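/- Let $p\in\mathbb Z$, $p\neq 0$, and consider the sixth Painlevé equation $$y''=\tfrac12\Big[\tfrac1y+\tfrac1{y-1}+\tfrac1{y-x}\Big]y'^2-\Big[\tfrac1x+\tfrac1{x-1}+\tfrac1{y-x}\Big]y'+\frac{y(y-1)(y-x)}{x^2(x-1)^2}\Big[\alpha+\beta\frac{x}{y^2}+\gamma\frac{x-1}{(y-1)^2}+\delta\frac{x(x-1)}{(y-x)^2}\Big]$$ with $\alpha=\frac12(\theta_\infty-1)^2$, $\beta=-\frac12\theta_0^2$, $\gamma=\frac12\theta_1^2$, $\frac12-\delta=\frac12\theta_x^2$, where $\theta_0=2p$, $\theta_x=\theta_1=0$, $\theta_\infty=1$. All logarithms are principal. Put $$\kappa_p=4\ln 2-\Big(2\sum_{k=1}^{|p|}\frac1k-\frac1{|p|}\Big)\qquad(\text{so } \kappa_{\pm1}=4\ln 2-1).$$ Let $\rho_0\in\mathbb C$, $0<r\le 1$, $0<\varphi\le\pi$, and let $y$ be a meromorphic solution in the sector $0<|x|<r$, $|\arg x|<\varphi$, such that $$y(x)=x\left[1-p^2(\ln x+\rho_0)^2+o(1)\right],\qquad x\to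 0 .$$ Then $y$ continues to a meromorphic solution on $\mathbb C\setminus((-\infty,0]\cup[1,\infty))$, the same behavior at $0$ holds in this domain, and: 1. if $\pi-i(\kappa_p+\rho_0)\ne 0$, then $$y(x)=1-p^2\Big(\ln\frac1x+\rho_\infty\Big)^2+o(1),\quad x\to\infty,\ \operatorname{Im}x>0,\qquad \rho_\infty=\frac{\pi(\kappa_p+\rho_0)}{\pi-i(\kappa_p+\rho_0)}-\kappa_p;$$ 2. if $\kappa_p+\rho_0\neq0$, then $$y(x)=1-\frac{1}{p^2(\ln(1-x)+\rho_1)^2}+o\Big(\frac1{\ln^4(1-x)}\Big),\quad x\to1,\qquad \rho_1=\frac{\pi^2}{\kappa_p+\rho_0}-\kappa_p,$$ where $x\to 1$ in $\mathbb C\setminus((-\infty,0]\cup[1,\infty))$. -/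

import Mathlib

noncomputable section

namespace PainleveSix

open Filter Topology

/-- Right-hand side of the sixth Painlevé equation with coefficients `α, β, γ, δ`,
as a function of `x`, `y` and `y' = dy/dx`. -/
def rhs (α β γ δ x y y' : ℂ) : ℂ :=
  (1 / 2) * (1 / y + 1 / (y - 1) + 1 / (y - x)) * y' ^ 2
    - (1 / x + 1 / (x - 1) + 1 / (y - x)) * y'
    + y * (y - 1) * (y - x) / (x ^ 2 * (x - 1) ^ 2) *
      (α + β * (x / y ^ 2) + γ * ((x - 1) / (y - 1) ^ 2)
        + δ * (x * (x - 1) / (y - x) ^ 2))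

/-- `y` is a meromorphic solution on the (open) set `U` of the sixth Painlevé equation with
`α = (θ∞ - 1)² / 2`, `-β = θ₀² / 2`, `γ = θ₁² / 2`, `1/2 - δ = θₓ² / 2`.
Off a set that is discrete and closed in `U`, the function avoids the values `0, 1, x`,
where the right-hand side is not defined, and the equation holds. -/
def IsSolutionOn (θ₀ θₓ θ₁ θinf : ℂ) (U : Set ℂ) (y : ℂ → ℂ) : Prop :=
  MeromorphicOn y U ∧
    ∀ᶠ x in codiscreteWithin U, y x ≠ 0 ∧ y x ≠ 1 ∧ y x ≠ x ∧
      deriv (deriv y) x =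
        rhs ((θinf - 1) ^ 2 / 2) (-(θ₀ ^ 2 / 2)) (θ₁ ^ 2 / 2) (1 / 2 - θₓ ^ 2 / 2)
          x (y x) (deriv y x)

/-- The open sector `0 < |x| < r`, `|arg x| < φ`. -/
def sector (r φ : ℝ) : Set ℂ :=
  {x | 0 < ‖x‖ ∧ ‖x‖ < r ∧ |Complex.arg x| < φ}

/-- The doubly slit plane `ℂ \ ((-∞, 0] ∪ [1, ∞))`, on which the principal branches of
`log x` and `log (1 - x)` are both holomorphic. -/
def slitDomain : Set ℂ :=
  {x | x ∈ Complex.slitPlane ∧ 1 - x ∈ Complex.slitPlane}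

/-- `y(x) = x [1 - p² (log x + ρ)² + o(1)]` as `x → 0` in `U`. -/
def BehaviorAtZero (p : ℤ) (ρ : ℂ) (U : Set ℂ) (y : ℂ → ℂ) : Prop :=
  Tendsto (fun x => y x / x - (1 - (p : ℂ) ^ 2 * (Complex.log x + ρ) ^ 2)) (𝓝[U] 0) (𝓝 0)

/-- `y(x) = 1 - p² (log (1/x) + ρ)² + o(1)` as `x → ∞` in `U`. -/
def BehaviorAtInfinity (p : ℤ) (ρ : ℂ) (U : Set ℂ) (y : ℂ → ℂ) : Prop :=
  Tendsto (fun x => y x - (1 - (p : ℂ) ^ 2 * (Complex.log (1 / x) + ρ) ^ 2))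
    (Bornology.cobounded ℂ ⊓ 𝓟 U) (𝓝 0)

/-- `y(x) = 1 - 1 / (p² (log (1-x) + ρ)²) + o(1 / log⁴ (1-x))` as `x → 1` in `U`. -/
def BehaviorAtOne (p : ℤ) (ρ : ℂ) (U : Set ℂ) (y : ℂ → ℂ) : Prop :=
  (fun x => y x - (1 - 1 / ((p : ℂ) ^ 2 * (Complex.log (1 - x) + ρ) ^ 2)))
    =o[𝓝[U] 1] fun x => 1 / Complex.log (1 - x) ^ 4

/-- The constant `4 log 2 - (2 H - 1/|p|)`, where `H = 1 + 1/2 + ⋯ + 1/|p|`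
(for `p = ±1` this is `4 log 2 - 1`). -/
def shift (p : ℤ) : ℝ :=
  4 * Real.log 2 - (2 * (harmonic p.natAbs : ℝ) - 1 / (p.natAbs : ℝ))

/-- The parameter at `x = ∞` as a function of the parameter `ρ₀` at `x = 0`. -/
def rhoInfinity (p : ℤ) (ρ₀ : ℂ) : ℂ :=
  Real.pi * (shift p + ρ₀) / (Real.pi - Complex.I * (shift p + ρ₀)) - shift p

/-- The parameter at `x = 1` as a function of the parameter `ρ₀` at `x = 0`. -/
def rhoOne (p : ℤ) (ρ₀ : ℂ) : ℂ :=
  (Real.pi : ℂ) ^ 2 / (shift p + ρ₀) - shift p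

end PainleveSix

end

/-! ### Bäcklund transformations and symmetries of the Hamiltonian system. -/

noncomputable section

namespace PainleveSix

open Filter Topology

/-! The equation is the `q`-component of a Hamiltonian system whose parameters satisfy α₀ + α₁ + 2α₂
+ α₃ + α₄ = 1 and on which the affine Weyl group of type D₄ acts by birational maps. Here α₀ = α₁ =
α₃ = 0 and α₄ = 2p. If α₄ = 0, the line `q = 0` is invariant and on it the conjugate variable
satisfies a Riccati equation, linearized by the hypergeometric equation of the complete elliptic
integral K: its solutions are `ric A B`, built on `lam A B` = A K(x) + B K(1 - x). Alternating the
reflection `mapC` (α₄ ↦ -α₄) with the translation `mapT` (α₄ ↦ 2 - α₄) leads from α₄ = 0 to α₄ =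
2|p|. The solution sought is therefore `chain` applied to `(0, ric A B x)`, an explicit function
that is meromorphic on the whole slit plane.

Behavior at 0. By `exists_legH_eq`, K(1 - x)/K(x) is -(log x - 4 log 2)/π plus a holomorphic
function vanishing at 0, whence -1/(x p) = log x - 4 log 2 - πA/B + small (`ric_asymptotics`). In
the variables q/x and 1/(x p) each reflection is a simple rational map with negligible corrections;
a translation preserves the form 1 - n²s² of q/x and shifts s by reciprocals of integers. These
shifts add up to 2H - 1/|p| (`chain_aux`, `tendsto_chain`).

Behavior at 1 and ∞. The Möbius symmetries `symOne` (x ↦ 1 - x) and `symInf` (x ↦ 1/x) commute with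
the whole chain. On the Riccati solutions the former exchanges A and B, and the latter replaces B by
B + iA in the upper half-plane (`lam_eq_lam_inv`). The expansion at 0 then gives the other two, and
the parameters at 0, 1, ∞ are linked by the linear connection formulas of K.

Uniqueness. The given y must be identified with this solution. Cauchy's estimate turns the
asymptotics of y into asymptotics of y', hence of the conjugate variable (`asy_conj`). Undoing the
chain gives a solution with α₄ = 0 and q/x → 0. Its q vanishes by a monotonicity argument on the
positive axis (`fst_eq_zero_of_asymptotics`), and the Riccati solution is fixed by its logarithmic
parameter (`eq_ric_of_asymptotics`). The result is `eq_chain_of_behaviorAtZero`. -/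

/-- The right-hand side `∂H/∂p` of the Hamiltonian form of the sixth Painlevé equation with root
parameters `α₀ = α₁ = α₃ = a`, `α₂ = b`, `α₄ = 1 - 3 a - 2 b`. -/
def hamQ (a b x q p : ℂ) : ℂ :=
  (2 * q * (q - 1) * (q - x) * p - ((1 - 3 * a - 2 * b) * ((q - 1) * (q - x))
    + a * (q * (q - x)) + (a - 1) * (q * (q - 1)))) / (x * (x - 1))

/-- The right-hand side `-∂H/∂q` of the Hamiltonian form of the sixth Painlevé equation with root
parameters `α₀ = α₁ = α₃ = a`, `α₂ = b`, `α₄ = 1 - 3 a - 2 b`. -/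
def hamP (a b x q p : ℂ) : ℂ :=
  (-(3 * q ^ 2 - 2 * (1 + x) * q + x) * p ^ 2 + ((1 - 3 * a - 2 * b) * (2 * q - 1 - x)
    + a * (2 * q - x) + (a - 1) * (2 * q - 1)) * p - b * (a + b)) / (x * (x - 1))

/-- The Hamiltonian system holds at the point `x` for the curve `z = (q, p)`. -/
def HamAt (a b : ℂ) (z : ℂ → ℂ × ℂ) (x : ℂ) : Prop :=
  HasDerivAt (fun t => (z t).1) (hamQ a b x (z x).1 (z x).2) x ∧
    HasDerivAt (fun t => (z t).2) (hamP a b x (z x).1 (z x).2) x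

/-- The reflection in the root `α₂`. -/
def mapA (b : ℂ) (z : ℂ × ℂ) : ℂ × ℂ := (z.1 + b / z.2, z.2)

/-- The product of the reflections in the roots `α₀` and `α₃` (and `α₁`). -/
def mapB (a x : ℂ) (z : ℂ × ℂ) : ℂ × ℂ := (z.1, z.2 - a / (z.1 - x) - a / (z.1 - 1))

/-- The reflection in the root `α₄`. -/
def mapC (c : ℂ) (z : ℂ × ℂ) : ℂ × ℂ := (z.1, z.2 - c / z.1)

/-- The translation `α₄ ↦ 2 - α₄` of the parameters with `α₀ = α₁ = α₃ = 0`, `α₂ = a`. -/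
def mapT (a x : ℂ) (z : ℂ × ℂ) : ℂ × ℂ :=
  mapA a (mapB a x (mapA (2 * a) (mapB a x (mapA a z))))

theorem mapA_neg (b : ℂ) (z : ℂ × ℂ) : mapA (-b) (mapA b z) = z := by
  simp [mapA, neg_div]

theorem mapB_neg (a x : ℂ) (z : ℂ × ℂ) : mapB (-a) x (mapB a x z) = z := by
  ext
  · simp [mapB]
  · simp only [mapB, neg_div]; ring

theorem mapC_neg (c : ℂ) (z : ℂ × ℂ) : mapC (-c) (mapC c z) = z := by
  simp [mapC, neg_div]

/-- The word defining `mapT` is a palindrome in its parameters, so negating `a` inverts it letter by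
letter. With total division this needs no regularity. -/
theorem mapT_neg (a x : ℂ) (z : ℂ × ℂ) : mapT (-a) x (mapT a x z) = z := by
  simp only [mapT, mul_neg, mapA_neg, mapB_neg]

theorem HamAt.mapA {a b x : ℂ} {z : ℂ → ℂ × ℂ} (h : HamAt a b z x) (hx : x ≠ 0) (hx1 : x ≠ 1)
    (hp : (z x).2 ≠ 0) : HamAt (a + b) (-b) (fun t => mapA b (z t)) x := by
  obtain ⟨h1, h2⟩ := h
  have hx1' : x - 1 ≠ 0 := sub_ne_zero.2 hx1
  refine ⟨?_, ?_⟩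
  · refine (h1.add ((hasDerivAt_const x b).div h2 hp)).congr_deriv ?_
    simp only [hamQ, hamP, PainleveSix.mapA]
    generalize (z x).1 = q at *
    generalize (z x).2 = p at *
    field_simp
    ring
  · refine h2.congr_deriv ?_
    simp only [hamP, PainleveSix.mapA]
    generalize (z x).1 = q at *
    generalize (z x).2 = p at *
    field_simp
    ring

theorem HamAt.mapB {a b x : ℂ} {z : ℂ → ℂ × ℂ} (h : HamAt a b z x) (hx : x ≠ 0) (hx1 : x ≠ 1)
    (hq : (z x).1 ≠ x) (hq1 : (z x).1 ≠ 1) :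
    HamAt (-a) (b + 3 * a) (fun t => mapB a t (z t)) x := by
  obtain ⟨h1, h2⟩ := h
  have hx1' : x - 1 ≠ 0 := sub_ne_zero.2 hx1
  have hq' := sub_ne_zero.2 hq
  have hq1' := sub_ne_zero.2 hq1
  refine ⟨?_, ?_⟩
  · refine h1.congr_deriv ?_
    simp only [hamQ, PainleveSix.mapB]
    generalize (z x).1 = q at *
    generalize (z x).2 = p at *
    field_simp
    ring
  · refine ((h2.sub ((hasDerivAt_const x a).div (h1.sub (hasDerivAt_id x)) hq')).sub
      ((hasDerivAt_const x a).div (h1.sub_const 1) hq1')).congr_deriv ?_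
    simp only [hamQ, hamP, PainleveSix.mapB, Pi.sub_apply, id]
    generalize (z x).1 = q at *
    generalize (z x).2 = p at *
    field_simp
    ring

/-- The alternative `c = 0` is needed at the start of the chain, where `q` vanishes identically but
the reflection is the identity. -/
theorem HamAt.mapC {a b c x : ℂ} {z : ℂ → ℂ × ℂ} (h : HamAt a b z x) (hx : x ≠ 0) (hx1 : x ≠ 1)
    (hc : c = 1 - 3 * a - 2 * b) (hq : c = 0 ∨ (z x).1 ≠ 0) :
    HamAt a (b + c) (fun t => mapC c (z t)) x := by
  obtain ⟨h1, h2⟩ := h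
  rcases hq with rfl | hq
  · simpa [PainleveSix.mapC, HamAt] using And.intro h1 h2
  have hx1' : x - 1 ≠ 0 := sub_ne_zero.2 hx1
  subst hc
  refine ⟨?_, ?_⟩
  · refine h1.congr_deriv ?_
    simp only [hamQ, PainleveSix.mapC]
    generalize (z x).1 = q at *
    generalize (z x).2 = p at *
    field_simp
    ring
  · refine (h2.sub ((hasDerivAt_const x (1 - 3 * a - 2 * b)).div h1 hq)).congr_deriv ?_
    simp only [hamQ, hamP, PainleveSix.mapC]
    generalize (z x).1 = q at *
    generalize (z x).2 = p at *
    field_simp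
    ring

/-- The product of the quantities that have to be nonzero for `mapT a x` to be regular at `z`. -/
def regT (a x : ℂ) (z : ℂ × ℂ) : ℂ :=
  let z1 := mapA a z
  let z2 := mapB a x z1
  let z3 := mapA (2 * a) z2
  let z4 := mapB a x z3
  z.2 * ((z1.1 - x) * (z1.1 - 1)) * (z2.2 * ((z3.1 - x) * (z3.1 - 1))) * z4.2

theorem HamAt.mapT {a x : ℂ} {z : ℂ → ℂ × ℂ} (h : HamAt 0 a z x) (hx : x ≠ 0) (hx1 : x ≠ 1)
    (hr : regT a x (z x) ≠ 0) : HamAt 0 (-a) (fun t => mapT a t (z t)) x := by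
  simp only [regT, mul_ne_zero_iff, sub_ne_zero] at hr
  obtain ⟨⟨⟨r1, r2, r3⟩, r4, r5, r6⟩, r7⟩ := hr
  -- The parameters (α₀, α₂) run through (0, a), (a, -a), (-a, 2a), (a, -2a), (-a, a), (0, -a).
  have k1 := h.mapA hx hx1 r1
  have k2 := k1.mapB hx hx1 r2 r3
  rw [show -(0 + a) = -a by ring, show -a + 3 * (0 + a) = 2 * a by ring,
    show 0 + a = a by ring] at k2
  have k3 := k2.mapA hx hx1 r4
  rw [show -a + 2 * a = a by ring] at k3
  have k4 := k3.mapB hx hx1 r5 r6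
  rw [show -(2 * a) + 3 * a = a by ring] at k4
  have k5 := k4.mapA hx hx1 r7
  rwa [show -a + a = 0 by ring] at k5

/-- The symmetry induced by the Möbius transformation that fixes `0`, `1` and exchanges `x`, `∞`. -/
def symOne (b x : ℂ) (z : ℂ × ℂ) : ℂ × ℂ :=
  ((1 - x) * z.1 / (z.1 - x), -((z.1 - x) ^ 2 * z.2 + b * (z.1 - x)) / (x * (1 - x)))

/-- The symmetry induced by the Möbius transformation that fixes `0`, `∞` and exchanges `x`, `1`. -/
def symInf (x : ℂ) (z : ℂ × ℂ) : ℂ × ℂ := (z.1 / x, x * z.2)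

theorem symInf_mapA {x : ℂ} (hx : x ≠ 0) (b : ℂ) (z : ℂ × ℂ) :
    symInf x (mapA b z) = mapA b (symInf x z) := by
  ext
  · simp only [symInf, mapA]
    by_cases h : z.2 = 0
    · simp [h]
    · field_simp
  · simp [symInf, mapA]

theorem symInf_mapB {x : ℂ} (hx : x ≠ 0) (a : ℂ) (z : ℂ × ℂ) :
    symInf x (mapB a x z) = mapB a (1 / x) (symInf x z) := by
  ext
  · simp [symInf, mapB]
  · simp only [symInf, mapB]
    rw [show z.1 / x - 1 / x = (z.1 - 1) / x by ring,
      show z.1 / x - 1 = (z.1 - x) / x by field_simp, div_div_eq_mul_div, div_div_eq_mul_div]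
    ring

theorem symInf_mapC {x : ℂ} (c : ℂ) (z : ℂ × ℂ) :
    symInf x (mapC c z) = mapC c (symInf x z) := by
  ext
  · simp [symInf, mapC]
  · simp only [symInf, mapC]
    rw [div_div_eq_mul_div]
    ring

theorem symInf_mapT {x : ℂ} (hx : x ≠ 0) (a : ℂ) (z : ℂ × ℂ) :
    symInf x (mapT a x z) = mapT a (1 / x) (symInf x z) := by
  simp only [mapT, symInf_mapA hx, symInf_mapB hx]

/-- The second component of `symOne` contains α₂, so commuting it past a reflection changes its
parameter in the same way as the reflection changes α₂. -/
theorem symOne_mapA {b x : ℂ} {z : ℂ × ℂ} (hq : z.1 ≠ x) (hp : z.2 ≠ 0) (hx : x ≠ 0) (hx1 : x ≠ 1)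
    (hq' : (mapA b z).1 ≠ x) : symOne (-b) x (mapA b z) = mapA b (symOne b x z) := by
  have hx1' : 1 - x ≠ 0 := sub_ne_zero.2 hx1.symm
  have h1 := sub_ne_zero.2 hq
  simp only [mapA] at hq'
  have h2 : z.1 * z.2 + b - x * z.2 ≠ 0 := by
    intro h
    apply hq'
    field_simp
    linear_combination h
  have h3 : (z.1 - x) ^ 2 * z.2 + b * (z.1 - x) ≠ 0 := by
    rw [show (z.1 - x) ^ 2 * z.2 + b * (z.1 - x) = (z.1 - x) * (z.1 * z.2 + b - x * z.2) by ring]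
    exact mul_ne_zero h1 h2
  have h4 : z.1 + b / z.2 - x = (z.1 * z.2 + b - x * z.2) / z.2 := by field_simp
  ext
  · simp only [symOne, mapA]
    rw [h4, show -((z.1 - x) ^ 2 * z.2 + b * (z.1 - x)) / (x * (1 - x)) =
      -((z.1 - x) * (z.1 * z.2 + b - x * z.2)) / (x * (1 - x)) by ring]
    field_simp
    ring
  · simp only [symOne, mapA]
    rw [h4]
    field_simp
    ring

theorem symOne_mapB {a b x : ℂ} {z : ℂ × ℂ} (hq : z.1 ≠ x) (hq1 : z.1 ≠ 1) (hx : x ≠ 0)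
    (hx1 : x ≠ 1) : symOne (b + 3 * a) x (mapB a x z) = mapB a (1 - x) (symOne b x z) := by
  have hx1' : 1 - x ≠ 0 := sub_ne_zero.2 hx1.symm
  have h1 := sub_ne_zero.2 hq
  have h2 := sub_ne_zero.2 hq1
  ext
  · simp [symOne, mapB]
  · simp only [symOne, mapB]
    rw [show (1 - x) * z.1 / (z.1 - x) - (1 - x) = (1 - x) * x / (z.1 - x) by field_simp; ring,
      show (1 - x) * z.1 / (z.1 - x) - 1 = -(x * (z.1 - 1)) / (z.1 - x) by field_simp; ring]
    field_simp
    ring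

theorem symOne_mapC {b c x : ℂ} {z : ℂ × ℂ} (hq : z.1 ≠ x) (hq0 : c = 0 ∨ z.1 ≠ 0) (hx : x ≠ 0)
    (hx1 : x ≠ 1) : symOne (b + c) x (mapC c z) = mapC c (symOne b x z) := by
  have hx1' : 1 - x ≠ 0 := sub_ne_zero.2 hx1.symm
  have h1 := sub_ne_zero.2 hq
  rcases hq0 with rfl | hq0
  · simp [mapC, symOne]
  ext
  · simp [symOne, mapC]
  · simp only [symOne, mapC]
    field_simp
    ring

theorem symOne_mapT {a x : ℂ} {z : ℂ × ℂ} (hx : x ≠ 0) (hx1 : x ≠ 1) (hr : regT a x z ≠ 0)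
    (hq : z.1 ≠ x) (hq' : (mapT a x z).1 ≠ x) :
    symOne (-a) x (mapT a x z) = mapT a (1 - x) (symOne a x z) := by
  simp only [regT, mul_ne_zero_iff, sub_ne_zero] at hr
  obtain ⟨⟨⟨r1, r2, r3⟩, r4, r5, r6⟩, r7⟩ := hr
  have k1 := symOne_mapA (b := a) hq r1 hx hx1 r2
  have k2 := symOne_mapB (a := a) (b := -a) r2 r3 hx hx1
  have k3 := symOne_mapA (b := 2 * a) (z := mapB a x (mapA a z)) r2 r4 hx hx1 r5
  have k4 := symOne_mapB (a := a) (b := -(2 * a)) r5 r6 hx hx1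
  have k5 := symOne_mapA (b := a) (z := mapB a x (mapA (2 * a) (mapB a x (mapA a z)))) r5 r7 hx hx1
    hq'
  rw [show -a + 3 * a = 2 * a by ring] at k2
  rw [show -(2 * a) + 3 * a = a by ring] at k4
  simp only [mapT]
  rw [k5, k4, k3, k2, k1]

end PainleveSix

end

/-! ### The Hamiltonian system versus the second-order equation, and meromorphic solutions. -/

noncomputable section

namespace PainleveSix

open Filter Topology

/-- The variable `p` conjugate to `q = y`, in terms of `x`, `y` and `y'`, for `α₄ = c`. -/
def conj (c x q q' : ℂ) : ℂ :=
  (x * (x - 1) * q' + c * ((q - 1) * (q - x)) - q * (q - 1)) / (2 * q * (q - 1) * (q - x))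

/-- Differentiating q' = ∂H/∂p and substituting both equations eliminates the conjugate variable.
The second-order equation contains θ₀ only through θ₀², so α₄ = 1 - 2b needs to match 2p up to sign
only; this allows working with |p|. -/
theorem HamAt.deriv_deriv {b x : ℂ} {z : ℂ → ℂ × ℂ} (h : ∀ᶠ t in 𝓝 x, HamAt 0 b z t) (hx : x ≠ 0)
    (hx1 : x ≠ 1) (h0 : (z x).1 ≠ 0) (h1 : (z x).1 ≠ 1) (hqx : (z x).1 ≠ x) {p : ℂ}
    (hp : (1 - 2 * b) ^ 2 = (2 * p) ^ 2) :
    deriv (deriv fun t => (z t).1) x =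
      rhs ((1 - 1) ^ 2 / 2) (-((2 * p) ^ 2 / 2)) (0 ^ 2 / 2) (1 / 2 - 0 ^ 2 / 2)
        x (z x).1 (deriv (fun t => (z t).1) x) := by
  obtain ⟨k1, k2⟩ := h.self_of_nhds
  have e : deriv (fun t => (z t).1) =ᶠ[𝓝 x] fun t => hamQ 0 b t (z t).1 (z t).2 :=
    h.mono fun t ht => ht.1.deriv
  have hx1' : x - 1 ≠ 0 := sub_ne_zero.2 hx1
  have h1' := sub_ne_zero.2 h1
  have hqx' := sub_ne_zero.2 hqx
  have hid := hasDerivAt_id x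
  have key : HasDerivAt (fun t => hamQ 0 b t (z t).1 (z t).2) _ x :=
    (((((k1.const_mul 2).mul (k1.sub_const 1)).mul (k1.sub hid)).mul k2).sub
      (((((k1.sub_const 1).mul (k1.sub hid)).const_mul (1 - 3 * 0 - 2 * b)).add
        ((k1.mul (k1.sub hid)).const_mul 0)).add ((k1.mul (k1.sub_const 1)).const_mul
          (0 - 1)))).div (hid.mul (hid.sub_const 1)) (mul_ne_zero hx hx1')
  rw [e.deriv_eq, key.deriv, e.self_of_nhds, ← hp]
  simp only [hamQ, hamP, rhs, Pi.mul_apply, Pi.sub_apply, Pi.add_apply, id]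
  generalize (z x).1 = q at *
  generalize (z x).2 = p at *
  field_simp
  ring

/-- `conj` solves the first Hamilton equation for the momentum, so that equation is automatic; the
second one is the given second-order equation. -/
theorem hamAt_of_deriv_deriv {b x : ℂ} {y : ℂ → ℂ} (hy : AnalyticAt ℂ y x) (hx : x ≠ 0)
    (hx1 : x ≠ 1) (h0 : y x ≠ 0) (h1 : y x ≠ 1) (hqx : y x ≠ x) {p : ℂ}
    (hp : (1 - 2 * b) ^ 2 = (2 * p) ^ 2)
    (h : deriv (deriv y) x = rhs ((1 - 1) ^ 2 / 2) (-((2 * p) ^ 2 / 2)) (0 ^ 2 / 2)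
      (1 / 2 - 0 ^ 2 / 2) x (y x) (deriv y x)) :
    HamAt 0 b (fun t => (y t, conj (1 - 2 * b) t (y t) (deriv y t))) x := by
  have k1 := hy.differentiableAt.hasDerivAt
  have k2 := hy.deriv.differentiableAt.hasDerivAt
  have hx1' : x - 1 ≠ 0 := sub_ne_zero.2 hx1
  have h1' := sub_ne_zero.2 h1
  have hqx' := sub_ne_zero.2 hqx
  have hid := hasDerivAt_id x
  rw [h, ← hp] at k2
  constructor
  · refine k1.congr_deriv ?_
    simp only [hamQ, conj]
    generalize deriv y x = q' at *
    generalize y x = q at *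
    field_simp
    ring
  · have key : HasDerivAt (fun t => conj (1 - 2 * b) t (y t) (deriv y t)) _ x :=
      ((((hid.mul (hid.sub_const 1)).mul k2).add
        (((k1.sub_const 1).mul (k1.sub hid)).const_mul (1 - 2 * b))).sub
        (k1.mul (k1.sub_const 1))).div
        (((k1.const_mul 2).mul (k1.sub_const 1)).mul (k1.sub hid))
        (by simp [h0, h1', hqx'])
    refine key.congr_deriv ?_
    simp only [hamP, conj, rhs, Pi.mul_apply, Pi.sub_apply, Pi.add_apply, id]
    generalize deriv y x = q' at *
    generalize y x = q at *
    field_simp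
    ring

/-! ### Codiscrete sets -/

theorem eventually_codiscreteWithin_iff {U : Set ℂ} (hU : IsOpen U) {P : ℂ → Prop} :
    (∀ᶠ x in codiscreteWithin U, P x) ↔ ∀ x ∈ U, ∀ᶠ t in 𝓝[≠] x, P t := by
  simp only [Filter.Eventually, mem_codiscreteWithin_iff_forall_mem_nhdsNE]
  refine forall₂_congr fun x hx => ⟨fun h => ?_, fun h => mem_of_superset h fun t ht => Or.inl ht⟩
  filter_upwards [h, mem_nhdsWithin_of_mem_nhds (hU.mem_nhds hx)] with t ht ht'
  exact ht.resolve_right fun k => k ht'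

/-- A property that holds off a discrete closed subset of an open set holds near the points of
such a set. -/
theorem eventually_codiscreteWithin_nhds {U : Set ℂ} (hU : IsOpen U) {P : ℂ → Prop}
    (h : ∀ᶠ x in codiscreteWithin U, P x) : ∀ᶠ x in codiscreteWithin U, ∀ᶠ t in 𝓝 x, P t := by
  rw [eventually_codiscreteWithin_iff hU] at h ⊢
  intro x hx
  have := (eventually_eventually_nhdsWithin (s := {x}ᶜ)).2 (h x hx)
  filter_upwards [this, self_mem_nhdsWithin] with t ht ht'
  rwa [isOpen_compl_singleton.nhdsWithin_eq ht'] at ht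

theorem mem_of_eventually_codiscreteWithin {U : Set ℂ} : ∀ᶠ x in codiscreteWithin U, x ∈ U :=
  self_mem_codiscreteWithin U

theorem exists_of_eventually_codiscreteWithin {U : Set ℂ} (hU : IsOpen U) (hne : U.Nonempty)
    {P : ℂ → Prop} (h : ∀ᶠ x in codiscreteWithin U, P x) : ∃ x ∈ U, P x := by
  obtain ⟨x, hx⟩ := hne
  have := (eventually_codiscreteWithin_iff hU).1 (h.and mem_of_eventually_codiscreteWithin) x hx
  obtain ⟨t, h1, h2⟩ := this.exists
  exact ⟨t, h2, h1⟩

/-- A meromorphic function on a preconnected open set vanishes off a discrete set, or is nonzero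
off a discrete set. -/
theorem MeromorphicOn.eq_zero_or_ne_zero {U : Set ℂ} (hU : IsOpen U) (hc : IsPreconnected U)
    {f : ℂ → ℂ} (hf : MeromorphicOn f U) :
    (∀ᶠ x in codiscreteWithin U, f x = 0) ∨ ∀ᶠ x in codiscreteWithin U, f x ≠ 0 := by
  simp only [eventually_codiscreteWithin_iff hU]
  by_cases h : ∃ x ∈ U, meromorphicOrderAt f x ≠ ⊤
  · right
    obtain ⟨x, hx, hxo⟩ := h
    intro t ht
    exact (meromorphicOrderAt_ne_top_iff_eventually_ne_zero (hf t ht)).1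
      (hf.meromorphicOrderAt_ne_top_of_isPreconnected hc hx ht hxo)
  · left
    push Not at h
    intro x hx
    exact meromorphicOrderAt_eq_top_iff.1 (h x hx)

/-- A meromorphic function on a preconnected open set whose derivative vanishes off a discrete set
is constant off a discrete set. -/
theorem MeromorphicOn.eq_const_of_hasDerivAt_zero {U : Set ℂ} (hU : IsOpen U)
    (hc : IsPreconnected U) (hne : U.Nonempty) {f : ℂ → ℂ} (hf : MeromorphicOn f U)
    (h : ∀ᶠ x in codiscreteWithin U, HasDerivAt f 0 x) :
    ∃ c, ∀ᶠ x in codiscreteWithin U, f x = c := by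
  obtain ⟨x, hx, hx'⟩ := exists_of_eventually_codiscreteWithin hU hne
    (eventually_codiscreteWithin_nhds hU h)
  refine ⟨f x, ?_⟩
  have h1 : ∀ᶠ t in 𝓝 x, f t = f x := by
    obtain ⟨ε, hε, hb⟩ := Metric.eventually_nhds_iff_ball.1 hx'
    filter_upwards [Metric.ball_mem_nhds x hε] with t ht
    refine Metric.isOpen_ball.is_const_of_deriv_eq_zero (convex_ball x ε).isPreconnected
      (fun s hs => (hb s hs).differentiableAt.differentiableWithinAt)
      (fun s hs => (hb s hs).deriv) ht (Metric.mem_ball_self hε)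
  rcases MeromorphicOn.eq_zero_or_ne_zero hU hc
    (f := fun t => f t - f x) (hf.sub (MeromorphicOn.const _)) with h2 | h2
  · exact h2.mono fun t ht => sub_eq_zero.1 ht
  · exfalso
    have h3 := (eventually_codiscreteWithin_iff hU).1 h2 x hx
    obtain ⟨t, ht, ht'⟩ := (h3.and (h1.filter_mono nhdsWithin_le_nhds)).exists
    exact ht (sub_eq_zero.2 ht')

/-- The curve `z = (q, p)` is a meromorphic solution of the Hamiltonian system on `U`. -/
structure IsHam (a b : ℂ) (U : Set ℂ) (z : ℂ → ℂ × ℂ) : Prop where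
  mero_fst : MeromorphicOn (fun x => (z x).1) U
  mero_snd : MeromorphicOn (fun x => (z x).2) U
  ham : ∀ᶠ x in codiscreteWithin U, HamAt a b z x

theorem meromorphicOn_mapA {U : Set ℂ} {z : ℂ → ℂ × ℂ} (b : ℂ)
    (h1 : MeromorphicOn (fun x => (z x).1) U) (h2 : MeromorphicOn (fun x => (z x).2) U) :
    MeromorphicOn (fun x => (mapA b (z x)).1) U ∧
    MeromorphicOn (fun x => (mapA b (z x)).2) U :=
  ⟨h1.add ((MeromorphicOn.const b).div h2), h2⟩

theorem meromorphicOn_mapB {U : Set ℂ} {z : ℂ → ℂ × ℂ} (a : ℂ)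
    (h1 : MeromorphicOn (fun x => (z x).1) U) (h2 : MeromorphicOn (fun x => (z x).2) U) :
    MeromorphicOn (fun x => (mapB a x (z x)).1) U ∧
    MeromorphicOn (fun x => (mapB a x (z x)).2) U :=
  ⟨h1, (h2.sub ((MeromorphicOn.const a).div (h1.sub MeromorphicOn.id))).sub
    ((MeromorphicOn.const a).div (h1.sub (MeromorphicOn.const 1)))⟩

theorem meromorphicOn_mapC {U : Set ℂ} {z : ℂ → ℂ × ℂ} (b : ℂ)
    (h1 : MeromorphicOn (fun x => (z x).1) U) (h2 : MeromorphicOn (fun x => (z x).2) U) :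
    MeromorphicOn (fun x => (mapC b (z x)).1) U ∧
    MeromorphicOn (fun x => (mapC b (z x)).2) U :=
  ⟨h1, h2.sub ((MeromorphicOn.const b).div h1)⟩

theorem meromorphicOn_mapT {U : Set ℂ} {z : ℂ → ℂ × ℂ} (a : ℂ)
    (h1 : MeromorphicOn (fun x => (z x).1) U) (h2 : MeromorphicOn (fun x => (z x).2) U) :
    MeromorphicOn (fun x => (mapT a x (z x)).1) U ∧
    MeromorphicOn (fun x => (mapT a x (z x)).2) U := by
  obtain ⟨h1, h2⟩ := meromorphicOn_mapA a h1 h2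
  obtain ⟨h1, h2⟩ := meromorphicOn_mapB a h1 h2
  obtain ⟨h1, h2⟩ := meromorphicOn_mapA (2 * a) h1 h2
  obtain ⟨h1, h2⟩ := meromorphicOn_mapB a h1 h2
  exact meromorphicOn_mapA a h1 h2

theorem meromorphicOn_regT {U : Set ℂ} {z : ℂ → ℂ × ℂ} (a : ℂ)
    (h1 : MeromorphicOn (fun x => (z x).1) U) (h2 : MeromorphicOn (fun x => (z x).2) U) :
    MeromorphicOn (fun x => regT a x (z x)) U := by
  obtain ⟨g1, g2⟩ := meromorphicOn_mapA a h1 h2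
  obtain ⟨k1, k2⟩ := meromorphicOn_mapB a g1 g2
  obtain ⟨l1, l2⟩ := meromorphicOn_mapA (2 * a) k1 k2
  obtain ⟨m1, m2⟩ := meromorphicOn_mapB a l1 l2
  exact ((h2.mul ((g1.sub MeromorphicOn.id).mul (g1.sub (MeromorphicOn.const 1)))).mul
    (k2.mul ((l1.sub MeromorphicOn.id).mul (l1.sub (MeromorphicOn.const 1))))).mul m2

theorem IsHam.mapT {U : Set ℂ} (hU : U ⊆ slitDomain) {z : ℂ → ℂ × ℂ} {a : ℂ} (h : IsHam 0 a U z)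
    (hr : ∀ᶠ x in codiscreteWithin U, regT a x (z x) ≠ 0) :
    IsHam 0 (-a) U (fun x => mapT a x (z x)) := by
  obtain ⟨h1, h2⟩ := meromorphicOn_mapT a h.mero_fst h.mero_snd
  refine ⟨h1, h2, ?_⟩
  filter_upwards [hr, h.ham, mem_of_eventually_codiscreteWithin] with x hx hx' hxU
  refine hx'.mapT ?_ ?_ hx
  · rintro rfl
    simpa using (hU hxU).1
  · rintro rfl
    simpa using (hU hxU).2

theorem IsHam.mapC {U : Set ℂ} (hU : U ⊆ slitDomain) {z : ℂ → ℂ × ℂ} {b c : ℂ} (h : IsHam 0 b U z)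
    (hc : c = 1 - 2 * b) (hq : c = 0 ∨ ∀ᶠ x in codiscreteWithin U, (z x).1 ≠ 0) :
    IsHam 0 (b + c) U (fun x => mapC c (z x)) := by
  obtain ⟨h1, h2⟩ := meromorphicOn_mapC c h.mero_fst h.mero_snd
  refine ⟨h1, h2, ?_⟩
  have hq : ∀ᶠ x in codiscreteWithin U, c = 0 ∨ (z x).1 ≠ 0 := by
    rcases hq with hq | hq
    · exact Eventually.of_forall fun x => Or.inl hq
    · exact hq.mono fun x hx => Or.inr hx
  filter_upwards [hq, h.ham, mem_of_eventually_codiscreteWithin] with x hx hx' hxU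
  refine hx'.mapC ?_ ?_ (by rw [hc]; ring) hx
  · rintro rfl
    simpa using (hU hxU).1
  · rintro rfl
    simpa using (hU hxU).2

end PainleveSix

end

/-! ### Propagation of logarithmic asymptotics through the reflections. -/

noncomputable section

namespace PainleveSix

open Filter Topology

/-- Along the filter `l`, `x → 0` and `s → ∞` with `x s⁴ → 0`. -/
structure Scale {ι : Type*} (l : Filter ι) (x s : ι → ℂ) : Prop where
  ne : ∀ᶠ i in l, x i ≠ 0
  sne : ∀ᶠ i in l, s i ≠ 0
  inv : Tendsto (fun i => (s i)⁻¹) l (𝓝 0)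
  small : Tendsto (fun i => x i * s i ^ 4) l (𝓝 0)

/-- The asymptotics `q / x = V(s) + o(1)`, `1 / (x p) = W(s) + o(1)` along a filter. -/
structure Asy {ι : Type*} (l : Filter ι) (x s : ι → ℂ) (z : ι → ℂ × ℂ) (V W : ℂ → ℂ) : Prop where
  fst : Tendsto (fun i => (z i).1 / x i - V (s i)) l (𝓝 0)
  snd : Tendsto (fun i => (x i * (z i).2)⁻¹ - W (s i)) l (𝓝 0)

section asymptotics

variable {ι : Type*} {l : Filter ι} {x s : ι → ℂ}

theorem Scale.small_two (h : Scale l x s) : Tendsto (fun i => x i * s i ^ 2) l (𝓝 0) := by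
  have := h.small.mul (h.inv.pow 2)
  simp only [zero_mul] at this
  refine this.congr' ?_
  filter_upwards [h.sne] with i hi
  field_simp

theorem Scale.tendsto_zero (h : Scale l x s) : Tendsto x l (𝓝 0) := by
  have := h.small.mul (h.inv.pow 4)
  simp only [zero_mul] at this
  refine this.congr' ?_
  filter_upwards [h.sne] with i hi
  field_simp

/-- The scale does not change when `s` is perturbed by a bounded amount. -/
theorem Scale.of_tendsto_sub (h : Scale l x s) {s' : ι → ℂ} {c : ℂ}
    (hs : Tendsto (fun i => s' i - s i) l (𝓝 c)) : Scale l x s' := by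
  have h1 : Tendsto (fun i => 1 + (s' i - s i) * (s i)⁻¹) l (𝓝 1) := by
    simpa using tendsto_const_nhds.add (hs.mul h.inv)
  have h2 : ∀ᶠ i in l, s' i = s i * (1 + (s' i - s i) * (s i)⁻¹) := by
    filter_upwards [h.sne] with i hi
    field_simp
    ring
  refine ⟨h.ne, ?_, ?_, ?_⟩
  · filter_upwards [h2, h.sne, h1.eventually_ne one_ne_zero] with i hi h3 h4
    rw [hi]
    exact mul_ne_zero h3 h4
  · have := h.inv.mul (h1.inv₀ one_ne_zero)
    simp only [zero_mul] at this
    refine this.congr' ?_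
    filter_upwards [h2] with i hi
    conv_rhs => rw [hi]
    rw [mul_inv]
  · have := h.small.mul (h1.pow 4)
    simp only [zero_mul] at this
    refine this.congr' ?_
    filter_upwards [h2] with i hi
    conv_rhs => rw [hi]
    ring

theorem tendsto_quad (h : Scale l x s) (c₀ c₁ c₂ : ℂ) :
    Tendsto (fun i => (c₀ + c₁ * s i + c₂ * s i ^ 2) * (s i)⁻¹ ^ 2) l (𝓝 c₂) := by
  have : Tendsto (fun i => c₀ * (s i)⁻¹ ^ 2 + c₁ * (s i)⁻¹ + c₂) l (𝓝 c₂) := by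
    simpa using ((tendsto_const_nhds.mul (h.inv.pow 2)).add
      (tendsto_const_nhds.mul h.inv)).add_const c₂
  refine this.congr' ?_
  filter_upwards [h.sne] with i hi
  field_simp

theorem tendsto_linear (h : Scale l x s) (c₀ c₁ : ℂ) :
    Tendsto (fun i => (c₀ + c₁ * s i) * (s i)⁻¹) l (𝓝 c₁) := by
  have : Tendsto (fun i => c₀ * (s i)⁻¹ + c₁) l (𝓝 c₁) := by
    simpa using (tendsto_const_nhds.mul h.inv).add_const c₁
  refine this.congr' ?_
  filter_upwards [h.sne] with i hi
  field_simp

theorem eventually_ne_zero_of_quad (h : Scale l x s) {f : ι → ℂ} {c₀ c₁ c₂ : ℂ}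
    (hf : Tendsto (fun i => f i - (c₀ + c₁ * s i + c₂ * s i ^ 2)) l (𝓝 0))
    (hc : c₂ ≠ 0 ∨ c₁ ≠ 0) : ∀ᶠ i in l, f i ≠ 0 := by
  by_cases h2 : c₂ = 0
  · have h1 : c₁ ≠ 0 := hc.resolve_left (not_not.2 h2)
    have := (hf.mul h.inv).add (tendsto_linear h c₀ c₁)
    rw [zero_mul, zero_add] at this
    filter_upwards [this.eventually_ne h1] with i hi h0
    apply hi
    rw [h0, h2]
    ring
  · have := (hf.mul (h.inv.pow 2)).add (tendsto_quad h c₀ c₁ c₂)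
    rw [zero_mul, zero_add] at this
    filter_upwards [this.eventually_ne h2] with i hi h0
    apply hi
    rw [h0]
    ring

/-- Asymptotics of `w'`, where `1 / w' = 1 / w - α / v - e`, when `v = V + o(1)`, `w = W + o(1)`
with `V`, `W` at most quadratic in `s`. -/
theorem tendsto_reflect (h : Scale l x s) {α b c d : ℂ} {v w V W e W' : ι → ℂ}
    (hv : Tendsto (fun i => v i - V i) l (𝓝 0)) (hw : Tendsto (fun i => w i - W i) l (𝓝 0))
    (hV : Tendsto (fun i => V i * (s i)⁻¹ ^ 2) l (𝓝 c))
    (hW : Tendsto (fun i => W i * (s i)⁻¹ ^ 2) l (𝓝 b))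
    (hd : c - α * b = d) (hd0 : d ≠ 0) (he : Tendsto (fun i => e i * s i ^ 4) l (𝓝 0))
    (hv0 : ∀ᶠ i in l, v i ≠ 0) (hw0 : ∀ᶠ i in l, w i ≠ 0)
    (hW' : ∀ᶠ i in l, W i * V i = W' i * (V i - α * W i)) :
    Tendsto (fun i => ((w i)⁻¹ - α / v i - e i)⁻¹ - W' i) l (𝓝 0) := by
  have hD : Tendsto (fun i => (V i - α * W i) * (s i)⁻¹ ^ 2) l (𝓝 d) := by
    rw [← hd]
    refine (hV.sub (hW.const_mul α)).congr fun i => ?_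
    ring
  have hva : Tendsto (fun i => v i * (s i)⁻¹ ^ 2) l (𝓝 c) := by
    have := (hv.mul (h.inv.pow 2)).add hV
    rw [zero_mul, zero_add] at this
    exact this.congr fun i => by ring
  have hwa : Tendsto (fun i => w i * (s i)⁻¹ ^ 2) l (𝓝 b) := by
    have := (hw.mul (h.inv.pow 2)).add hW
    rw [zero_mul, zero_add] at this
    exact this.congr fun i => by ring
  have hevw : Tendsto (fun i => e i * w i * v i) l (𝓝 0) := by
    have := (he.mul hwa).mul hva
    rw [zero_mul, zero_mul] at this
    refine this.congr' ?_
    filter_upwards [h.sne] with i hi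
    field_simp
  have hED : Tendsto (fun i => (v i - V i) - α * (w i - W i) - e i * w i * v i) l (𝓝 0) := by
    simpa using (hv.sub (hw.const_mul α)).sub hevw
  have hE : Tendsto (fun i => (v i - α * w i - e i * w i * v i) * (s i)⁻¹ ^ 2) l (𝓝 d) := by
    have := (hED.mul (h.inv.pow 2)).add hD
    rw [zero_mul, zero_add] at this
    exact this.congr fun i => by ring
  -- This is the difference of v w / (v - αw - e w v) and V W / (V - αW) over a common denominator,
  -- numerator and denominator both divided by s⁴. The denominator then tends to d², and each term
  -- of the numerator carries a factor tending to 0.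
  have hN : Tendsto (fun i => ((V i - α * W i) * (s i)⁻¹ ^ 2 *
      (v i * (s i)⁻¹ ^ 2 * (w i - W i) + W i * (s i)⁻¹ ^ 2 * (v i - V i)) -
      W i * (s i)⁻¹ ^ 2 * (V i * (s i)⁻¹ ^ 2) *
        ((v i - V i) - α * (w i - W i) - e i * w i * v i)) /
      ((v i - α * w i - e i * w i * v i) * (s i)⁻¹ ^ 2 *
        ((V i - α * W i) * (s i)⁻¹ ^ 2))) l (𝓝 0) := by
    have := ((hD.mul ((hva.mul hw).add (hW.mul hv))).sub ((hW.mul hV).mul hED)).div (hE.mul hD)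
      (mul_ne_zero hd0 hd0)
    simp only [mul_zero, add_zero, sub_zero, zero_div] at this
    exact this
  refine hN.congr' ?_
  filter_upwards [h.sne, hv0, hw0, hW', hD.eventually_ne hd0, hE.eventually_ne hd0]
    with i hs h1 h2 h3 h4 h5
  have h4' : V i - α * W i ≠ 0 := left_ne_zero_of_mul h4
  have h5' : v i - α * w i - e i * w i * v i ≠ 0 := left_ne_zero_of_mul h5
  have h6 : W' i = W i * V i / (V i - α * W i) := by
    rw [eq_div_iff h4', h3]
  have h7 : (w i)⁻¹ - α / v i - e i = (v i - α * w i - e i * w i * v i) / (w i * v i) := by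
    field_simp
  rw [h6, h7, inv_div, show v i - V i - α * (w i - W i) - e i * w i * v i =
    (v i - α * w i - e i * w i * v i) - (V i - α * W i) by ring]
  generalize v i - α * w i - e i * w i * v i = E at *
  generalize V i - α * W i = D at *
  field_simp
  ring

/-- Asymptotics of `w'`, where `1 / w' = 1 / W - e` with a small `e`. -/
theorem tendsto_inv_sub (h : Scale l x s) {b : ℂ} {W e : ι → ℂ}
    (hW : Tendsto (fun i => W i * (s i)⁻¹ ^ 2) l (𝓝 b)) (hW0 : ∀ᶠ i in l, W i ≠ 0)
    (he : Tendsto (fun i => e i * s i ^ 4) l (𝓝 0)) :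
    Tendsto (fun i => ((W i)⁻¹ - e i)⁻¹ - W i) l (𝓝 0) := by
  have h1 : Tendsto (fun i => e i * W i) l (𝓝 0) := by
    have := (he.mul hW).mul (h.inv.pow 2)
    simp only [zero_mul] at this
    refine this.congr' ?_
    filter_upwards [h.sne] with i hi
    field_simp
  have h2 : Tendsto (fun i => 1 - e i * W i) l (𝓝 1) := by simpa using h1.const_sub 1
  have h3 : Tendsto (fun i => e i * s i ^ 4 * (W i * (s i)⁻¹ ^ 2) * (W i * (s i)⁻¹ ^ 2) /
      (1 - e i * W i)) l (𝓝 0) := by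
    have := ((he.mul hW).mul hW).div h2 one_ne_zero
    simp only [zero_mul, zero_div] at this
    exact this
  refine h3.congr' ?_
  filter_upwards [h.sne, hW0, h2.eventually_ne one_ne_zero] with i hs h0 h4
  rw [show (W i)⁻¹ - e i = (1 - e i * W i) / W i by field_simp, inv_div]
  field_simp
  ring

variable {z : ι → ℂ × ℂ} {V W : ℂ → ℂ}

theorem Asy.congr (h : Asy l x s z V W) {V' W' : ℂ → ℂ} {s' : ι → ℂ}
    (hV : ∀ i, V (s i) = V' (s' i)) (hW : ∀ i, W (s i) = W' (s' i)) : Asy l x s' z V' W' :=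
  ⟨h.fst.congr fun i => by rw [hV], h.snd.congr fun i => by rw [hW]⟩

theorem Asy.snd_ne (h : Asy l x s z V W) (hx : Scale l x s) {c₀ c₁ c₂ : ℂ}
    (hW : ∀ t, W t = c₀ + c₁ * t + c₂ * t ^ 2) (hc : c₂ ≠ 0 ∨ c₁ ≠ 0) :
    ∀ᶠ i in l, (z i).2 ≠ 0 := by
  filter_upwards [eventually_ne_zero_of_quad hx (h.snd.congr fun i => by rw [hW]) hc] with i hi h0
  exact hi (by simp [h0])

theorem Asy.mapA (h : Asy l x s z V W) (b : ℂ) :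
    Asy l x s (fun i => mapA b (z i)) (fun t => V t + b * W t) W := by
  refine ⟨?_, h.snd⟩
  have := h.fst.add (h.snd.const_mul b)
  simp only [mul_zero, add_zero] at this
  refine this.congr fun i => ?_
  simp only [PainleveSix.mapA, div_eq_mul_inv, mul_inv]
  ring

theorem tendsto_error (hx : Scale l x s) (a : ℂ) (hz : Tendsto (fun i => (z i).1) l (𝓝 0)) :
    Tendsto (fun i => a * x i / ((z i).1 - 1) * s i ^ 4) l (𝓝 0) := by
  have h1 : Tendsto (fun i => (z i).1 - 1) l (𝓝 (-1)) := by simpa using hz.sub_const 1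
  have := (hx.small.const_mul a).div h1 (by norm_num)
  simp only [mul_zero, zero_div] at this
  exact this.congr fun i => by simp only [Pi.div_apply]; ring

/-- In the variables v = q/x, w = 1/(x p) the reflection reads 1/w' = 1/w - a/(v - 1) - (small). The
last term is negligible when q → 0, because it is of the order of x. -/
theorem mapB_snd (a : ℂ) {x : ℂ} (hx : x ≠ 0) (z : ℂ × ℂ) : (x * (mapB a x z).2)⁻¹ =
    (((x * z.2)⁻¹)⁻¹ - a / (z.1 / x - 1) - a * x / (z.1 - 1))⁻¹ := by
  congr 1
  rw [inv_inv, show z.1 / x - 1 = (z.1 - x) / x by field_simp, div_div_eq_mul_div]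
  simp only [mapB]
  ring

/-- The condition `hd` says that the s² terms of v - 1 and a w do not cancel; without it the o(1)
errors could not be controlled by `tendsto_reflect`. The identity `hW'` determines the new profile
by the limiting form of the reflection. -/
theorem Asy.mapB {v₀ v₁ v₂ w₀ w₁ w₂ : ℂ} {W' : ℂ → ℂ} {a : ℂ}
    (h : Asy l x s z (fun t => v₀ + v₁ * t + v₂ * t ^ 2) (fun t => w₀ + w₁ * t + w₂ * t ^ 2))
    (hx : Scale l x s)  (hd : v₂ - a * w₂ ≠ 0) (hv : v₂ ≠ 0 ∨ v₁ ≠ 0) (hw : w₂ ≠ 0 ∨ w₁ ≠ 0)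
    (hW' : ∀ t, (w₀ + w₁ * t + w₂ * t ^ 2) * ((v₀ - 1) + v₁ * t + v₂ * t ^ 2) =
      W' t * (((v₀ - 1) + v₁ * t + v₂ * t ^ 2) - a * (w₀ + w₁ * t + w₂ * t ^ 2))) :
    (∀ᶠ i in l, (z i).2 ≠ 0 ∧ (z i).1 ≠ x i ∧ (z i).1 ≠ 1) ∧
    Asy l x s (fun i => mapB a (x i) (z i)) (fun t => v₀ + v₁ * t + v₂ * t ^ 2) W' := by
  have hw0 := eventually_ne_zero_of_quad hx h.snd hw
  have hv1 : Tendsto (fun i => (z i).1 / x i - 1 - ((v₀ - 1) + v₁ * s i + v₂ * s i ^ 2)) l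
      (𝓝 0) := h.fst.congr fun i => by ring
  have hv0 := eventually_ne_zero_of_quad hx hv1 hv
  have hz : Tendsto (fun i => (z i).1) l (𝓝 0) := by
    have := (hx.tendsto_zero.mul h.fst).add (hx.small_two.mul (tendsto_quad hx v₀ v₁ v₂))
    simp only [zero_mul, add_zero] at this
    refine this.congr' ?_
    filter_upwards [hx.ne, hx.sne] with i hi hs
    field_simp
    ring
  refine ⟨?_, h.fst, ?_⟩
  · filter_upwards [hw0, hv0, hz.eventually_ne zero_ne_one, hx.ne] with i h1 h2 h3 h4
    refine ⟨fun k => h1 (by simp [k]), fun k => h2 ?_, h3⟩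
    rw [k, div_self h4, sub_self]
  · have := tendsto_reflect hx hv1 h.snd (tendsto_quad hx _ _ _) (tendsto_quad hx _ _ _) rfl hd
      (tendsto_error hx a hz) hv0 hw0 (Eventually.of_forall fun i => hW' (s i))
    refine this.congr' ?_
    filter_upwards [hx.ne] with i hi
    rw [mapB_snd a hi]

/-- Changing the sign of α₄ = 2n amounts to replacing n by -n in both profiles; the profile of q/x
depends on n² only. -/
theorem Asy.mapC {n : ℂ} (hn : n ≠ 0)
    (h : Asy l x s z (fun t => 1 - n ^ 2 * t ^ 2) (fun t => t * (1 - n * t)))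
    (hx : Scale l x s) : (∀ᶠ i in l, (z i).1 ≠ 0) ∧
    Asy l x s (fun i => mapC (2 * n) (z i)) (fun t => 1 - n ^ 2 * t ^ 2)
      (fun t => t * (1 + n * t)) := by
  have h1 : Tendsto (fun i => (z i).1 / x i - (1 + 0 * s i + (-n ^ 2) * s i ^ 2)) l (𝓝 0) :=
    h.fst.congr fun i => by ring
  have h2 : Tendsto (fun i => (x i * (z i).2)⁻¹ - (0 + 1 * s i + (-n) * s i ^ 2)) l (𝓝 0) :=
    h.snd.congr fun i => by ring
  have hv0 := eventually_ne_zero_of_quad hx h1 (Or.inl (neg_ne_zero.2 (pow_ne_zero 2 hn)))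
  have hw0 := eventually_ne_zero_of_quad hx h2 (Or.inl (neg_ne_zero.2 hn))
  refine ⟨?_, h.fst, ?_⟩
  · filter_upwards [hv0] with i hi h0
    exact hi (by simp [h0])
  · have := tendsto_reflect hx (e := fun _ => 0) (α := 2 * n) (W' := fun i => s i * (1 + n * s i))
      h1 h2 (tendsto_quad hx _ _ _)
      (tendsto_quad hx _ _ _) (d := n ^ 2) (by ring) (pow_ne_zero 2 hn) (by simp [tendsto_const_nhds]) hv0 hw0
      (Eventually.of_forall fun i => by ring)
    refine this.congr' ?_
    filter_upwards [hx.ne] with i hi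
    simp only [PainleveSix.mapC, inv_inv, sub_zero]
    rw [div_div_eq_mul_div]
    congr 2
    ring

theorem regT_ne_zero {a x : ℂ} {z : ℂ × ℂ} (h1 : z.2 ≠ 0)
    (h2 : (mapB a x (mapA a z)).2 ≠ 0 ∧ (mapA a z).1 ≠ x ∧ (mapA a z).1 ≠ 1)
    (h3 : (mapA (2 * a) (mapB a x (mapA a z))).1 ≠ x ∧
      (mapA (2 * a) (mapB a x (mapA a z))).1 ≠ 1)
    (h4 : (mapB a x (mapA (2 * a) (mapB a x (mapA a z)))).2 ≠ 0) : regT a x z ≠ 0 := by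
  simp only [regT, mul_ne_zero_iff, sub_ne_zero]
  exact ⟨⟨⟨h1, h2.2⟩, h2.1, h3⟩, h4⟩

/-- Asymptotics under the translation `mapT`, before the shift of the variable `s`. -/
theorem Asy.mapT_aux {n : ℂ} (hn : n ≠ 0)
    (h : Asy l x s z (fun t => 1 - n ^ 2 * t ^ 2) (fun t => t * (1 - n * t)))
    (hx : Scale l x s) : (∀ᶠ i in l, (z i).1 ≠ x i ∧ regT (1 / 2 - n) (x i) (z i) ≠ 0) ∧
    Asy l x s (fun i => PainleveSix.mapT (1 / 2 - n) (x i) (z i))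
      (fun t => 1 - ((n - 1) * t - 1 - (n - 1) / n) ^ 2)
      (fun t => (n * t - 1) * (n * (n - 1) * t - (2 * n - 1)) / n ^ 2) := by
  obtain ⟨a, ha⟩ : ∃ a, a = 1 / 2 - n := ⟨_, rfl⟩
  rw [← ha]
  have h1 : Tendsto (fun i => (z i).1 / x i - 1 - (0 + 0 * s i + (-n ^ 2) * s i ^ 2)) l (𝓝 0) :=
    h.fst.congr fun i => by ring
  have r0 := eventually_ne_zero_of_quad hx h1 (Or.inl (neg_ne_zero.2 (pow_ne_zero 2 hn)))
  have k1 : Asy l x s (fun i => PainleveSix.mapA a (z i))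
      (fun t => 1 + (1 / 2 - n) * t + (-n / 2) * t ^ 2) (fun t => 0 + 1 * t + (-n) * t ^ 2) :=
    (h.mapA a).congr (fun i => by simp only [ha]; ring) (fun i => by ring)
  obtain ⟨r1, k2⟩ := k1.mapB (a := a) (W' := fun t => -((1 - n * t) * (1 / 2 - n - n * t / 2)) / n ^ 2)
    hx (by rw [ha]; ring_nf; simpa using hn) (Or.inl (by simpa using hn))
    (Or.inl (neg_ne_zero.2 hn)) (fun t => by rw [ha]; field_simp; ring)
  have k3 : Asy l x s _ (fun t => (-1 + 4 * n - 2 * n ^ 2) / (2 * n ^ 2) +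
      (2 - 5 * n + 2 * n ^ 2) / (2 * n) * t + (n - 1) / 2 * t ^ 2)
      (fun t => (-(1 / 2 - n) / n ^ 2) + ((1 - n) / n) * t + (-1 / 2) * t ^ 2) :=
    (k2.mapA (2 * a)).congr (fun i => by simp only [ha]; field_simp; ring)
      (fun i => by field_simp; ring)
  obtain ⟨r2, k4⟩ := k3.mapB (a := a)
    (W' := fun t => (n * t - 1) * (n * (n - 1) * t - (2 * n - 1)) / n ^ 2)
    hx (by rw [ha]; ring_nf; norm_num) (by
      -- For n = 1 the quadratic coefficient (n - 1)/2 vanishes and the linear one, -1/2, takes its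
      -- place.
      by_cases h1 : n = 1
      · right; subst h1; norm_num
      · left; exact div_ne_zero (sub_ne_zero.2 h1) two_ne_zero)
    (Or.inl (by norm_num)) (fun t => by rw [ha]; field_simp; ring)
  have r3 := k4.snd_ne hx (c₀ := (2 * n - 1) / n ^ 2)
    (c₁ := (2 - 3 * n) / n) (c₂ := n - 1) (fun t => by field_simp; ring) (by
      by_cases h1 : n = 1
      · right; subst h1; norm_num
      · left; exact sub_ne_zero.2 h1)
  have k5 := k4.mapA a
  refine ⟨?_, k5.congr (fun i => by simp only [ha]; field_simp; ring) (fun i => rfl)⟩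
  filter_upwards [r0, r1, r2, r3, hx.ne] with i g0 g1 g2 g3 g4
  refine ⟨fun k => g0 (by rw [k, div_self g4, sub_self]), ?_⟩
  exact regT_ne_zero g1.1 ⟨g2.1, g1.2⟩ g2.2 g3

/-- The profiles are reproduced with n replaced by 1 - n, in accordance with α₄ ↦ 2 - α₄, once s is
shifted by -1/n - 1/(n - 1). These shifts are the source of the harmonic sum in the final constant.
-/
theorem Asy.mapT {n : ℂ} (hn : n ≠ 0) (hn1 : n ≠ 1)
    (h : Asy l x s z (fun t => 1 - n ^ 2 * t ^ 2) (fun t => t * (1 - n * t)))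
    (hx : Scale l x s) : (∀ᶠ i in l, (z i).1 ≠ x i ∧ regT (1 / 2 - n) (x i) (z i) ≠ 0) ∧
    Asy l x (fun i => s i - 1 / n - 1 / (n - 1)) (fun i => PainleveSix.mapT (1 / 2 - n) (x i) (z i))
      (fun t => 1 - (1 - n) ^ 2 * t ^ 2) (fun t => t * (1 - (1 - n) * t)) := by
  obtain ⟨h1, h2⟩ := h.mapT_aux hn hx
  have := sub_ne_zero.2 hn1
  have h3 : 1 - n ≠ 0 := sub_ne_zero.2 hn1.symm
  refine ⟨h1, h2.congr (fun i => ?_) (fun i => ?_)⟩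
  · field_simp
    ring
  · field_simp
    ring

/-- For n = 1 the shift in `Asy.mapT` is singular. This is the last step of the descent to α₄ = 0,
where q/x no longer grows. -/
theorem Asy.mapT_one
    (h : Asy l x s z (fun t => 1 - 1 ^ 2 * t ^ 2) (fun t => t * (1 - 1 * t)))
    (hx : Scale l x s) : (∀ᶠ i in l, (z i).1 ≠ x i ∧ regT (1 / 2 - 1) (x i) (z i) ≠ 0) ∧
    Asy l x s (fun i => PainleveSix.mapT (1 / 2 - 1) (x i) (z i)) (fun _ => 0) (fun t => 1 - t) := by
  obtain ⟨h1, h2⟩ := h.mapT_aux one_ne_zero hx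
  exact ⟨h1, h2.congr (fun i => by ring) (fun i => by ring)⟩

/-- The first step of the ascent, from the invariant line q = 0 to α₄ = 2. It contributes the shift
1 of the logarithm. -/
theorem asy_mapT_zero {p : ι → ℂ} (hx : Scale l x fun i => -(x i * p i)⁻¹) :
    (∀ᶠ i in l, regT (1 / 2) (x i) (0, p i) ≠ 0) ∧
    Asy l x (fun i => 1 - (x i * p i)⁻¹) (fun i => PainleveSix.mapT (1 / 2) (x i) (0, p i))
      (fun t => 1 - 1 ^ 2 * t ^ 2) (fun t => t * (1 - 1 * t)) := by
  set S : ι → ℂ := fun i => -(x i * p i)⁻¹ with hS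
  have k0 : Asy l x S (fun i => (0, p i)) (fun _ => 0) (fun t => -t) := by
    refine ⟨by simp [tendsto_const_nhds], by simp [hS, tendsto_const_nhds]⟩
  have k1 : Asy l x S (fun i => PainleveSix.mapA (1 / 2) (0, p i)) (fun t => 0 + (-1 / 2) * t)
      (fun t => -t) := (k0.mapA (1 / 2)).congr (fun i => by ring) (fun i => rfl)
  have p0 : ∀ᶠ i in l, p i ≠ 0 := by
    filter_upwards [hx.sne] with i hi h0
    exact hi (by simp [hS, h0])
  have hq : ∀ᶠ i in l, (PainleveSix.mapA (1 / 2) (0, p i)).1 / x i = -S i / 2 := by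
    filter_upwards [p0, hx.ne] with i h1 h2
    simp only [PainleveSix.mapA, hS]
    field_simp
    ring
  have hz : Tendsto (fun i => (PainleveSix.mapA (1 / 2) (0, p i)).1) l (𝓝 0) := by
    have := (hx.small_two.mul hx.inv).mul_const (-1 / 2)
    simp only [zero_mul] at this
    refine this.congr' ?_
    filter_upwards [hq, hx.ne, hx.sne] with i h1 h2 h3
    rw [div_eq_iff h2] at h1
    rw [h1]
    field_simp
  have hS2 : ∀ᶠ i in l, S i + 2 ≠ 0 :=
    eventually_ne_zero_of_quad hx (c₀ := 2) (c₁ := 1) (c₂ := 0) (by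
      refine tendsto_const_nhds.congr fun i => ?_; ring) (Or.inr one_ne_zero)
  have k2 : Asy l x S (fun i => mapB (1 / 2) (x i) (PainleveSix.mapA (1 / 2) (0, p i)))
      (fun t => 0 + (-1 / 2) * t) (fun t => -(t * (t + 2)) / 2) := by
    refine ⟨k1.fst, ?_⟩
    -- Here v - 1 and w/2 have the same linear leading term, which cancels, so `tendsto_reflect`
    -- does not apply. But v and w are exact functions of S = -1/(x p), and only the small term of
    -- the reflection has to be estimated.
    have := tendsto_inv_sub hx (W := fun i => -(S i * (S i + 2)) / 2) (b := -1 / 2)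
      ((tendsto_quad hx 0 (-1) (-1 / 2)).congr fun i => by ring) (by
        filter_upwards [hx.sne, hS2] with i h1 h2
        exact div_ne_zero (neg_ne_zero.2 (mul_ne_zero h1 h2)) two_ne_zero)
        (tendsto_error hx (1 / 2) hz)
    refine this.congr' ?_
    filter_upwards [hx.ne, hq, hx.sne, hS2] with i h0 h1 h2 h3
    rw [mapB_snd _ h0, h1]
    congr 3
    have h4 : ((x i * (PainleveSix.mapA (1 / 2) (0, p i)).2)⁻¹)⁻¹ = (-S i)⁻¹ := by
      simp [hS, PainleveSix.mapA]
    have h5 : -S i / 2 - 1 ≠ 0 := by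
      rw [show -S i / 2 - 1 = -(S i + 2) / 2 by ring]
      exact div_ne_zero (neg_ne_zero.2 h3) two_ne_zero
    rw [h4, show -S i / 2 - 1 = -(S i + 2) / 2 by ring]
    field_simp
    ring
  have k3 : Asy l x S _ (fun t => 0 + (-3 / 2) * t + (-1 / 2) * t ^ 2)
      (fun t => 0 + (-1) * t + (-1 / 2) * t ^ 2) :=
    (k2.mapA (2 * (1 / 2))).congr (fun i => by ring) (fun i => by ring)
  obtain ⟨r2, k4⟩ := k3.mapB (a := 1 / 2) (W' := fun t => -(t * (t + 1))) hx (by norm_num)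
    (Or.inl (by norm_num)) (Or.inl (by norm_num)) (fun t => by ring)
  have r3 := k4.snd_ne hx (c₀ := 0) (c₁ := -1) (c₂ := -1) (fun t => by ring)
    (Or.inl (by norm_num))
  refine ⟨?_, (k4.mapA (1 / 2)).congr (fun i => ?_) (fun i => ?_)⟩
  · filter_upwards [r2, r3, p0, hq, hS2, hx.ne, hz.eventually_ne zero_ne_one]
      with i g2 g3 g4 g5 g6 g7 g8
    refine regT_ne_zero g4 ⟨g2.1, fun k => g6 ?_, g8⟩ g2.2 g3
    rw [k, div_self g7] at g5
    linear_combination 2 * g5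
  · simp only [hS]
    ring
  · simp only [hS]
    ring

end asymptotics

end PainleveSix

end

/-! ### The complete elliptic integral: hypergeometric equation, nonvanishing, Pfaff's
transformation. -/

noncomputable section

namespace PainleveSix

open Filter Topology MeasureTheory Set
open scoped Interval

theorem hasDerivAt_integral_of_continuousOn {D : Set ℂ} (hD : IsOpen D) {F F' : ℂ → ℝ → ℂ}
    (a b : ℝ) (hF : ∀ x ∈ D, Continuous (F x))
    (hF' : ContinuousOn (Function.uncurry F') (D ×ˢ univ))
    (h : ∀ x ∈ D, ∀ t, HasDerivAt (fun x => F x t) (F' x t) x) {x : ℂ} (hx : x ∈ D) :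
    HasDerivAt (fun x => ∫ t in a..b, F x t) (∫ t in a..b, F' x t) x := by
  obtain ⟨ε, hε, hb⟩ := Metric.nhds_basis_closedBall.mem_iff.1 (hD.mem_nhds hx)
  have hc : IsCompact (Metric.closedBall x ε ×ˢ [[a, b]]) :=
    (isCompact_closedBall x ε).prod isCompact_uIcc
  obtain ⟨C, hC⟩ := hc.exists_bound_of_continuousOn
    (hF'.mono (prod_mono hb (subset_univ _)))
  refine (intervalIntegral.hasDerivAt_integral_of_dominated_loc_of_deriv_le (bound := fun _ => C)
    (Metric.closedBall_mem_nhds x hε) ?_ ?_ ?_ ?_ ?_ ?_).2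
  · filter_upwards [hD.mem_nhds hx] with y hy
    exact (hF y hy).aestronglyMeasurable
  · exact (hF x hx).intervalIntegrable _ _
  · have : Continuous (F' x) := by
      rw [← continuousOn_univ]
      exact hF'.comp (f := fun t => (x, t)) (by fun_prop) fun t _ => ⟨hx, mem_univ _⟩
    exact this.aestronglyMeasurable
  · exact Eventually.of_forall fun t ht y hy => hC (y, t) ⟨hy, uIoc_subset_uIcc ht⟩
  · exact intervalIntegrable_const
  · exact Eventually.of_forall fun t _ y hy => h y (hb hy) t

/-- The plane cut along `[1, ∞)`. -/
def cutPlane : Set ℂ := {x | 1 - x ∈ Complex.slitPlane}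

theorem isOpen_cutPlane : IsOpen cutPlane :=
  Complex.isOpen_slitPlane.preimage (by fun_prop)

/-- The point 1 - x sin² t = cos² t + (1 - x) sin² t lies on the segment from 1 to 1 - x, and the
slit plane is star-shaped about 1. -/
theorem delta_mem {x : ℂ} (hx : x ∈ cutPlane) (t : ℝ) :
    1 - x * (Real.sin t : ℂ) ^ 2 ∈ Complex.slitPlane := by
  have h := Complex.starConvex_one_slitPlane hx (sq_nonneg (Real.cos t)) (sq_nonneg (Real.sin t))
    (Real.cos_sq_add_sin_sq t)
  have e : (Real.cos t : ℂ) ^ 2 = 1 - (Real.sin t : ℂ) ^ 2 := by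
    rw [eq_sub_iff_add_eq]
    exact_mod_cast Real.cos_sq_add_sin_sq t
  convert h using 1
  simp only [Complex.real_smul, Complex.ofReal_pow, e]
  ring

theorem hasDerivAt_integral_cpow (c : ℂ) (k : ℕ) {x : ℂ} (hx : x ∈ cutPlane) :
    HasDerivAt
      (fun x => ∫ t in (0 : ℝ)..Real.pi / 2,
        ((Real.sin t : ℂ) ^ 2) ^ k * (1 - x * (Real.sin t : ℂ) ^ 2) ^ c)
      (∫ t in (0 : ℝ)..Real.pi / 2,
        -c * (((Real.sin t : ℂ) ^ 2) ^ (k + 1) * (1 - x * (Real.sin t : ℂ) ^ 2) ^ (c - 1))) x := by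
  refine hasDerivAt_integral_of_continuousOn isOpen_cutPlane
    (F' := fun x t => -c * (((Real.sin t : ℂ) ^ 2) ^ (k + 1) *
      (1 - x * (Real.sin t : ℂ) ^ 2) ^ (c - 1))) _ _ (fun y hy => ?_) ?_ (fun y hy t => ?_) hx
  · refine Continuous.mul (by fun_prop) ?_
    exact Continuous.cpow (by fun_prop) continuous_const fun t => delta_mem hy t
  · simp only [Function.uncurry_def]
    refine ContinuousOn.mul (by fun_prop) (ContinuousOn.mul (by fun_prop) ?_)
    exact ContinuousOn.cpow (by fun_prop) (by fun_prop) fun p hp => delta_mem hp.1 _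
  · have h1 : HasDerivAt (fun x : ℂ => 1 - x * (Real.sin t : ℂ) ^ 2) (-(Real.sin t : ℂ) ^ 2) y := by
      simpa using ((hasDerivAt_id y).mul_const ((Real.sin t : ℂ) ^ 2)).const_sub 1
    refine ((h1.cpow_const (c := c) (delta_mem hy t)).const_mul _).congr_deriv ?_
    ring

/-- The complete elliptic integral of the first kind, as a function of the parameter `x = k²`. -/
def legK (x : ℂ) : ℂ :=
  ∫ t in (0 : ℝ)..Real.pi / 2, (1 - x * (Real.sin t : ℂ) ^ 2) ^ (-1 / 2 : ℂ)

theorem hasDerivAt_legK_aux {x : ℂ} (hx : x ∈ cutPlane) :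
    HasDerivAt legK (1 / 2 * ∫ t in (0 : ℝ)..Real.pi / 2,
      ((Real.sin t : ℂ) ^ 2) ^ 1 * (1 - x * (Real.sin t : ℂ) ^ 2) ^ (-3 / 2 : ℂ)) x := by
  have := hasDerivAt_integral_cpow (-1 / 2) 0 hx
  simp only [pow_zero, one_mul, intervalIntegral.integral_const_mul, zero_add] at this
  refine this.congr_deriv ?_
  rw [show (-1 / 2 - 1 : ℂ) = -3 / 2 by norm_num]
  norm_num

theorem hasDerivAt_deriv_legK_aux {x : ℂ} (hx : x ∈ cutPlane) :
    HasDerivAt (deriv legK) (3 / 4 * ∫ t in (0 : ℝ)..Real.pi / 2,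
      ((Real.sin t : ℂ) ^ 2) ^ 2 * (1 - x * (Real.sin t : ℂ) ^ 2) ^ (-5 / 2 : ℂ)) x := by
  have := (hasDerivAt_integral_cpow (-3 / 2) 1 hx).const_mul (1 / 2)
  simp only [intervalIntegral.integral_const_mul] at this
  have e : deriv legK =ᶠ[𝓝 x] fun x => 1 / 2 * ∫ t in (0 : ℝ)..Real.pi / 2,
      ((Real.sin t : ℂ) ^ 2) ^ 1 * (1 - x * (Real.sin t : ℂ) ^ 2) ^ (-3 / 2 : ℂ) := by
    filter_upwards [isOpen_cutPlane.mem_nhds hx] with y hy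
    exact (hasDerivAt_legK_aux hy).deriv
  refine (this.congr_of_eventuallyEq e).congr_deriv ?_
  rw [← mul_assoc, show (-3 / 2 - 1 : ℂ) = -5 / 2 by norm_num]
  norm_num

theorem differentiableAt_legK {x : ℂ} (hx : x ∈ cutPlane) : DifferentiableAt ℂ legK x :=
  (hasDerivAt_legK_aux hx).differentiableAt

theorem hasDerivAt_legK {x : ℂ} (hx : x ∈ cutPlane) : HasDerivAt legK (deriv legK x) x :=
  (differentiableAt_legK hx).hasDerivAt

/-- The hypergeometric equation of the complete elliptic integral. -/
theorem hasDerivAt_deriv_legK {x : ℂ} (hx : x ∈ cutPlane) (hx0 : x ≠ 0) :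
    HasDerivAt (deriv legK) ((legK x / 4 - (1 - 2 * x) * deriv legK x) / (x * (1 - x))) x := by
  have hx1 : 1 - x ≠ 0 := Complex.slitPlane_ne_zero hx
  refine (hasDerivAt_deriv_legK_aux hx).congr_deriv ?_
  rw [eq_div_iff (mul_ne_zero hx0 hx1), (hasDerivAt_legK_aux hx).deriv]
  set Δ : ℝ → ℂ := fun t => 1 - x * (Real.sin t : ℂ) ^ 2 with hΔ
  have hΔ0 : ∀ t, Δ t ∈ Complex.slitPlane := fun t => delta_mem hx t
  have c : ∀ e : ℂ, Continuous fun t => Δ t ^ e := fun e =>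
    Continuous.cpow (by simp only [hΔ]; fun_prop) continuous_const hΔ0
  have e3 : ∀ t, Δ t ^ (-3 / 2 : ℂ) = Δ t ^ (-5 / 2 : ℂ) * Δ t := fun t => by
    rw [show (-3 / 2 : ℂ) = -5 / 2 + 1 by norm_num,
      Complex.cpow_add _ _ (Complex.slitPlane_ne_zero (hΔ0 t)), Complex.cpow_one]
  have e1 : ∀ t, Δ t ^ (-1 / 2 : ℂ) = Δ t ^ (-5 / 2 : ℂ) * Δ t ^ 2 := fun t => by
    rw [show (-1 / 2 : ℂ) = -5 / 2 + (2 : ℕ) by norm_num,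
      Complex.cpow_add _ _ (Complex.slitPlane_ne_zero (hΔ0 t)), Complex.cpow_natCast]
  have key : ∫ t in (0 : ℝ)..Real.pi / 2,
      (3 / 4 * (((Real.sin t : ℂ) ^ 2) ^ 2 * Δ t ^ (-5 / 2 : ℂ)) * (x * (1 - x)) +
      (1 - 2 * x) * (1 / 2 * (((Real.sin t : ℂ) ^ 2) ^ 1 * Δ t ^ (-3 / 2 : ℂ)))
      - Δ t ^ (-1 / 2 : ℂ) / 4) = 0 := by
    -- The hypergeometric operator applied to the integrand is the exact derivative of -(1/4) sin t
    -- cos t Δ^(-3/2), which vanishes at both endpoints.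
    have hd : ∀ t ∈ uIcc 0 (Real.pi / 2), HasDerivAt
        (fun t : ℝ => -1 / 4 * ((Real.sin t : ℂ) * (Real.cos t : ℂ) * Δ t ^ (-3 / 2 : ℂ)))
        (3 / 4 * (((Real.sin t : ℂ) ^ 2) ^ 2 * Δ t ^ (-5 / 2 : ℂ)) * (x * (1 - x)) +
      (1 - 2 * x) * (1 / 2 * (((Real.sin t : ℂ) ^ 2) ^ 1 * Δ t ^ (-3 / 2 : ℂ)))
      - Δ t ^ (-1 / 2 : ℂ) / 4) t := by
      intro t _
      have hs : HasDerivAt (fun t : ℝ => (Real.sin t : ℂ)) (Real.cos t : ℂ) t :=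
        (Real.hasDerivAt_sin t).ofReal_comp
      have hc : HasDerivAt (fun t : ℝ => (Real.cos t : ℂ)) (-(Real.sin t : ℂ)) t := by
        simpa using (Real.hasDerivAt_cos t).ofReal_comp
      have hD : HasDerivAt Δ (-(x * (2 * (Real.sin t : ℂ) * Real.cos t))) t := by
        simpa [hΔ] using ((hs.pow 2).const_mul x).const_sub 1
      have hE : HasDerivAt (fun t => Δ t ^ (-3 / 2 : ℂ))
          (-3 / 2 * Δ t ^ (-5 / 2 : ℂ) * (-(x * (2 * (Real.sin t : ℂ) * Real.cos t)))) t := by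
        have h0 := (((hasDerivAt_id (Δ t)).cpow_const (c := (-3 / 2 : ℂ)) (hΔ0 t)).comp t hD)
        refine h0.congr_deriv ?_
        norm_num
      refine (((hs.mul hc).mul hE).const_mul (-1 / 4)).congr_deriv ?_
      simp only [Pi.mul_apply]
      have hcs : (Real.cos t : ℂ) ^ 2 = 1 - (Real.sin t : ℂ) ^ 2 := by
        rw [eq_sub_iff_add_eq]
        exact_mod_cast Real.cos_sq_add_sin_sq t
      rw [e3, e1]
      generalize Δ t ^ (-5 / 2 : ℂ) = E
      simp only [hΔ]
      generalize (Real.cos t : ℂ) = C at *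
      generalize (Real.sin t : ℂ) = S at *
      linear_combination (-1 / 4 * E * (1 - x * S ^ 2) - 3 / 4 * E * x * S ^ 2) * hcs
    rw [intervalIntegral.integral_eq_sub_of_hasDerivAt hd]
    · simp
    · apply Continuous.intervalIntegrable
      have := c (-5 / 2)
      have := c (-3 / 2)
      have := c (-1 / 2)
      fun_prop
  have i5 : IntervalIntegrable (fun t : ℝ => ((Real.sin t : ℂ) ^ 2) ^ 2 * Δ t ^ (-5 / 2 : ℂ)) volume 0
      (Real.pi / 2) := ((by fun_prop : Continuous fun t : ℝ => ((Real.sin t : ℂ) ^ 2) ^ 2).mul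
        (c _)).intervalIntegrable _ _
  have i3 : IntervalIntegrable (fun t : ℝ => ((Real.sin t : ℂ) ^ 2) ^ 1 * Δ t ^ (-3 / 2 : ℂ)) volume 0
      (Real.pi / 2) := ((by fun_prop : Continuous fun t : ℝ => ((Real.sin t : ℂ) ^ 2) ^ 1).mul
        (c _)).intervalIntegrable _ _
  have i1 : IntervalIntegrable (fun t => Δ t ^ (-1 / 2 : ℂ)) volume 0 (Real.pi / 2) :=
    (c _).intervalIntegrable _ _
  rw [intervalIntegral.integral_sub (((i5.const_mul _).mul_const _).add
    ((i3.const_mul _).const_mul _)) (i1.div_const _), intervalIntegral.integral_add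
    ((i5.const_mul _).mul_const _) ((i3.const_mul _).const_mul _)] at key
  simp only [intervalIntegral.integral_const_mul, intervalIntegral.integral_mul_const,
    intervalIntegral.integral_div] at key
  simp only [legK]
  linear_combination key

theorem legK_zero : legK 0 = Real.pi / 2 := by
  simp [legK]

theorem cpow_re_pos {z : ℂ} (hz : 0 < z.re) : 0 < (z ^ (-1 / 2 : ℂ)).re := by
  have h0 : z ≠ 0 := by rintro rfl; simp at hz
  rw [show (-1 / 2 : ℂ) = ((-1 / 2 : ℝ) : ℂ) by push_cast; rfl]
  have ha := Complex.abs_arg_lt_pi_div_two_iff.2 (Or.inl hz)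
  rw [abs_lt] at ha
  rw [Complex.cpow_def_of_ne_zero h0, Complex.exp_re]
  refine mul_pos (Real.exp_pos _) (Real.cos_pos_of_mem_Ioo ?_)
  rw [Complex.im_mul_ofReal, Complex.log_im]
  constructor <;> linarith [ha.1, ha.2]

/-- For Re x < 1 the base 1 - x sin² t has positive real part; the power -1/2 halves the argument,
so the integrand, and with it K, has positive real part. In particular K has no zeros in the unit
disc. -/
theorem legK_ne_zero {x : ℂ} (hx : x.re < 1) : legK x ≠ 0 := by
  have hx' : x ∈ cutPlane := Or.inl (by simpa using hx)
  have hc : Continuous fun t : ℝ => (1 - x * (Real.sin t : ℂ) ^ 2) ^ (-1 / 2 : ℂ) :=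
    Continuous.cpow (by fun_prop) continuous_const fun t => delta_mem hx' t
  have h1 : (legK x).re = ∫ t in (0 : ℝ)..Real.pi / 2,
      ((1 - x * (Real.sin t : ℂ) ^ 2) ^ (-1 / 2 : ℂ)).re := by
    have := Complex.reCLM.intervalIntegral_comp_comm (hc.intervalIntegrable (μ := volume) 0 (Real.pi / 2))
    simpa [legK] using this.symm
  have h2 : 0 < (legK x).re := by
    rw [h1]
    refine intervalIntegral.intervalIntegral_pos_of_pos
      ((Complex.continuous_re.comp hc).intervalIntegrable _ _) (fun t => cpow_re_pos ?_)
      (by positivity)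
    rw [Complex.sub_re, Complex.one_re, ← Complex.ofReal_pow, Complex.re_mul_ofReal]
    rcases le_or_gt x.re 0 with h0 | h0
    · nlinarith [sq_nonneg (Real.sin t)]
    · nlinarith [Real.sin_sq_le_one t]
  intro h
  simp [h] at h2

/-- With imaginary parts of opposite sign the two arguments partly cancel, so their sum stays in the
principal range. -/
theorem log_mul_of_im {a b : ℂ} (ha : a ∈ Complex.slitPlane) (hb : b ∈ Complex.slitPlane)
    (h : (0 ≤ a.im ∧ b.im ≤ 0) ∨ (a.im ≤ 0 ∧ 0 ≤ b.im)) :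
    Complex.log (a * b) = Complex.log a + Complex.log b := by
  have neg : ∀ {z : ℂ}, z ∈ Complex.slitPlane → z.im ≤ 0 → Complex.arg z ≤ 0 := by
    intro z hz h
    rcases h.lt_or_eq with h | h
    · exact (Complex.arg_neg_iff.2 h).le
    · rcases hz with hz | hz
      · exact (Complex.arg_eq_zero_iff.2 ⟨hz.le, h⟩).le
      · exact absurd h hz
  refine (Complex.log_mul_eq_add_log_iff (Complex.slitPlane_ne_zero ha)
    (Complex.slitPlane_ne_zero hb)).2 ?_
  have l1 := Complex.neg_pi_lt_arg a
  have l2 := Complex.neg_pi_lt_arg b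
  have l3 := Complex.arg_le_pi a
  have l4 := Complex.arg_le_pi b
  rcases h with ⟨h1, h2⟩ | ⟨h1, h2⟩
  · have := Complex.arg_nonneg_iff.2 h1
    have := neg hb h2
    constructor <;> linarith
  · have := Complex.arg_nonneg_iff.2 h2
    have := neg ha h1
    constructor <;> linarith

theorem mul_cpow_of_im {a b : ℂ} (ha : a ∈ Complex.slitPlane) (hb : b ∈ Complex.slitPlane)
    (h : (0 ≤ a.im ∧ b.im ≤ 0) ∨ (a.im ≤ 0 ∧ 0 ≤ b.im)) (c : ℂ) :
    (a * b) ^ c = a ^ c * b ^ c := by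
  have a0 := Complex.slitPlane_ne_zero ha
  have b0 := Complex.slitPlane_ne_zero hb
  rw [Complex.cpow_def_of_ne_zero (mul_ne_zero a0 b0), log_mul_of_im ha hb h, add_mul,
    Complex.exp_add, Complex.cpow_def_of_ne_zero a0, Complex.cpow_def_of_ne_zero b0]

theorem inv_mem_slitPlane {a : ℂ} (ha : a ∈ Complex.slitPlane) : a⁻¹ ∈ Complex.slitPlane := by
  have hn := Complex.normSq_pos.2 (Complex.slitPlane_ne_zero ha)
  rcases ha with h | h
  · left
    rw [Complex.inv_re]
    exact div_pos h hn
  · right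
    rw [Complex.inv_im]
    exact div_ne_zero (neg_ne_zero.2 h) hn.ne'

/-- Pfaff's transformation. -/
theorem legK_one_sub {a : ℂ} (ha : a ∈ Complex.slitPlane) :
    legK (1 - a) = a ^ (-1 / 2 : ℂ) * legK (1 - a⁻¹) := by
  have a0 := Complex.slitPlane_ne_zero ha
  have h := intervalIntegral.integral_comp_sub_left (a := 0) (b := Real.pi / 2)
    (fun t : ℝ => (1 - (1 - a) * (Real.sin t : ℂ) ^ 2) ^ (-1 / 2 : ℂ)) (Real.pi / 2)
  simp only [sub_self, sub_zero, Real.sin_pi_div_two_sub] at h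
  simp only [legK]
  rw [← h, ← intervalIntegral.integral_const_mul]
  congr 1
  funext t
  have hcs : (Real.cos t : ℂ) ^ 2 = 1 - (Real.sin t : ℂ) ^ 2 := by
    rw [eq_sub_iff_add_eq]
    exact_mod_cast Real.cos_sq_add_sin_sq t
  have hb : 1 - (1 - a⁻¹) * (Real.sin t : ℂ) ^ 2 ∈ Complex.slitPlane := by
    refine delta_mem ?_ t
    simpa [cutPlane] using inv_mem_slitPlane ha
  -- After t ↦ π/2 - t the base is sin² t + a cos² t = a (1 - (1 - a⁻¹) sin² t). The imaginary parts
  -- of the two factors have opposite signs, so the principal powers multiply.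
  rw [← mul_cpow_of_im ha hb]
  · congr 1
    rw [hcs]
    field_simp
    ring
  · have : (1 - (1 - a⁻¹) * (Real.sin t : ℂ) ^ 2).im = -(a.im / Complex.normSq a) * Real.sin t ^ 2 := by
      rw [← Complex.ofReal_pow, Complex.sub_im, Complex.im_mul_ofReal]
      simp [Complex.inv_im]
      ring
    rw [this]
    have hn := Complex.normSq_nonneg a
    rcases le_total 0 a.im with h0 | h0
    · left
      refine ⟨h0, ?_⟩
      have := mul_nonneg (div_nonneg h0 hn) (sq_nonneg (Real.sin t))
      linarith
    · right
      refine ⟨h0, ?_⟩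
      have := mul_nonneg (neg_nonneg.2 (div_nonpos_of_nonpos_of_nonneg h0 hn))
        (sq_nonneg (Real.sin t))
      linarith

end PainleveSix

end

/-! ### The logarithmic singularity of K at 1. -/

noncomputable section

namespace PainleveSix

open Filter Topology MeasureTheory Set
open scoped Interval

theorem one_sub_cos_div_sin (t : ℝ) (ht : t ∈ Icc 0 (Real.pi / 2)) :
    (1 - Real.cos t) / Real.sin t = Real.sin t / (1 + Real.cos t) := by
  rcases ht.1.eq_or_lt with h | h
  · simp [← h]
  · have h1 := Real.sin_pos_of_pos_of_lt_pi h (by linarith [ht.2, Real.pi_pos])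
    have h2 := Real.cos_nonneg_of_mem_Icc ⟨by linarith [ht.1, Real.pi_pos], ht.2⟩
    rw [div_eq_div_iff h1.ne' (by positivity)]
    nlinarith [Real.sin_sq_add_cos_sq t]

theorem integral_tan_half :
    ∫ t in (0 : ℝ)..Real.pi / 2, Real.sin t / (1 + Real.cos t) = Real.log 2 := by
  have hpos : ∀ t ∈ uIcc 0 (Real.pi / 2), 0 < 1 + Real.cos t := by
    intro t ht
    rw [uIcc_of_le (by positivity)] at ht
    have h2 := Real.cos_nonneg_of_mem_Icc ⟨by linarith [ht.1, Real.pi_pos], ht.2⟩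
    positivity
  have hd : ∀ t ∈ uIcc 0 (Real.pi / 2), HasDerivAt (fun t => -Real.log (1 + Real.cos t))
      (Real.sin t / (1 + Real.cos t)) t := by
    intro t ht
    refine ((((Real.hasDerivAt_cos t).const_add 1).log (hpos t ht).ne').neg).congr_deriv ?_
    ring
  rw [intervalIntegral.integral_eq_sub_of_hasDerivAt hd]
  · norm_num
  · apply ContinuousOn.intervalIntegrable
    exact ContinuousOn.div (by fun_prop) (by fun_prop) fun t ht => (hpos t ht).ne'

/-- The factor 1 - cos t removes the singularity at t = 0: since 1 - cos t ≤ sin t on the interval,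
the integrands are bounded by 1 and dominated convergence applies. -/
theorem tendsto_integral_one_sub_cos :
    Tendsto (fun x : ℝ => ∫ t in (0 : ℝ)..Real.pi / 2,
      (1 - Real.cos t) / √(Real.sin t ^ 2 + x * Real.cos t ^ 2)) (𝓝[>] 0) (𝓝 (Real.log 2)) := by
  have e : ∫ t in (0 : ℝ)..Real.pi / 2, (1 - Real.cos t) / Real.sin t = Real.log 2 := by
    rw [← integral_tan_half]
    refine intervalIntegral.integral_congr fun t ht => ?_
    rw [uIcc_of_le (by positivity)] at ht
    exact one_sub_cos_div_sin t ht
  rw [← e]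
  refine intervalIntegral.tendsto_integral_filter_of_dominated_convergence (fun _ => 1) ?_ ?_
    intervalIntegrable_const ?_
  · exact Eventually.of_forall fun x => Measurable.aestronglyMeasurable (by fun_prop)
  · filter_upwards [self_mem_nhdsWithin] with x hx
    refine Eventually.of_forall fun t ht => ?_
    rw [uIoc_of_le (by positivity)] at ht
    have h1 := Real.sin_pos_of_pos_of_lt_pi ht.1 (by linarith [ht.2, Real.pi_pos])
    have h2 := Real.cos_nonneg_of_mem_Icc ⟨by linarith [ht.1, Real.pi_pos], ht.2⟩
    have h3 : Real.sin t ≤ √(Real.sin t ^ 2 + x * Real.cos t ^ 2) := by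
      apply Real.le_sqrt_of_sq_le
      have : 0 ≤ x * Real.cos t ^ 2 := mul_nonneg (le_of_lt hx) (sq_nonneg _)
      linarith
    have h4 := Real.cos_le_one t
    rw [Real.norm_of_nonneg (div_nonneg (by linarith) (Real.sqrt_nonneg _)),
      div_le_one (h1.trans_le h3)]
    nlinarith [Real.sin_sq_add_cos_sq t]
  · refine Eventually.of_forall fun t ht => ?_
    rw [uIoc_of_le (by positivity)] at ht
    have h1 := Real.sin_pos_of_pos_of_lt_pi ht.1 (by linarith [ht.2, Real.pi_pos])
    have h2 : Tendsto (fun x : ℝ => (1 - Real.cos t) / √(Real.sin t ^ 2 + x * Real.cos t ^ 2))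
        (𝓝 0) (𝓝 ((1 - Real.cos t) / √(Real.sin t ^ 2 + 0 * Real.cos t ^ 2))) := by
      apply Tendsto.div tendsto_const_nhds
      · exact Continuous.tendsto (by fun_prop) 0
      · simp [Real.sqrt_sq h1.le, h1.ne']
    rw [zero_mul, add_zero, Real.sqrt_sq h1.le] at h2
    exact h2.mono_left nhdsWithin_le_nhds

/-- The substitution u = sin t gives the elementary primitive arsinh(c sin t)/√(1 - x) with c² = (1
- x)/x. This part carries the whole logarithm. -/
theorem integral_cos_div_sqrt {x : ℝ} (hx : 0 < x) (hx1 : x < 1) :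
    ∫ t in (0 : ℝ)..Real.pi / 2, Real.cos t / √(Real.sin t ^ 2 + x * Real.cos t ^ 2) =
      (Real.log (1 + √(1 - x)) - Real.log x / 2) / √(1 - x) := by
  have h1 : 0 < 1 - x := by linarith
  set c := √(1 - x) / √x with hc
  have hsx := Real.sqrt_pos.2 hx
  have hs1 := Real.sqrt_pos.2 h1
  have hc2 : c ^ 2 = (1 - x) / x := by
    rw [hc, div_pow, Real.sq_sqrt h1.le, Real.sq_sqrt hx.le]
  have hd : ∀ t ∈ uIcc 0 (Real.pi / 2), HasDerivAt
      (fun t => Real.arsinh (c * Real.sin t) / √(1 - x))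
      (Real.cos t / √(Real.sin t ^ 2 + x * Real.cos t ^ 2)) t := by
    intro t _
    refine ((((Real.hasDerivAt_sin t).const_mul c).arsinh).div_const _).congr_deriv ?_
    have h2 : Real.sin t ^ 2 + x * Real.cos t ^ 2 = x * (1 + (c * Real.sin t) ^ 2) := by
      rw [mul_pow, hc2, Real.cos_sq']
      field_simp
      ring
    have h3 : 0 < √(1 + (c * Real.sin t) ^ 2) := Real.sqrt_pos.2 (by positivity)
    rw [h2, Real.sqrt_mul hx.le, smul_eq_mul]
    generalize √(1 + (c * Real.sin t) ^ 2) = B at *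
    rw [hc]
    field_simp
  rw [intervalIntegral.integral_eq_sub_of_hasDerivAt hd]
  · simp only [Real.sin_pi_div_two, Real.sin_zero, mul_one, mul_zero, Real.arsinh_zero, zero_div,
      sub_zero]
    congr 1
    have h4 : √(1 + c ^ 2) = 1 / √x := by
      rw [hc2, show 1 + (1 - x) / x = 1 / x by field_simp; ring, Real.sqrt_div' _ hx.le,
        Real.sqrt_one]
    rw [Real.arsinh, h4, hc, ← add_div, Real.log_div (by positivity) hsx.ne',
      Real.log_sqrt hx.le, add_comm (√(1 - x))]
  · apply Continuous.intervalIntegrable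
    refine Continuous.div (by fun_prop) (by fun_prop) fun t => (Real.sqrt_pos.2 ?_).ne'
    nlinarith [Real.sin_sq_add_cos_sq t, sq_nonneg (Real.sin t), sq_nonneg (Real.cos t)]

theorem legK_one_sub_ofReal {x : ℝ} (hx : 0 < x) :
    legK (1 - x) = ((∫ t in (0 : ℝ)..Real.pi / 2,
      1 / √(Real.sin t ^ 2 + x * Real.cos t ^ 2) : ℝ) : ℂ) := by
  have h := intervalIntegral.integral_comp_sub_left (a := 0) (b := Real.pi / 2)
    (fun t : ℝ => (1 - (1 - x) * (Real.sin t : ℂ) ^ 2) ^ (-1 / 2 : ℂ)) (Real.pi / 2)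
  simp only [sub_self, sub_zero, Real.sin_pi_div_two_sub] at h
  simp only [legK]
  rw [← h, ← intervalIntegral.integral_ofReal]
  congr 1
  funext t
  have e : (1 - (1 - x) * (Real.cos t : ℂ) ^ 2) =
      ((Real.sin t ^ 2 + x * Real.cos t ^ 2 : ℝ) : ℂ) := by
    push_cast
    rw [Complex.sin_sq]
    ring
  have hp : 0 ≤ Real.sin t ^ 2 + x * Real.cos t ^ 2 := by positivity
  rw [e, show (-1 / 2 : ℂ) = ((-(1 / 2) : ℝ) : ℂ) by push_cast; ring, ← Complex.ofReal_cpow hp,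
    Real.rpow_neg hp, ← Real.sqrt_eq_rpow, one_div]

/-- Writing the numerator 1 as (1 - cos t) + cos t splits K(1 - x) into a convergent part and an
elementary one, each contributing log 2 to the constant. The replacement of log x/√(1 - x) by log x
costs O(x log x). -/
theorem tendsto_legK_one_sub :
    Tendsto (fun x : ℝ => legK (1 - x) + Real.log x / 2) (𝓝[>] 0) (𝓝 (2 * Real.log 2 : ℝ)) := by
  have e : ∀ᶠ x : ℝ in 𝓝[>] 0, legK (1 - x) + Real.log x / 2 =
      (((∫ t in (0 : ℝ)..Real.pi / 2, (1 - Real.cos t) / √(Real.sin t ^ 2 + x * Real.cos t ^ 2)) +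
        (Real.log (1 + √(1 - x)) / √(1 - x) -
          Real.log x * x * (((1 / √(1 - x)) - 1) / x) / 2) : ℝ) : ℂ) := by
    filter_upwards [Ioo_mem_nhdsGT (zero_lt_one)] with x hx
    rw [legK_one_sub_ofReal hx.1]
    norm_cast
    have hp : ∀ t, 0 < Real.sin t ^ 2 + x * Real.cos t ^ 2 := fun t => by
      nlinarith [Real.sin_sq_add_cos_sq t, sq_nonneg (Real.sin t), sq_nonneg (Real.cos t), hx.1,
        hx.2]
    have i1 : IntervalIntegrable (fun t => (1 - Real.cos t) /
        √(Real.sin t ^ 2 + x * Real.cos t ^ 2)) volume 0 (Real.pi / 2) :=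
      (Continuous.div (by fun_prop) (by fun_prop)
        fun t => (Real.sqrt_pos.2 (hp t)).ne').intervalIntegrable _ _
    have i2 : IntervalIntegrable (fun t => Real.cos t /
        √(Real.sin t ^ 2 + x * Real.cos t ^ 2)) volume 0 (Real.pi / 2) :=
      (Continuous.div (by fun_prop) (by fun_prop)
        fun t => (Real.sqrt_pos.2 (hp t)).ne').intervalIntegrable _ _
    have := intervalIntegral.integral_add i1 i2
    rw [integral_cos_div_sqrt hx.1 hx.2] at this
    have e2 : (fun t => (1 - Real.cos t) / √(Real.sin t ^ 2 + x * Real.cos t ^ 2) +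
        Real.cos t / √(Real.sin t ^ 2 + x * Real.cos t ^ 2)) =
        fun t => 1 / √(Real.sin t ^ 2 + x * Real.cos t ^ 2) := by
      funext t
      ring
    rw [e2] at this
    rw [this]
    generalize (∫ t in (0 : ℝ)..Real.pi / 2, (1 - Real.cos t) /
      √(Real.sin t ^ 2 + x * Real.cos t ^ 2)) = J
    have hx0 := hx.1.ne'
    have h1 : √(1 - x) ≠ 0 := (Real.sqrt_pos.2 (by linarith [hx.2])).ne'
    field_simp
    ring
  refine Tendsto.congr' (e.mono fun x hx => hx.symm) ?_
  refine (Complex.continuous_ofReal.tendsto _).comp ?_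
  have h1 : Tendsto (fun x : ℝ => Real.log (1 + √(1 - x)) / √(1 - x)) (𝓝[>] 0)
      (𝓝 (Real.log 2)) := by
    have : ContinuousAt (fun x : ℝ => Real.log (1 + √(1 - x)) / √(1 - x)) 0 := by
      refine ContinuousAt.div (ContinuousAt.log (by fun_prop) (by norm_num)) (by fun_prop)
        (by norm_num)
    have h := this.tendsto
    norm_num at h
    exact h.mono_left nhdsWithin_le_nhds
  have h2 : Tendsto (fun x : ℝ => ((1 / √(1 - x)) - 1) / x) (𝓝[>] 0) (𝓝 (1 / 2)) := by
    have hd : HasDerivAt (fun x : ℝ => 1 / √(1 - x)) (1 / 2) 0 := by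
      have : HasDerivAt (fun x : ℝ => (√(1 - x))⁻¹) _ 0 :=
        (((hasDerivAt_id (0 : ℝ)).const_sub 1).sqrt (by norm_num)).inv (by norm_num)
      simp only [one_div]
      refine this.congr_deriv ?_
      norm_num
    have := hd.tendsto_slope_zero_right
    refine this.congr fun x => ?_
    simp [div_eq_inv_mul]
  have h3 : Tendsto (fun x : ℝ => Real.log x * x) (𝓝[>] 0) (𝓝 0) := by
    simpa using tendsto_log_mul_rpow_nhdsGT_zero zero_lt_one
  have := tendsto_integral_one_sub_cos.add (h1.sub ((h3.mul h2).div_const 2))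
  convert this using 2
  ring

end PainleveSix

end

/-! ### The quotient K(1 - x)/K(x) near 0. -/

noncomputable section

namespace PainleveSix

open Filter Topology Set

theorem isOpen_slitDomain : IsOpen slitDomain :=
  Complex.isOpen_slitPlane.inter (Complex.isOpen_slitPlane.preimage (by fun_prop))

theorem starConvex_slitDomain : StarConvex ℝ (1 / 2 : ℂ) slitDomain := by
  have h := Complex.starConvex_ofReal_slitPlane (x := 1 / 2) (by norm_num)
  intro x hx a b ha hb hab
  have hab' : (a : ℂ) + b = 1 := by exact_mod_cast hab
  constructor
  · convert h hx.1 ha hb hab using 3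
    norm_num
  · convert h hx.2 ha hb hab using 1
    simp only [Complex.real_smul]
    push_cast
    linear_combination -hab'

theorem isPreconnected_slitDomain : IsPreconnected slitDomain :=
  (starConvex_slitDomain.isPathConnected
    ⟨Or.inl (by norm_num), Or.inl (by norm_num)⟩).isConnected.isPreconnected

theorem isPreconnected_ball_inter_slitPlane :
    IsPreconnected (Metric.ball (0 : ℂ) 1 ∩ Complex.slitPlane) := by
  have hm : (((1 / 2 : ℝ) : ℂ)) ∈ Metric.ball (0 : ℂ) 1 := by
    rw [mem_ball_zero_iff, Complex.norm_real]
    norm_num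
  have h1 : StarConvex ℝ (((1 / 2 : ℝ) : ℂ)) (Metric.ball (0 : ℂ) 1) :=
    (convex_ball (0 : ℂ) 1).starConvex hm
  have h2 := Complex.starConvex_ofReal_slitPlane (x := 1 / 2) (by norm_num)
  exact ((h1.inter h2).isPathConnected ⟨hm, Or.inl (by norm_num)⟩).isConnected.isPreconnected

theorem mem_slitDomain_of_norm_lt {x : ℂ} (hx : x ∈ Complex.slitPlane) (h1 : ‖x‖ < 1) :
    x ∈ slitDomain := by
  refine ⟨hx, Or.inl ?_⟩
  have := (Complex.re_le_norm x).trans_lt h1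
  simpa using this

theorem ne_zero_of_mem_slitDomain {x : ℂ} (hx : x ∈ slitDomain) : x ≠ 0 :=
  Complex.slitPlane_ne_zero hx.1

theorem one_sub_ne_zero_of_mem_slitDomain {x : ℂ} (hx : x ∈ slitDomain) : 1 - x ≠ 0 :=
  Complex.slitPlane_ne_zero hx.2

theorem one_sub_mem_cutPlane {x : ℂ} (hx : x ∈ Complex.slitPlane) : 1 - x ∈ cutPlane := by
  simpa [cutPlane] using hx

theorem hasDerivAt_legK_one_sub {x : ℂ} (hx : x ∈ Complex.slitPlane) :
    HasDerivAt (fun x => legK (1 - x)) (-deriv legK (1 - x)) x := by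
  have := (hasDerivAt_legK (one_sub_mem_cutPlane hx)).comp x ((hasDerivAt_id x).const_sub 1)
  exact this.congr_deriv (by simp)

theorem hasDerivAt_deriv_legK_one_sub {x : ℂ} (hx : x ∈ slitDomain) :
    HasDerivAt (fun x => -deriv legK (1 - x))
      ((legK (1 - x) / 4 - (1 - 2 * (1 - x)) * deriv legK (1 - x)) / ((1 - x) * x)) x := by
  have := ((hasDerivAt_deriv_legK (one_sub_mem_cutPlane hx.1)
    (one_sub_ne_zero_of_mem_slitDomain hx)).comp x ((hasDerivAt_id x).const_sub 1)).neg
  refine this.congr_deriv ?_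
  simp

/-- Abel's identity for the solutions K(x) and K(1 - x). The value of the constant is found later,
from the behavior at 0. -/
theorem exists_wronskian : ∃ c : ℂ, ∀ x ∈ slitDomain,
    x * (1 - x) * (-deriv legK (1 - x) * legK x - legK (1 - x) * deriv legK x) = c := by
  have hd : ∀ x ∈ slitDomain, HasDerivAt (fun x =>
      x * (1 - x) * (-deriv legK (1 - x) * legK x - legK (1 - x) * deriv legK x)) 0 x := by
    intro x hx
    have h0 := ne_zero_of_mem_slitDomain hx
    have h1 := one_sub_ne_zero_of_mem_slitDomain hx
    refine ((((hasDerivAt_id x).mul ((hasDerivAt_id x).const_sub 1))).mul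
      (((hasDerivAt_deriv_legK_one_sub hx).mul (hasDerivAt_legK hx.2)).sub
        ((hasDerivAt_legK_one_sub hx.1).mul (hasDerivAt_deriv_legK hx.2 h0)))).congr_deriv ?_
    simp only [Pi.mul_apply, Pi.sub_apply, id]
    field_simp
    ring
  exact isOpen_slitDomain.exists_is_const_of_deriv_eq_zero isPreconnected_slitDomain
    (fun x hx => (hd x hx).differentiableAt.differentiableWithinAt) (fun x hx => (hd x hx).deriv)

/-- The quotient of the two basic solutions of the hypergeometric equation. -/
def legH (x : ℂ) : ℂ := legK (1 - x) / legK x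

theorem legK_ne_zero_of_norm_lt {x : ℂ} (h1 : ‖x‖ < 1) : legK x ≠ 0 :=
  legK_ne_zero ((Complex.re_le_norm x).trans_lt h1)

theorem mem_cutPlane_of_norm_lt {x : ℂ} (h1 : ‖x‖ < 1) : x ∈ cutPlane := by
  left
  have := (Complex.re_le_norm x).trans_lt h1
  simpa using this

theorem hasDerivAt_legH_aux {c : ℂ} (hc : ∀ x ∈ slitDomain,
    x * (1 - x) * (-deriv legK (1 - x) * legK x - legK (1 - x) * deriv legK x) = c) {x : ℂ}
    (hx : x ∈ Complex.slitPlane) (h1 : ‖x‖ < 1) :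
    HasDerivAt legH (c / (x * (1 - x) * legK x ^ 2)) x := by
  have hxD := mem_slitDomain_of_norm_lt hx h1
  have hg := legK_ne_zero_of_norm_lt h1
  have h0 := ne_zero_of_mem_slitDomain hxD
  have h1 := one_sub_ne_zero_of_mem_slitDomain hxD
  refine ((hasDerivAt_legK_one_sub hx).div (hasDerivAt_legK hxD.2) hg).congr_deriv ?_
  rw [← hc x hxD]
  field_simp

/-- The Wronskian gives the derivative of the quotient as φ(x)/x with φ holomorphic in the unit
disc. Its polar part integrates to a logarithm with coefficient φ(0), and the rest, (φ(x) - φ(0))/x,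
has a holomorphic primitive E in the disc. -/
theorem legH_aux : ∃ E : ℂ → ℂ, ∃ c d : ℂ, DifferentiableOn ℂ E (Metric.ball 0 1) ∧ E 0 = 0 ∧
    (∀ x ∈ Metric.ball 0 1 ∩ Complex.slitPlane,
      HasDerivAt legH (c / (x * (1 - x) * legK x ^ 2)) x) ∧
    ∀ x ∈ Metric.ball 0 1 ∩ Complex.slitPlane,
      legH x = c * 4 / Real.pi ^ 2 * Complex.log x + d + E x := by
  obtain ⟨c, hc⟩ := exists_wronskian
  set φ : ℂ → ℂ := fun x => c / ((1 - x) * legK x ^ 2) with hφ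
  have hπ : (Real.pi : ℂ) ≠ 0 := by exact_mod_cast Real.pi_ne_zero
  have hφ0 : φ 0 = c * 4 / Real.pi ^ 2 := by
    simp only [hφ, legK_zero]
    field_simp
    ring
  have hφd : DifferentiableOn ℂ φ (Metric.ball 0 1) := by
    intro x hx
    rw [mem_ball_zero_iff] at hx
    have hxc := mem_cutPlane_of_norm_lt hx
    refine DifferentiableAt.differentiableWithinAt ?_
    refine DifferentiableAt.div (by fun_prop) (DifferentiableAt.mul (by fun_prop)
      ((differentiableAt_legK hxc).pow 2)) ?_
    exact mul_ne_zero (Complex.slitPlane_ne_zero hxc) (pow_ne_zero 2 (legK_ne_zero_of_norm_lt hx))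
  have hm : DifferentiableOn ℂ (dslope φ 0) (Metric.ball 0 1) :=
    (Complex.differentiableOn_dslope (Metric.ball_mem_nhds 0 one_pos)).2 hφd
  obtain ⟨E, hE0, hE⟩ := hm.isExactOn_ball.with_val_at 0 0
  have hder : ∀ x ∈ Metric.ball 0 1 ∩ Complex.slitPlane,
      HasDerivAt legH (c / (x * (1 - x) * legK x ^ 2)) x := fun x hx =>
    hasDerivAt_legH_aux hc hx.2 (mem_ball_zero_iff.1 hx.1)
  have hd : ∀ x ∈ Metric.ball 0 1 ∩ Complex.slitPlane, HasDerivAt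
      (fun x => legH x - c * 4 / Real.pi ^ 2 * Complex.log x - E x) 0 x := by
    intro x hx
    have hx0 := Complex.slitPlane_ne_zero hx.2
    refine (((hder x hx).sub ((Complex.hasDerivAt_log hx.2).const_mul (c * 4 / Real.pi ^ 2))).sub
      (hE x hx.1)).congr_deriv ?_
    rw [dslope_of_ne _ hx0, slope_def_field, hφ0]
    simp only [hφ]
    have hg := legK_ne_zero_of_norm_lt (mem_ball_zero_iff.1 hx.1)
    have h1 := Complex.slitPlane_ne_zero (mem_cutPlane_of_norm_lt (mem_ball_zero_iff.1 hx.1))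
    field_simp
    ring
  obtain ⟨d, hd⟩ := (Metric.isOpen_ball.inter Complex.isOpen_slitPlane).exists_is_const_of_deriv_eq_zero
    isPreconnected_ball_inter_slitPlane
    (fun x hx => (hd x hx).differentiableAt.differentiableWithinAt) (fun x hx => (hd x hx).deriv)
  refine ⟨E, c, d, fun x hx => (hE x hx).differentiableAt.differentiableWithinAt, hE0, hder, ?_⟩
  intro x hx
  rw [← hd x hx]
  ring

theorem tendsto_ofReal_nhdsGT_zero :
    Tendsto (fun t : ℝ => (t : ℂ)) (𝓝[>] 0) (𝓝 0) :=
  (Complex.continuous_ofReal.tendsto' 0 0 (by simp)).mono_left nhdsWithin_le_nhds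

/-- Comparison with K(1 - t) + (log t)/2 → 2 log 2 along the positive axis: a nonzero coefficient of
log t would make the limit infinite, which fixes k, and the constant terms then give d. -/
theorem legH_consts {E : ℂ → ℂ} {k d : ℂ} (hE : DifferentiableOn ℂ E (Metric.ball 0 1))
    (hE0 : E 0 = 0) (h : ∀ x ∈ Metric.ball 0 1 ∩ Complex.slitPlane,
      legH x = k * Complex.log x + d + E x) :
    k = -(1 / Real.pi) ∧ d = 4 / Real.pi * Real.log 2 := by
  have hπ : (Real.pi : ℂ) ≠ 0 := by exact_mod_cast Real.pi_ne_zero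
  have hev : ∀ᶠ t : ℝ in 𝓝[>] 0, legK (1 - t) + Real.log t / 2 =
      (Real.pi / 2 * k + 1 / 2) * Real.log t + k * (Real.log t * t) * ((legK t - Real.pi / 2) / t)
        + legK t * (d + E t) := by
    filter_upwards [Ioo_mem_nhdsGT (zero_lt_one)] with t ht
    have h1 : ‖(t : ℂ)‖ < 1 := by
      rw [Complex.norm_real, Real.norm_of_nonneg ht.1.le]
      exact ht.2
    have ht0 : (t : ℂ) ≠ 0 := by exact_mod_cast ht.1.ne'
    have h2 := h t ⟨mem_ball_zero_iff.2 h1, Or.inl (by simpa using ht.1)⟩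
    have hg := legK_ne_zero_of_norm_lt h1
    rw [legH, div_eq_iff hg, ← Complex.ofReal_log ht.1.le] at h2
    rw [h2]
    field_simp
    ring
  have hslope : Tendsto (fun t : ℝ => (legK t - Real.pi / 2) / t) (𝓝[>] 0)
      (𝓝 (deriv legK 0)) := by
    have h1 := (hasDerivAt_legK (x := 0) (mem_cutPlane_of_norm_lt (by simp))).tendsto_slope_zero
    have h2 : Tendsto (fun t : ℝ => (t : ℂ)) (𝓝[>] 0) (𝓝[≠] 0) := by
      refine tendsto_nhdsWithin_iff.2 ⟨tendsto_ofReal_nhdsGT_zero, ?_⟩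
      filter_upwards [self_mem_nhdsWithin] with t ht
      exact Complex.ofReal_ne_zero.2 (ne_of_gt ht)
    refine (h1.comp h2).congr fun t => ?_
    simp [legK_zero, div_eq_inv_mul]
  have hlog : Tendsto (fun t : ℝ => (Real.log t * t : ℂ)) (𝓝[>] 0) (𝓝 0) := by
    have : Tendsto (fun x : ℝ => Real.log x * x) (𝓝[>] 0) (𝓝 0) := by
      simpa using tendsto_log_mul_rpow_nhdsGT_zero zero_lt_one
    refine ((Complex.continuous_ofReal.tendsto' 0 0 (by simp)).comp this).congr fun t => ?_
    simp
  have hK : Tendsto (fun t : ℝ => legK t) (𝓝[>] 0) (𝓝 (Real.pi / 2)) := by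
    have := (differentiableAt_legK (x := 0)
      (mem_cutPlane_of_norm_lt (by simp))).continuousAt.tendsto.comp tendsto_ofReal_nhdsGT_zero
    rwa [legK_zero] at this
  have hEt : Tendsto (fun t : ℝ => E t) (𝓝[>] 0) (𝓝 0) := by
    have := ((hE.differentiableAt (Metric.ball_mem_nhds 0 one_pos)).continuousAt.tendsto).comp
      tendsto_ofReal_nhdsGT_zero
    rwa [hE0] at this
  have hrest : Tendsto (fun t : ℝ => k * (Real.log t * t) * ((legK t - Real.pi / 2) / t)
        + legK t * (d + E t)) (𝓝[>] 0) (𝓝 (Real.pi / 2 * d)) := by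
    simpa using ((hlog.const_mul k).mul hslope).add (hK.mul (hEt.const_add d))
  have hlin : Tendsto (fun t : ℝ => (Real.pi / 2 * k + 1 / 2) * (Real.log t : ℂ)) (𝓝[>] 0)
      (𝓝 ((2 * Real.log 2 : ℝ) - Real.pi / 2 * d)) := by
    refine (tendsto_legK_one_sub.sub hrest).congr' ?_
    filter_upwards [hev] with t ht
    rw [ht]
    ring
  have hk : (Real.pi / 2 * k + 1 / 2 : ℂ) = 0 := by
    by_contra hne
    have h1 := hlin.norm
    have h2 : Tendsto (fun t : ℝ => ‖(Real.pi / 2 * k + 1 / 2 : ℂ) * (Real.log t : ℂ)‖) (𝓝[>] 0)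
        atTop := by
      simp only [norm_mul, Complex.norm_real]
      exact (tendsto_abs_atBot_atTop.comp Real.tendsto_log_nhdsGT_zero).const_mul_atTop
        (norm_pos_iff.2 hne)
    exact not_tendsto_nhds_of_tendsto_atTop h2 _ h1
  rw [hk] at hlin
  simp only [zero_mul] at hlin
  have hd := tendsto_nhds_unique tendsto_const_nhds hlin
  push_cast at hd
  constructor
  · field_simp
    linear_combination 2 * hk
  · field_simp
    linear_combination 2 * hd

theorem exists_legH_eq : ∃ E : ℂ → ℂ, DifferentiableOn ℂ E (Metric.ball 0 1) ∧ E 0 = 0 ∧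
    (∀ x ∈ Metric.ball 0 1 ∩ Complex.slitPlane,
      HasDerivAt legH (-(Real.pi / 4) / (x * (1 - x) * legK x ^ 2)) x) ∧
    ∀ x ∈ Metric.ball 0 1 ∩ Complex.slitPlane,
      legH x = -(1 / Real.pi) * (Complex.log x - 4 * Real.log 2) + E x := by
  obtain ⟨E, c, d, h1, h2, h3, h4⟩ := legH_aux
  obtain ⟨hk, hd⟩ := legH_consts h1 h2 h4
  have hπ : (Real.pi : ℂ) ≠ 0 := by exact_mod_cast Real.pi_ne_zero
  have hc : c = -(Real.pi / 4) := by
    field_simp at hk ⊢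
    linear_combination hk
  refine ⟨E, h1, h2, fun x hx => by rw [← hc]; exact h3 x hx, fun x hx => ?_⟩
  rw [h4 x hx, hk, hd]
  ring

end PainleveSix

end

/-! ### The Riccati solutions on the line q = 0 and their asymptotics. -/

noncomputable section

namespace PainleveSix

open Filter Topology Set

theorem tendsto_mul_log_pow :
    Tendsto (fun t : ℝ => t * (|Real.log t| + Real.pi) ^ 4) (𝓝[>] 0) (𝓝 0) := by
  have h1 : Tendsto (fun x : ℝ => Real.log x * x ^ (1 / 4 : ℝ)) (𝓝[>] 0) (𝓝 0) :=
    tendsto_log_mul_rpow_nhdsGT_zero (by norm_num)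
  have h2 : Tendsto (fun x : ℝ => x ^ (1 / 4 : ℝ)) (𝓝[>] 0) (𝓝 0) := by
    have : ContinuousAt (fun x : ℝ => x ^ (1 / 4 : ℝ)) 0 :=
      Real.continuousAt_rpow_const _ _ (Or.inr (by norm_num))
    have h := this.tendsto
    rw [Real.zero_rpow (by norm_num)] at h
    exact h.mono_left nhdsWithin_le_nhds
  have h3 := (h1.abs.add (h2.mul_const Real.pi)).pow 4
  simp only [abs_zero, zero_mul, add_zero, ne_eq, OfNat.ofNat_ne_zero, not_false_eq_true,
    zero_pow] at h3
  refine h3.congr' ?_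
  filter_upwards [self_mem_nhdsWithin] with t ht
  have ht : 0 < t := ht
  have h4 : (t ^ (1 / 4 : ℝ)) ^ 4 = t := by
    rw [← Real.rpow_natCast, ← Real.rpow_mul ht.le]
    norm_num
  rw [abs_mul, abs_of_pos (Real.rpow_pos_of_pos ht _)]
  calc _ = (t ^ (1 / 4 : ℝ)) ^ 4 * (|Real.log t| + Real.pi) ^ 4 := by ring
    _ = _ := by rw [h4]

/-- The imaginary part of the principal logarithm is at most π in absolute value, so the estimates
hold for any approach to 0, with no restriction on the direction. -/
theorem scale_log {ι : Type*} {l : Filter ι} {x : ι → ℂ} (hx : Tendsto x l (𝓝[≠] 0)) :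
    Scale l x fun i => Complex.log (x i) := by
  have hx0 : ∀ᶠ i in l, x i ≠ 0 := (tendsto_nhdsWithin_iff.1 hx).2
  have hn : Tendsto (fun i => ‖x i‖) l (𝓝[>] 0) := by
    refine tendsto_nhdsWithin_iff.2 ⟨?_, hx0.mono fun i hi => norm_pos_iff.2 hi⟩
    simpa using (tendsto_nhdsWithin_iff.1 hx).1.norm
  have hlog : Tendsto (fun i => ‖Complex.log (x i)‖) l atTop := by
    have h1 := tendsto_abs_atBot_atTop.comp (Real.tendsto_log_nhdsGT_zero.comp hn)
    refine tendsto_atTop_mono (fun i => ?_) h1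
    simpa [Complex.log_re] using Complex.abs_re_le_norm (Complex.log (x i))
  refine ⟨hx0, ?_, ?_, ?_⟩
  · filter_upwards [hlog.eventually_gt_atTop 0] with i hi
    exact norm_pos_iff.1 hi
  · rw [tendsto_zero_iff_norm_tendsto_zero]
    simp only [norm_inv]
    exact tendsto_inv_atTop_zero.comp hlog
  · refine squeeze_zero_norm (fun i => ?_) (tendsto_mul_log_pow.comp hn)
    rw [norm_mul, norm_pow]
    simp only [Function.comp]
    gcongr
    calc ‖Complex.log (x i)‖ ≤ |(Complex.log (x i)).re| + |(Complex.log (x i)).im| :=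
          Complex.norm_le_abs_re_add_abs_im _
      _ ≤ _ := by
        rw [Complex.log_re, Complex.log_im]
        gcongr
        exact Complex.abs_arg_le_pi _

/-- The solution `A K(x) + B K(1 - x)` of the hypergeometric equation. -/
def lam (A B x : ℂ) : ℂ := A * legK x + B * legK (1 - x)

/-- The derivative of `lam A B`. -/
def lamDeriv (A B x : ℂ) : ℂ := A * deriv legK x - B * deriv legK (1 - x)

/-- The solution of the Riccati equation satisfied by `p` when `q = 0`. -/
def ric (A B x : ℂ) : ℂ := (x - 1) * (lamDeriv A B x / lam A B x) + 1 / 2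

theorem hasDerivAt_lam (A B : ℂ) {x : ℂ} (hx : x ∈ slitDomain) :
    HasDerivAt (lam A B) (lamDeriv A B x) x := by
  refine (((hasDerivAt_legK hx.2).const_mul A).add
    ((hasDerivAt_legK_one_sub hx.1).const_mul B)).congr_deriv ?_
  simp only [lamDeriv]
  ring

theorem hasDerivAt_lamDeriv (A B : ℂ) {x : ℂ} (hx : x ∈ slitDomain) :
    HasDerivAt (lamDeriv A B)
      ((lam A B x / 4 - (1 - 2 * x) * lamDeriv A B x) / (x * (1 - x))) x := by
  have h0 := ne_zero_of_mem_slitDomain hx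
  have h1 := one_sub_ne_zero_of_mem_slitDomain hx
  have := (((hasDerivAt_deriv_legK hx.2 h0).const_mul A).add
    ((hasDerivAt_deriv_legK_one_sub hx).const_mul B))
  have e : lamDeriv A B = fun x => A * deriv legK x + B * -deriv legK (1 - x) := by
    funext x
    simp only [lamDeriv]
    ring
  rw [e]
  refine this.congr_deriv ?_
  simp only [lam]
  field_simp
  ring

theorem hasDerivAt_ric (A B : ℂ) {x : ℂ} (hx : x ∈ slitDomain) (h : lam A B x ≠ 0) :
    HasDerivAt (ric A B) (hamP 0 (1 / 2) x 0 (ric A B x)) x := by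
  have h0 := ne_zero_of_mem_slitDomain hx
  have h1 := one_sub_ne_zero_of_mem_slitDomain hx
  have h2 : x - 1 ≠ 0 := by
    rw [← neg_sub]
    exact neg_ne_zero.2 h1
  have := (((hasDerivAt_id x).sub_const 1).mul
    ((hasDerivAt_lamDeriv A B hx).div (hasDerivAt_lam A B hx) h)).add_const (1 / 2)
  refine this.congr_deriv ?_
  simp only [hamP, ric, Pi.div_apply, id]
  generalize lam A B x = L at *
  generalize lamDeriv A B x = D at *
  rw [show 1 - x = -(x - 1) by ring]
  field_simp
  ring

theorem meromorphicOn_of_hasDerivAt {U : Set ℂ} (hU : IsOpen U) {f f' : ℂ → ℂ}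
    (h : ∀ x ∈ U, HasDerivAt f (f' x) x) : MeromorphicOn f U := fun _ hx =>
  (DifferentiableOn.analyticAt
    (fun y hy => (h y hy).differentiableAt.differentiableWithinAt) (hU.mem_nhds hx)).meromorphicAt

theorem meromorphicOn_lam (A B : ℂ) : MeromorphicOn (lam A B) slitDomain :=
  meromorphicOn_of_hasDerivAt isOpen_slitDomain fun _ hx => hasDerivAt_lam A B hx

theorem meromorphicOn_ric (A B : ℂ) : MeromorphicOn (ric A B) slitDomain :=
  ((MeromorphicOn.id.sub (MeromorphicOn.const 1)).mul
    ((meromorphicOn_of_hasDerivAt isOpen_slitDomain fun _ hx => hasDerivAt_lamDeriv A B hx).div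
      (meromorphicOn_lam A B))).add (MeromorphicOn.const (1 / 2))

theorem isHam_ric {A B : ℂ} (h : ∀ᶠ x in codiscreteWithin slitDomain, lam A B x ≠ 0) :
    IsHam 0 (1 / 2) slitDomain fun x => (0, ric A B x) := by
  refine ⟨MeromorphicOn.const 0, meromorphicOn_ric A B, ?_⟩
  filter_upwards [h, mem_of_eventually_codiscreteWithin] with x hx hxU
  refine ⟨?_, hasDerivAt_ric A B hxU hx⟩
  refine (hasDerivAt_const x (0 : ℂ)).congr_deriv ?_
  simp [hamQ]

section asymptotics

variable {ι : Type*} {l : Filter ι} {x : ι → ℂ}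

/-- Asymptotics of the solutions of the Riccati equation at `x = 0`. -/
theorem ric_asymptotics (hx : Tendsto x l (𝓝[≠] 0)) (hxs : ∀ᶠ i in l, x i ∈ Complex.slitPlane)
    (A : ℂ) {B : ℂ} (hB : B ≠ 0) :
    Tendsto (fun i => (-(x i * ric A B (x i))⁻¹ -
      (Complex.log (x i) - 4 * Real.log 2 - Real.pi * A / B)) *
        (Complex.log (x i) - 4 * Real.log 2 - Real.pi * A / B)) l (𝓝 0) ∧
    ∀ᶠ i in l, lam A B (x i) ≠ 0 := by
  obtain ⟨E, hE, hE0, hh', hh⟩ := exists_legH_eq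
  have hπ : (Real.pi : ℂ) ≠ 0 := by exact_mod_cast Real.pi_ne_zero
  set s : ι → ℂ := fun i => Complex.log (x i) - 4 * Real.log 2 - Real.pi * A / B with hs
  have hS : Scale l x s := (scale_log hx).of_tendsto_sub (c := -(4 * Real.log 2 + Real.pi * A / B))
    (tendsto_const_nhds.congr fun i => by simp only [hs]; ring)
  have hx0 := (tendsto_nhdsWithin_iff.1 hx).1
  have h0 : (0 : ℂ) ∈ cutPlane := mem_cutPlane_of_norm_lt (by simp)
  have hgc : ContinuousAt legK 0 := (differentiableAt_legK h0).continuousAt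
  have hg0 : legK 0 ≠ 0 := legK_ne_zero_of_norm_lt (by simp)
  -- With σ = s - πE one has `lam A B` = -(B/π) K σ, hence x · `ric A B` = x k - G/σ, where k comes
  -- from K'/K and G from σ'. Both are regular at 0, and G(0) = 1 because K(0) = π/2.
  set k : ℂ → ℂ := fun t => (t - 1) * (deriv legK t / legK t) + 1 / 2 with hk
  set G : ℂ → ℂ := fun t => Real.pi ^ 2 / 4 / legK t ^ 2 with hG
  have hkc : ContinuousAt k 0 := by
    refine ((continuousAt_id.sub continuousAt_const).mul (ContinuousAt.div ?_ hgc hg0)).add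
      continuousAt_const
    exact (hasDerivAt_deriv_legK_aux h0).continuousAt
  have hGd : DifferentiableAt ℂ G 0 :=
    (differentiableAt_const _).div ((differentiableAt_legK h0).pow 2) (pow_ne_zero 2 hg0)
  have hG0 : G 0 = 1 := by
    simp only [hG, legK_zero]
    field_simp
    norm_num
  have hEd : DifferentiableAt ℂ E 0 := hE.differentiableAt (Metric.ball_mem_nhds 0 one_pos)
  have tk : Tendsto (fun i => k (x i)) l (𝓝 (k 0)) := hkc.tendsto.comp hx0
  have tG : Tendsto (fun i => G (x i)) l (𝓝 1) := by
    have := hGd.continuousAt.tendsto.comp hx0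
    rwa [hG0] at this
  have tE : Tendsto (fun i => E (x i)) l (𝓝 0) := by
    have := hEd.continuousAt.tendsto.comp hx0
    rwa [hE0] at this
  have te : Tendsto (fun i => (x i)⁻¹ * E (x i)) l (𝓝 (deriv E 0)) := by
    refine (hEd.hasDerivAt.tendsto_slope_zero.comp hx).congr fun i => ?_
    simp [hE0]
  have tg : Tendsto (fun i => (x i)⁻¹ * (G (x i) - 1)) l (𝓝 (deriv G 0)) := by
    refine (hGd.hasDerivAt.tendsto_slope_zero.comp hx).congr fun i => ?_
    simp [hG0]
  have tsE : Tendsto (fun i => 1 - Real.pi * E (x i) * (s i)⁻¹) l (𝓝 1) := by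
    simpa using ((tE.const_mul (Real.pi : ℂ)).mul hS.inv).const_sub 1
  have tden : Tendsto (fun i => G (x i) - x i * k (x i) * (s i - Real.pi * E (x i))) l (𝓝 1) := by
    have h1 : Tendsto (fun i => x i * s i ^ 2 * (s i)⁻¹ * k (x i) *
        (1 - Real.pi * E (x i) * (s i)⁻¹)) l (𝓝 0) := by
      simpa using ((hS.small_two.mul hS.inv).mul tk).mul tsE
    have h2 := tG.sub h1
    rw [sub_zero] at h2
    refine h2.congr' ?_
    filter_upwards [hS.sne] with i hi
    field_simp
  have hball : ∀ᶠ i in l, x i ∈ Metric.ball (0 : ℂ) 1 :=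
    hx0.eventually (Metric.ball_mem_nhds 0 one_pos)
  have hform : ∀ᶠ i in l, lam A B (x i) ≠ 0 ∧ -(x i * ric A B (x i))⁻¹ =
      (s i - Real.pi * E (x i)) / (G (x i) - x i * k (x i) * (s i - Real.pi * E (x i))) := by
    filter_upwards [hball, hxs, hS.ne, hS.sne, tsE.eventually_ne one_ne_zero] with i h1 h2 h3 h4 h5
    have hn := mem_ball_zero_iff.1 h1
    have hg := legK_ne_zero_of_norm_lt hn
    have hxD := mem_slitDomain_of_norm_lt h2 hn
    have h1x := one_sub_ne_zero_of_mem_slitDomain hxD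
    have hf : legK (1 - x i) = legK (x i) * legH (x i) := by
      rw [legH]
      field_simp
    have hst : s i - Real.pi * E (x i) ≠ 0 := by
      intro h
      apply h5
      field_simp
      linear_combination h
    have hl : lam A B (x i) = -(B / Real.pi) * legK (x i) * (s i - Real.pi * E (x i)) := by
      rw [lam, hf, hh _ ⟨h1, h2⟩]
      simp only [hs]
      field_simp
      ring
    have hd : lamDeriv A B (x i) = -(B / Real.pi) * deriv legK (x i) * (s i - Real.pi * E (x i)) +
        B * legK (x i) * (-(Real.pi / 4) / (x i * (1 - x i) * legK (x i) ^ 2)) := by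
      have e1 : -deriv legK (1 - x i) = deriv legK (x i) * legH (x i) +
          legK (x i) * (-(Real.pi / 4) / (x i * (1 - x i) * legK (x i) ^ 2)) := by
        have u1 := hasDerivAt_legK_one_sub h2
        have u2 := (hasDerivAt_legK hxD.2).mul (hh' _ ⟨h1, h2⟩)
        refine u1.unique (u2.congr_of_eventuallyEq ?_)
        filter_upwards [(differentiableAt_legK hxD.2).continuousAt.eventually_ne hg] with t ht
        simp only [Pi.mul_apply, legH]
        field_simp
      have e2 : lamDeriv A B (x i) = A * deriv legK (x i) + B * -deriv legK (1 - x i) := by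
        simp only [lamDeriv]
        ring
      rw [e2, e1, hh _ ⟨h1, h2⟩]
      simp only [hs]
      field_simp
      ring
    have hl0 : lam A B (x i) ≠ 0 := by
      rw [hl]
      exact mul_ne_zero (mul_ne_zero (neg_ne_zero.2 (div_ne_zero hB hπ)) hg) hst
    refine ⟨hl0, ?_⟩
    have hr : x i * ric A B (x i) = -(G (x i) - x i * k (x i) * (s i - Real.pi * E (x i))) /
        (s i - Real.pi * E (x i)) := by
      rw [ric, hl, hd]
      simp only [hG, hk]
      generalize s i - Real.pi * E (x i) = σ at *
      rw [show x i - 1 = -(1 - x i) by ring]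
      field_simp
      ring
    rw [hr, inv_div, div_neg, neg_neg]
  refine ⟨?_, hform.mono fun i hi => hi.1⟩
  -- The error multiplied by s is (-πE s - (G - 1)s² + x k s² σ) divided by a quantity tending to 1.
  -- Since E and G - 1 are O(x), everything is x s⁴ times a quantity tending to 0.
  have hfin : Tendsto (fun i => x i * s i ^ 4 * (-Real.pi * ((x i)⁻¹ * E (x i)) * (s i)⁻¹ ^ 3 -
      (x i)⁻¹ * (G (x i) - 1) * (s i)⁻¹ ^ 2 +
      k (x i) * (1 - Real.pi * E (x i) * (s i)⁻¹) * (s i)⁻¹) /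
      (G (x i) - x i * k (x i) * (s i - Real.pi * E (x i)))) l (𝓝 0) := by
    have := (hS.small.mul ((((te.const_mul (-Real.pi : ℂ)).mul (hS.inv.pow 3)).sub
      (tg.mul (hS.inv.pow 2))).add ((tk.mul tsE).mul hS.inv))).div tden one_ne_zero
    simp only [zero_mul, zero_div] at this
    exact this
  refine hfin.congr' ?_
  filter_upwards [hform, hS.ne, hS.sne, tden.eventually_ne one_ne_zero] with i h1 h2 h3 h4
  rw [h1.2, show Complex.log (x i) - 4 * Real.log 2 - Real.pi * A / B = s i from rfl]
  generalize hD : G (x i) - x i * k (x i) * (s i - Real.pi * E (x i)) = D at *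
  rw [eq_comm, div_sub' h4, div_mul_eq_mul_div]
  congr 1
  rw [← hD]
  field_simp
  ring

end asymptotics

end PainleveSix

end

/-! ### The iterated translations and their compatibility with the symmetries. -/

noncomputable section

namespace PainleveSix

open Filter Topology Set

/-- The iterated translations of the point `z`, which take the parameter `α₄ = 0` to `α₄ = 2 m`. -/
def chain (x : ℂ) (z : ℂ × ℂ) : ℕ → ℂ × ℂ
  | 0 => z
  | m + 1 => mapT (1 / 2 + m) x (mapC (2 * m) (chain x z m))

/-- Regularity of the `m`-th step of the iteration `chain`. -/
structure ChainReg (x : ℂ) (z : ℂ × ℂ) (m : ℕ) : Prop where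
  zero : m ≠ 0 → (chain x z m).1 ≠ 0
  ne : (chain x z m).1 ≠ x
  reg : regT (1 / 2 + m) x (mapC (2 * m) (chain x z m)) ≠ 0

/-- The shift of the logarithm after `m` translations. -/
def logShift (m : ℕ) : ℂ := 2 * (harmonic m : ℂ) - 1 / m

theorem logShift_one : logShift 1 = 1 := by
  simp [logShift, harmonic]
  norm_num

theorem logShift_succ (m : ℕ) :
    logShift (m + 1) = logShift m + 1 / m + 1 / (m + 1) := by
  simp only [logShift, harmonic_succ]
  push_cast
  ring

section asymptotics

variable {ι : Type*} {l : Filter ι} {x p : ι → ℂ}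

/-- Each step combines n ↦ -n (`mapC`) with n ↦ 1 - n (`mapT`), so n = m + 1 becomes m + 2 and the
logarithm is shifted by 1/(m + 1) + 1/(m + 2), the increment of `logShift`. The induction starts at
`m + 1 = 1` because the profile at α₄ = 0 is degenerate. -/
theorem chain_aux (hx : Scale l x fun i => -(x i * p i)⁻¹) (m : ℕ) :
    (∀ᶠ i in l, ChainReg (x i) (0, p i) m) ∧
    Asy l x (fun i => -(x i * p i)⁻¹ + logShift (m + 1)) (fun i => chain (x i) (0, p i) (m + 1))
      (fun t => 1 - ((m : ℂ) + 1) ^ 2 * t ^ 2) (fun t => t * (1 - ((m : ℂ) + 1) * t)) := by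
  induction m with
  | zero =>
    obtain ⟨h1, h2⟩ := asy_mapT_zero hx
    have e : ∀ z : ℂ × ℂ, mapC (2 * (0 : ℕ)) z = z := fun z => by simp [mapC]
    have e2 : (1 / 2 + (0 : ℕ) : ℂ) = 1 / 2 := by simp
    constructor
    · filter_upwards [h1, hx.ne] with i hi hi0
      refine ⟨fun h => absurd rfl h, hi0.symm, ?_⟩
      simp only [chain, e, e2]
      exact hi
    · simp only [chain, e, e2]
      refine h2.congr (fun i => ?_) (fun i => ?_)
      · rw [logShift_one]
        push_cast
        ring
      · rw [logShift_one]
        push_cast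
        ring
  | succ m ih =>
    obtain ⟨-, ih⟩ := ih
    have hm : (m : ℂ) + 1 ≠ 0 := by exact_mod_cast Nat.succ_ne_zero m
    have hm2 : (m : ℂ) + 1 + 1 ≠ 0 := by exact_mod_cast Nat.succ_ne_zero (m + 1)
    have hS : Scale l x fun i => -(x i * p i)⁻¹ + logShift (m + 1) :=
      hx.of_tendsto_sub (c := logShift (m + 1)) (tendsto_const_nhds.congr fun i => by ring)
    obtain ⟨r1, k1⟩ := ih.mapC hm hS
    have k2 : Asy l x (fun i => -(x i * p i)⁻¹ + logShift (m + 1))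
        (fun i => PainleveSix.mapC (2 * ((m : ℂ) + 1)) (chain (x i) (0, p i) (m + 1)))
        (fun t => 1 - (-((m : ℂ) + 1)) ^ 2 * t ^ 2) (fun t => t * (1 - (-((m : ℂ) + 1)) * t)) :=
      k1.congr (fun i => by ring) (fun i => by ring)
    obtain ⟨r2, k3⟩ := k2.mapT (neg_ne_zero.2 hm) (fun h => hm2 (by linear_combination -h)) hS
    have e : (1 / 2 + ((m + 1 : ℕ) : ℂ)) = 1 / 2 - -((m : ℂ) + 1) := by push_cast; ring
    have e2 : (2 * ((m + 1 : ℕ) : ℂ)) = 2 * ((m : ℂ) + 1) := by push_cast; ring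
    constructor
    · filter_upwards [r1, r2] with i h1 h2
      refine ⟨fun _ => h1, h2.1, ?_⟩
      rw [e, e2]
      exact h2.2
    · simp only [chain] at k3 ⊢
      rw [e]
      simp only [e2]
      have h3 : ∀ i, -(x i * p i)⁻¹ + logShift (m + 1) - 1 / -((m : ℂ) + 1) -
          1 / (-((m : ℂ) + 1) - 1) = -(x i * p i)⁻¹ + logShift (m + 1 + 1) := fun i => by
        rw [logShift_succ (m + 1)]
        have h4 : -((m : ℂ) + 1) - 1 ≠ 0 := fun h => hm2 (by linear_combination -h)
        push_cast
        field_simp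
        ring
      refine k3.congr (fun i => ?_) (fun i => ?_)
      · simp only [h3]
        push_cast
        ring
      · simp only [h3]
        push_cast
        ring

theorem chain_reg (hx : Scale l x fun i => -(x i * p i)⁻¹) (m : ℕ) :
    ∀ᶠ i in l, ChainReg (x i) (0, p i) m := (chain_aux hx m).1

/-- Asymptotics of the iterated translations in terms of the asymptotics of the solution of the
Riccati equation. -/
theorem tendsto_chain {s : ι → ℂ} (hs : Scale l x s)
    (h : Tendsto (fun i => (-(x i * p i)⁻¹ - s i) * s i) l (𝓝 0)) {n : ℕ} (hn : n ≠ 0) :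
    Tendsto (fun i => (chain (x i) (0, p i) n).1 / x i -
      (1 - (n : ℂ) ^ 2 * (s i + logShift n) ^ 2)) l (𝓝 0) ∧
    ∀ m, ∀ᶠ i in l, ChainReg (x i) (0, p i) m := by
  have h0 : Tendsto (fun i => -(x i * p i)⁻¹ - s i) l (𝓝 0) := by
    have := h.mul hs.inv
    rw [zero_mul] at this
    refine this.congr' ?_
    filter_upwards [hs.sne] with i hi
    field_simp
  have hS := hs.of_tendsto_sub h0
  refine ⟨?_, chain_reg hS⟩
  obtain ⟨m, rfl⟩ := Nat.exists_eq_succ_of_ne_zero hn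
  have h1 := (chain_aux hS m).2.fst
  set c := logShift (m + 1)
  -- Replacing -1/(x p) by s inside a square produces the cross term 2 (error) s; this is why the
  -- hypothesis requires the error to be o(1/s).
  have h2 : Tendsto (fun i => -((m : ℂ) + 1) ^ 2 * ((-(x i * p i)⁻¹ - s i) *
      (-(x i * p i)⁻¹ - s i) + 2 * ((-(x i * p i)⁻¹ - s i) * s i) +
        2 * c * (-(x i * p i)⁻¹ - s i))) l (𝓝 0) := by
    simpa using ((((h0.mul h0).add (h.const_mul 2)).add (h0.const_mul (2 * c))).const_mul
      (-((m : ℂ) + 1) ^ 2))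
  have h3 := h1.add h2
  rw [add_zero] at h3
  refine h3.congr fun i => ?_
  push_cast
  ring

end asymptotics

/-! ### Symmetries -/

theorem symInf_chain {x : ℂ} (hx : x ≠ 0) (z : ℂ × ℂ) (m : ℕ) :
    symInf x (chain x z m) = chain (1 / x) (symInf x z) m := by
  induction m with
  | zero => rfl
  | succ m ih => simp only [chain, symInf_mapT hx, symInf_mapC, ih]

/-- Regularity of all earlier steps is needed, unlike for `symInf_chain`, since `symOne` divides by
q - x. The parameter of `symOne` is the current value 1/2 - m of α₂. -/
theorem symOne_chain {x : ℂ} (hx : x ≠ 0) (hx1 : x ≠ 1) {z : ℂ × ℂ} (m : ℕ)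
    (h : ∀ k ≤ m, ChainReg x z k) :
    symOne (1 / 2 - m) x (chain x z m) = chain (1 - x) (symOne (1 / 2) x z) m := by
  induction m with
  | zero => simp [chain]
  | succ m ih =>
    have ih := ih fun k hk => h k (hk.trans m.le_succ)
    have h1 := h m m.le_succ
    have h2 := (h (m + 1) le_rfl).ne
    simp only [chain] at h2 ⊢
    have k1 := symOne_mapT (a := 1 / 2 + m) hx hx1 h1.reg h1.ne h2
    have k2 := symOne_mapC (b := 1 / 2 - m) (c := 2 * m) (z := chain x z m) h1.ne (by
      rcases eq_or_ne m 0 with h0 | h0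
      · left; simp [h0]
      · exact Or.inr (h1.zero h0)) hx hx1
    rw [show (1 / 2 - m + 2 * m : ℂ) = 1 / 2 + m by ring] at k2
    rw [show (1 / 2 - ((m + 1 : ℕ) : ℂ)) = -(1 / 2 + m) by push_cast; ring, k1, k2, ih]

/-- The substitution x ↦ 1 - x exchanges K(x) and K(1 - x), hence A and B; the line q = 0 is
preserved. -/
theorem symOne_ric (A B : ℂ) {x : ℂ} (hx : x ≠ 0) (hx1 : x ≠ 1) :
    symOne (1 / 2) x (0, ric A B x) = (0, ric B A (1 - x)) := by
  have hx1' : 1 - x ≠ 0 := sub_ne_zero.2 hx1.symm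
  have e1 : lam B A (1 - x) = lam A B x := by
    simp only [lam, sub_sub_cancel]
    ring
  have e2 : lamDeriv B A (1 - x) = -lamDeriv A B x := by
    simp only [lamDeriv, sub_sub_cancel]
    ring
  ext
  · simp [symOne]
  · simp only [symOne, ric, e1, e2, neg_div]
    generalize lamDeriv A B x / lam A B x = r
    field_simp
    ring

/-! ### Meromorphic solutions -/

/-- The germ at `0` of the positive real half-line. -/
def ray : Filter ℂ := Filter.map (fun t : ℝ => (t : ℂ)) (𝓝[>] 0)

instance : NeBot ray := Filter.map_neBot

/-- Exceptional points of a codiscrete property are isolated, so they cannot fill an interval of the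
positive axis inside `U`. -/
theorem frequently_ray {U : Set ℂ} (hU : IsOpen U) (hray : ∀ᶠ x in ray, x ∈ U) {P : ℂ → Prop}
    (h : ∀ᶠ x in codiscreteWithin U, P x) : ∃ᶠ x in ray, P x := by
  intro hn
  have h1 : ∀ᶠ t : ℝ in 𝓝[>] 0, (t : ℂ) ∈ U ∧ ¬P t := hray.and hn
  obtain ⟨ε, hε, hε'⟩ := mem_nhdsGT_iff_exists_Ioo_subset.1 h1
  have hε : 0 < ε := hε
  obtain ⟨t, ht⟩ : ∃ t, t ∈ Ioo 0 ε := nonempty_Ioo.2 hε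
  have h2 := (eventually_codiscreteWithin_iff hU).1 h t (hε' ht).1
  have h3 : Tendsto (fun t : ℝ => (t : ℂ)) (𝓝[≠] t) (𝓝[≠] (t : ℂ)) := by
    refine tendsto_nhdsWithin_iff.2 ⟨(Complex.continuous_ofReal.tendsto t).mono_left
      nhdsWithin_le_nhds, ?_⟩
    filter_upwards [self_mem_nhdsWithin] with s hs
    simpa using hs
  obtain ⟨s, hs1, hs2⟩ := ((h3.eventually h2).and (mem_nhdsWithin_of_mem_nhds
    (Ioo_mem_nhds ht.1 ht.2))).exists
  exact (hε' hs2).2 hs1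

/-- By the identity theorem, the asymptotics along a single ray are enough to exclude identical
vanishing on `U`. All genericity conditions for the reflections are obtained in this way. -/
theorem MeromorphicOn.ne_zero_of_ray {U : Set ℂ} (hU : IsOpen U) (hc : IsPreconnected U)
    (hray : ∀ᶠ x in ray, x ∈ U) {f : ℂ → ℂ} (hf : MeromorphicOn f U)
    (h : ∀ᶠ x in ray, f x ≠ 0) : ∀ᶠ x in codiscreteWithin U, f x ≠ 0 := by
  refine (MeromorphicOn.eq_zero_or_ne_zero hU hc hf).resolve_left fun h0 => ?_
  obtain ⟨x, h1, h2⟩ := ((frequently_ray hU hray h0).and_eventually h).exists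
  exact h2 h1

theorem isHam_chain {U : Set ℂ} (hU : IsOpen U) (hc : IsPreconnected U)
    (hray : ∀ᶠ x in ray, x ∈ U) (hUs : U ⊆ slitDomain) {p : ℂ → ℂ}
    (h : IsHam 0 (1 / 2) U fun x => (0, p x)) (hr : ∀ m, ∀ᶠ x in ray, ChainReg x (0, p x) m)
    (m : ℕ) : IsHam 0 (1 / 2 - m) U fun x => chain x (0, p x) m := by
  induction m with
  | zero => simpa [chain] using h
  | succ m ih =>
    have k1 := ih.mapC hUs (c := 2 * m) (by ring) (by
      rcases eq_or_ne m 0 with h0 | h0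
      · left; simp [h0]
      · right
        exact MeromorphicOn.ne_zero_of_ray hU hc hray ih.mero_fst
          ((hr m).mono fun x hx => hx.zero h0))
    rw [show (1 / 2 - m + 2 * m : ℂ) = 1 / 2 + m by ring] at k1
    have k2 := k1.mapT hUs (MeromorphicOn.ne_zero_of_ray hU hc hray
      (meromorphicOn_regT _ k1.mero_fst k1.mero_snd) ((hr m).mono fun x hx => hx.reg))
    rw [show -(1 / 2 + m : ℂ) = 1 / 2 - ((m + 1 : ℕ) : ℂ) by push_cast; ring] at k2
    exact k2

theorem IsHam.isSolutionOn {U : Set ℂ} (hU : IsOpen U) (hUs : U ⊆ slitDomain) {b : ℂ}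
    {z : ℂ → ℂ × ℂ} (h : IsHam 0 b U z) {p : ℂ} (hp : (1 - 2 * b) ^ 2 = (2 * p) ^ 2)
    (h0 : ∀ᶠ x in codiscreteWithin U, (z x).1 ≠ 0)
    (h1 : ∀ᶠ x in codiscreteWithin U, (z x).1 ≠ 1)
    (hx : ∀ᶠ x in codiscreteWithin U, (z x).1 ≠ x) :
    IsSolutionOn (2 * p) 0 0 1 U fun x => (z x).1 := by
  refine ⟨h.mero_fst, ?_⟩
  filter_upwards [h0, h1, hx, eventually_codiscreteWithin_nhds hU h.ham,
    mem_of_eventually_codiscreteWithin] with x k0 k1 kx kh kU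
  refine ⟨k0, k1, kx, HamAt.deriv_deriv kh ?_ ?_ k0 k1 kx hp⟩
  · exact ne_zero_of_mem_slitDomain (hUs kU)
  · exact (sub_ne_zero.1 (one_sub_ne_zero_of_mem_slitDomain (hUs kU))).symm

end PainleveSix

end

/-! ### The explicit solution and its behavior at 0 and at 1. -/

noncomputable section

namespace PainleveSix

open Filter Topology Set

theorem shift_eq (p : ℤ) : (shift p : ℂ) = 4 * Real.log 2 - logShift p.natAbs := by
  simp only [shift, logShift]
  push_cast
  ring

theorem natAbs_sq_cast (p : ℤ) : ((p.natAbs : ℕ) : ℂ) ^ 2 = (p : ℂ) ^ 2 := by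
  rw [← Int.cast_natCast, ← Int.cast_pow, Int.natAbs_sq, Int.cast_pow]

section behaviour

variable {ι : Type*} {l : Filter ι} {x : ι → ℂ}

theorem scale_log_sub (hx : Tendsto x l (𝓝[≠] 0)) (c d : ℂ) :
    Scale l x fun i => Complex.log (x i) - c - d :=
  (scale_log hx).of_tendsto_sub (c := -c - d) (tendsto_const_nhds.congr fun i => by ring)

theorem chain_ric_asymptotics (hx : Tendsto x l (𝓝[≠] 0))
    (hxs : ∀ᶠ i in l, x i ∈ Complex.slitPlane) (A : ℂ) {B : ℂ} (hB : B ≠ 0) {n : ℕ} (hn : n ≠ 0) :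
    Tendsto (fun i => (chain (x i) (0, ric A B (x i)) n).1 / x i -
      (1 - (n : ℂ) ^ 2 * (Complex.log (x i) - 4 * Real.log 2 - Real.pi * A / B + logShift n) ^ 2))
      l (𝓝 0) ∧ ∀ m, ∀ᶠ i in l, ChainReg (x i) (0, ric A B (x i)) m :=
  tendsto_chain (scale_log_sub hx _ _) (ric_asymptotics hx hxs A hB).1 hn

theorem tendsto_zero_of_quad {s : ι → ℂ} (hs : Scale l x s) {q : ι → ℂ} {a : ℂ}
    (h : Tendsto (fun i => q i / x i - (1 - a * s i ^ 2)) l (𝓝 0)) : Tendsto q l (𝓝 0) := by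
  have h1 := (hs.tendsto_zero.mul h).add (hs.small_two.mul (tendsto_quad hs 1 0 (-a)))
  simp only [zero_mul, add_zero] at h1
  refine h1.congr' ?_
  filter_upwards [hs.ne, hs.sne] with i h1 h2
  field_simp
  ring

end behaviour

theorem tendsto_ray : Tendsto (fun x : ℂ => x) ray (𝓝[≠] 0) := by
  refine tendsto_nhdsWithin_iff.2 ⟨tendsto_ofReal_nhdsGT_zero, ?_⟩
  have : ∀ᶠ t : ℝ in 𝓝[>] 0, (t : ℂ) ∈ ({0}ᶜ : Set ℂ) := by
    filter_upwards [self_mem_nhdsWithin] with t ht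
    exact Complex.ofReal_ne_zero.2 (ne_of_gt ht)
  exact this

theorem ray_slitPlane : ∀ᶠ x in ray, x ∈ Complex.slitPlane := by
  have : ∀ᶠ t : ℝ in 𝓝[>] 0, (t : ℂ) ∈ Complex.slitPlane := by
    filter_upwards [self_mem_nhdsWithin] with t ht
    exact Or.inl (by simpa using ht)
  exact this

theorem ray_ball {r : ℝ} (hr : 0 < r) : ∀ᶠ x in ray, ‖x‖ < r := by
  have := (tendsto_nhdsWithin_iff.1 tendsto_ray).1.norm
  rw [norm_zero] at this
  exact this.eventually_lt_const hr

theorem ray_slitDomain : ∀ᶠ x in ray, x ∈ slitDomain := by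
  filter_upwards [ray_slitPlane, ray_ball one_pos] with x h1 h2
  exact mem_slitDomain_of_norm_lt h1 h2

/-- The asymptotics at 0 serve here only as a certificate that no denominator, and none of q, q - 1,
q - x, vanishes identically. -/
theorem isSolutionOn_chain (A : ℂ) {B : ℂ} (hB : B ≠ 0) {p : ℤ} (hp : p ≠ 0) :
    IsSolutionOn (2 * (p : ℂ)) 0 0 1 slitDomain
      fun x => (chain x (0, ric A B x) p.natAbs).1 := by
  have hn : p.natAbs ≠ 0 := Int.natAbs_ne_zero.2 hp
  obtain ⟨h1, h2⟩ := chain_ric_asymptotics tendsto_ray ray_slitPlane A hB hn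
  have hlam : ∀ᶠ x in codiscreteWithin slitDomain, lam A B x ≠ 0 :=
    MeromorphicOn.ne_zero_of_ray isOpen_slitDomain isPreconnected_slitDomain ray_slitDomain
      (meromorphicOn_lam A B) (ric_asymptotics tendsto_ray ray_slitPlane A hB).2
  have hH := isHam_chain isOpen_slitDomain isPreconnected_slitDomain ray_slitDomain Subset.rfl
    (isHam_ric hlam) h2 p.natAbs
  have hS := scale_log_sub tendsto_ray (4 * Real.log 2) (Real.pi * A / B - logShift p.natAbs)
  have hq := tendsto_zero_of_quad (q := fun x => (chain x (0, ric A B x) p.natAbs).1) hS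
    (a := (p.natAbs : ℂ) ^ 2) (h1.congr fun x => by ring)
  refine hH.isSolutionOn isOpen_slitDomain Subset.rfl ?_ ?_ ?_ ?_
  · linear_combination 4 * natAbs_sq_cast p
  · exact MeromorphicOn.ne_zero_of_ray isOpen_slitDomain isPreconnected_slitDomain ray_slitDomain
      hH.mero_fst ((h2 _).mono fun x hx => hx.zero hn)
  · have := MeromorphicOn.ne_zero_of_ray isOpen_slitDomain isPreconnected_slitDomain ray_slitDomain
      (hH.mero_fst.sub (MeromorphicOn.const 1)) ((hq.eventually_ne zero_ne_one).mono
        fun x hx => sub_ne_zero.2 hx)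
    exact this.mono fun x hx => sub_ne_zero.1 hx
  · have := MeromorphicOn.ne_zero_of_ray isOpen_slitDomain isPreconnected_slitDomain ray_slitDomain
      (hH.mero_fst.sub MeromorphicOn.id) ((h2 _).mono fun x hx => sub_ne_zero.2 hx.ne)
    exact this.mono fun x hx => sub_ne_zero.1 hx

theorem behaviorAtZero_chain {p : ℤ} (hp : p ≠ 0) (A : ℂ) {B : ℂ} (hB : B ≠ 0) :
    BehaviorAtZero p (-(Real.pi * A / B) - shift p) slitDomain
      fun x => (chain x (0, ric A B x) p.natAbs).1 := by
  have hx : Tendsto (fun x : ℂ => x) (𝓝[slitDomain] 0) (𝓝[≠] 0) :=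
    nhdsWithin_mono 0 fun x hx => ne_zero_of_mem_slitDomain hx
  have h := (chain_ric_asymptotics hx (eventually_mem_nhdsWithin.mono fun x hx => hx.1) A hB
    (Int.natAbs_ne_zero.2 hp)).1
  refine h.congr fun x => ?_
  rw [natAbs_sq_cast, shift_eq]
  ring

theorem behaviorAtOne_chain {p : ℤ} (hp : p ≠ 0) {A : ℂ} (B : ℂ) (hA : A ≠ 0) :
    BehaviorAtOne p (-(Real.pi * B / A) - shift p) slitDomain
      fun x => (chain x (0, ric A B x) p.natAbs).1 := by
  have hn : p.natAbs ≠ 0 := Int.natAbs_ne_zero.2 hp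
  have hpc : (p : ℂ) ≠ 0 := by exact_mod_cast hp
  set ρ : ℂ := -(Real.pi * B / A) - shift p with hρ
  have hx : Tendsto (fun x : ℂ => 1 - x) (𝓝[slitDomain] 1) (𝓝[≠] 0) := by
    refine tendsto_nhdsWithin_iff.2 ⟨?_, eventually_mem_nhdsWithin.mono fun x hx =>
      one_sub_ne_zero_of_mem_slitDomain hx⟩
    exact (Continuous.tendsto' (by fun_prop) 1 0 (by ring)).mono_left nhdsWithin_le_nhds
  obtain ⟨h1, h2⟩ := chain_ric_asymptotics hx
    (eventually_mem_nhdsWithin.mono fun x hx => hx.2) B hA hn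
  set s : ℂ → ℂ := fun x => Complex.log (1 - x) + ρ with hs
  have hL := scale_log hx
  have hS : Scale (𝓝[slitDomain] 1) (fun x : ℂ => 1 - x) s :=
    hL.of_tendsto_sub (c := ρ) (tendsto_const_nhds.congr fun i => by simp only [hs]; ring)
  -- V is q/x for the solution with A and B exchanged, taken at the point 1 - x. By `symOne` the
  -- solution at x equals x V/(V - 1) = x (1 + 1/(V - 1)).
  set V : ℂ → ℂ := fun x => (chain (1 - x) (0, ric B A (1 - x)) p.natAbs).1 / (1 - x) with hV
  have hVs : Tendsto (fun x => V x - (1 - (p : ℂ) ^ 2 * s x ^ 2)) (𝓝[slitDomain] 1) (𝓝 0) := by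
    refine h1.congr fun x => ?_
    simp only [hs, hρ]
    rw [natAbs_sq_cast, shift_eq]
    ring
  have hreg : ∀ᶠ x in 𝓝[slitDomain] 1, ∀ k ≤ p.natAbs,
      ChainReg (1 - x) (0, ric B A (1 - x)) k := by
    have := (Finset.range (p.natAbs + 1)).eventually_all.2 fun k _ => h2 k
    filter_upwards [this] with x hx k hk
    exact hx k (Finset.mem_range.2 (Nat.lt_succ_of_le hk))
  have hY : ∀ᶠ x in 𝓝[slitDomain] 1, V x - 1 ≠ 0 ∧ (chain x (0, ric A B x) p.natAbs).1 =
      x * (1 + 1 / (V x - 1)) := by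
    filter_upwards [hreg, eventually_mem_nhdsWithin] with x h3 hxU
    have k0 := ne_zero_of_mem_slitDomain hxU
    have k1 := one_sub_ne_zero_of_mem_slitDomain hxU
    have k2 := symOne_chain k1 (fun h => k0 (by linear_combination -h)) p.natAbs h3
    rw [symOne_ric B A k1 (fun h => k0 (by linear_combination -h)), sub_sub_cancel] at k2
    have k3 := sub_ne_zero.2 (h3 _ le_rfl).ne
    have k4 : V x - 1 = ((chain (1 - x) (0, ric B A (1 - x)) p.natAbs).1 - (1 - x)) / (1 - x) := by
      simp only [hV]
      field_simp
    refine ⟨?_, ?_⟩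
    · rw [k4]
      exact div_ne_zero k3 k1
    · rw [← k2, k4]
      simp only [symOne]
      field_simp
      ring
  have hlog0 : ∀ᶠ x in 𝓝[slitDomain] 1, 1 / Complex.log (1 - x) ^ 4 = 0 →
      (chain x (0, ric A B x) p.natAbs).1 -
        (1 - 1 / ((p : ℂ) ^ 2 * (Complex.log (1 - x) + ρ) ^ 2)) = 0 := by
    filter_upwards [hL.sne] with x hx h
    exact absurd h (one_div_ne_zero (pow_ne_zero 4 hx))
  refine (Asymptotics.isLittleO_iff_tendsto' hlog0).2 ?_
  have hV1 : Tendsto (fun x => (V x - 1) * (s x)⁻¹ ^ 2) (𝓝[slitDomain] 1) (𝓝 (-(p : ℂ) ^ 2)) := by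
    have := (hVs.mul (hS.inv.pow 2)).add (tendsto_quad hS 0 0 (-(p : ℂ) ^ 2))
    rw [zero_mul, zero_add] at this
    exact this.congr fun x => by ring
  have hls : Tendsto (fun x => Complex.log (1 - x) * (s x)⁻¹) (𝓝[slitDomain] 1) (𝓝 1) :=
    (tendsto_linear hS (-ρ) 1).congr fun x => by simp only [hs]; ring
  have hp2 : (-(p : ℂ) ^ 2) ≠ 0 := neg_ne_zero.2 (pow_ne_zero 2 hpc)
  -- Since V - 1 = -p²s² + o(1), the difference 1/(V - 1) + 1/(p²s²) is o(s⁻⁴), and replacing the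
  -- factor x by 1 costs O(1 - x), which is also o(s⁻⁴). The last factor passes from s⁴ to log⁴(1 -
  -- x).
  have hfin : Tendsto (fun x => ((V x - (1 - (p : ℂ) ^ 2 * s x ^ 2)) /
      ((p : ℂ) ^ 2 * ((V x - 1) * (s x)⁻¹ ^ 2)) - (1 - x) * s x ^ 4 *
        (1 + (s x)⁻¹ ^ 2 / ((V x - 1) * (s x)⁻¹ ^ 2))) *
        (Complex.log (1 - x) * (s x)⁻¹) ^ 4) (𝓝[slitDomain] 1) (𝓝 0) := by
    have := ((hVs.div (hV1.const_mul ((p : ℂ) ^ 2)) (mul_ne_zero (pow_ne_zero 2 hpc) hp2)).sub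
      (hS.small.mul (((hS.inv.pow 2).div hV1 hp2).const_add 1))).mul (hls.pow 4)
    simp only [zero_div, zero_mul, sub_zero] at this
    exact this
  refine hfin.congr' ?_
  filter_upwards [hY, hS.sne, hL.sne] with x h3 h4 h5
  rw [h3.2, show Complex.log (1 - x) + ρ = s x from rfl]
  have h6 := h3.1
  generalize hW : V x - 1 = W at *
  rw [show V x = W + 1 by rw [← hW]; ring]
  field_simp
  ring

end PainleveSix

end

/-! ### The connection formula between 0 and infinity. -/

noncomputable section

namespace PainleveSix

open Filter Topology Set

/-- The half disc on which `t = 1 / x` ranges for large `x` in the upper half-plane. -/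
def lowerHalfDisc : Set ℂ := Metric.ball 0 (1 / 2) ∩ {t | t.im < 0}

theorem isOpen_lowerHalfDisc : IsOpen lowerHalfDisc :=
  Metric.isOpen_ball.inter (isOpen_lt Complex.continuous_im continuous_const)

theorem isPreconnected_lowerHalfDisc : IsPreconnected lowerHalfDisc :=
  ((convex_ball _ _).inter (convex_halfSpace_im_lt 0)).isPreconnected

theorem lowerHalfDisc_mem {t : ℂ} (ht : t ∈ lowerHalfDisc) :
    t ∈ Metric.ball (0 : ℂ) 1 ∩ Complex.slitPlane ∧
      t / (t - 1) ∈ Metric.ball (0 : ℂ) 1 ∩ Complex.slitPlane ∧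
      1 - t ∈ Complex.slitPlane ∧ 0 < (1 - t).im ∧ 0 < (t / (t - 1)).im := by
  obtain ⟨h1, h2⟩ := ht
  rw [mem_ball_zero_iff] at h1
  have h2 : t.im < 0 := h2
  have h3 : 0 < (1 - t).im := by simpa using h2
  have h4 : 1 - t ∈ Complex.slitPlane := Or.inr h3.ne'
  have h5 : t - 1 ≠ 0 := by
    rw [← neg_sub]
    exact neg_ne_zero.2 (Complex.slitPlane_ne_zero h4)
  have h6 : (t / (t - 1)).im = -t.im / Complex.normSq (t - 1) := by
    rw [Complex.div_im]
    simp
    ring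
  have h7 : 0 < (t / (t - 1)).im := by
    rw [h6]
    exact div_pos (by linarith) (Complex.normSq_pos.2 h5)
  refine ⟨⟨mem_ball_zero_iff.2 (by linarith), Or.inr h2.ne⟩,
    ⟨mem_ball_zero_iff.2 ?_, Or.inr h7.ne'⟩, h4, h3, h7⟩
  rw [norm_div, div_lt_one (norm_pos_iff.2 h5)]
  have := norm_sub_norm_le (1 : ℂ) (1 - t)
  have h8 := norm_sub_norm_le (1 : ℂ) t
  rw [norm_one, norm_sub_rev] at h8
  linarith

theorem legK_div_sub_one {t : ℂ} (ht : t ∈ lowerHalfDisc) :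
    legK (t / (t - 1)) = ((1 - t)⁻¹) ^ (-1 / 2 : ℂ) * legK t := by
  obtain ⟨-, -, h1, -⟩ := lowerHalfDisc_mem ht
  have h0 := Complex.slitPlane_ne_zero h1
  have h := legK_one_sub (inv_mem_slitPlane h1)
  have h2 : t - 1 ≠ 0 := by
    rw [← neg_sub]
    exact neg_ne_zero.2 h0
  rwa [inv_inv, sub_sub_cancel, show 1 - (1 - t)⁻¹ = t / (t - 1) by
    rw [show t - 1 = -(1 - t) by ring]
    field_simp
    ring] at h

theorem cpow_neg_half_sq (z : ℂ) : (z ^ (-1 / 2 : ℂ)) ^ 2 = z⁻¹ := by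
  rw [← Complex.cpow_nat_mul, ← Complex.cpow_neg_one]
  congr 1
  norm_num

theorem log_div_sub_one {t : ℂ} (ht : t ∈ lowerHalfDisc) :
    Complex.log (t / (t - 1)) = Complex.log t + Real.pi * Complex.I - Complex.log (1 - t) := by
  obtain ⟨h1, h2, h3, h4, h5⟩ := lowerHalfDisc_mem ht
  have ht0 : t.im < 0 := ht.2
  have h0 := Complex.slitPlane_ne_zero h3
  have h6 : t - 1 ≠ 0 := by
    rw [← neg_sub]
    exact neg_ne_zero.2 h0
  have h7 : 0 < (-t).im := by simpa using ht0
  have h8 : ((1 - t)⁻¹).im ≤ 0 := by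
    rw [Complex.inv_im]
    exact div_nonpos_of_nonpos_of_nonneg (by linarith) (Complex.normSq_nonneg _)
  have e : t / (t - 1) = -t * (1 - t)⁻¹ := by
    rw [show t - 1 = -(1 - t) by ring]
    field_simp
  rw [e, log_mul_of_im (Or.inr h7.ne') (inv_mem_slitPlane h3) (Or.inl ⟨h7.le, h8⟩),
    Complex.log_inv _ (Complex.slitPlane_arg_ne_pi h3)]
  have e2 : Complex.log (-t) = Complex.log t + Real.pi * Complex.I := by
    simp only [Complex.log, norm_neg, Complex.arg_neg_eq_arg_add_pi_of_im_neg ht0]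
    push_cast
    ring
  rw [e2]
  ring

/-- The quotient `K(1 - t) / K(t)` under the transformation `t ↦ t / (t - 1)`. -/
theorem legH_div_sub_one {t : ℂ} (ht : t ∈ lowerHalfDisc) :
    legH (t / (t - 1)) = legH t - Complex.I := by
  obtain ⟨E, hE, hE0, hh', hh⟩ := exists_legH_eq
  have hπ : (Real.pi : ℂ) ≠ 0 := by exact_mod_cast Real.pi_ne_zero
  -- By Pfaff's transformation both quotients have the same derivative, so they differ by a
  -- constant, which is read off as t → 0. It comes from log(-t) = log t + πi in the lower
  -- half-plane, multiplied by -1/π.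
  have hd : ∀ x ∈ lowerHalfDisc, HasDerivAt (fun t => legH (t / (t - 1)) - legH t) 0 x := by
    intro x hx
    obtain ⟨h1, h2, h3, h4, h5⟩ := lowerHalfDisc_mem hx
    have h0 := Complex.slitPlane_ne_zero h3
    have h6 : x - 1 ≠ 0 := by
      rw [← neg_sub]
      exact neg_ne_zero.2 h0
    have hx0 := Complex.slitPlane_ne_zero h1.2
    have k1 : HasDerivAt (fun t : ℂ => t / (t - 1)) (-1 / (x - 1) ^ 2) x := by
      refine ((hasDerivAt_id x).div ((hasDerivAt_id x).sub_const 1) h6).congr_deriv ?_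
      simp only [id]
      ring
    refine (((hh' _ h2).comp x k1).sub (hh' _ h1)).congr_deriv ?_
    have hg := legK_ne_zero_of_norm_lt (mem_ball_zero_iff.1 h1.1)
    rw [legK_div_sub_one hx, mul_pow, cpow_neg_half_sq, inv_inv,
      show 1 - x / (x - 1) = -1 / (x - 1) by field_simp; ring, show 1 - x = -(x - 1) by ring]
    field_simp
    ring
  obtain ⟨c, hc⟩ := isOpen_lowerHalfDisc.exists_is_const_of_deriv_eq_zero
    isPreconnected_lowerHalfDisc
    (fun x hx => (hd x hx).differentiableAt.differentiableWithinAt) (fun x hx => (hd x hx).deriv)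
  suffices c = -Complex.I by
    linear_combination hc t ht + this
  have hev : ∀ x ∈ lowerHalfDisc, c = -Complex.I +
      (1 / Real.pi * Complex.log (1 - x) + E (x / (x - 1)) - E x) := by
    intro x hx
    obtain ⟨h1, h2, h3, h4, h5⟩ := lowerHalfDisc_mem hx
    rw [← hc x hx, hh _ h1, hh _ h2, log_div_sub_one hx]
    field_simp
    ring
  have hEc : ContinuousAt E 0 :=
    (hE.differentiableAt (Metric.ball_mem_nhds 0 one_pos)).continuousAt
  have hlim : Tendsto (fun x => -Complex.I +
      (1 / Real.pi * Complex.log (1 - x) + E (x / (x - 1)) - E x)) (𝓝[lowerHalfDisc] 0)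
      (𝓝 (-Complex.I)) := by
    have c1 : ContinuousAt (fun x : ℂ => -Complex.I +
      (1 / Real.pi * Complex.log (1 - x) + E (x / (x - 1)) - E x)) 0 := by
      have c2 : ContinuousAt (fun x : ℂ => Complex.log (1 - x)) 0 :=
        ContinuousAt.clog (by fun_prop) (by simp)
      have c3 : ContinuousAt (fun x : ℂ => E (x / (x - 1))) 0 := by
        refine ContinuousAt.comp (f := fun x : ℂ => x / (x - 1)) (by simpa using hEc) ?_
        exact ContinuousAt.div (by fun_prop) (by fun_prop) (by norm_num)
      exact continuousAt_const.add (((continuousAt_const.mul c2).add c3).sub hEc)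
    have := c1.tendsto
    simp only [sub_zero, Complex.log_one, mul_zero, zero_sub, zero_div, hE0, add_zero] at this
    exact this.mono_left nhdsWithin_le_nhds
  have hne : NeBot (𝓝[lowerHalfDisc] 0) := by
    rw [← mem_closure_iff_nhdsWithin_neBot]
    refine mem_closure_of_tendsto (f := fun t : ℝ => -Complex.I * t) (b := 𝓝[>] 0) ?_ ?_
    · simpa using tendsto_ofReal_nhdsGT_zero.const_mul (-Complex.I)
    · filter_upwards [Ioo_mem_nhdsGT (show (0 : ℝ) < 1 / 2 by norm_num)] with t ht
      refine ⟨mem_ball_zero_iff.2 ?_, ?_⟩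
      · simpa [abs_of_pos ht.1] using ht.2
      · simpa using ht.1
  refine tendsto_nhds_unique (tendsto_const_nhds.congr' ?_) hlim
  filter_upwards [self_mem_nhdsWithin] with x hx
  exact hev x hx

theorem inv_mem_lowerHalfDisc {x : ℂ} (hx : 0 < x.im) (h2 : 2 < ‖x‖) : x⁻¹ ∈ lowerHalfDisc := by
  have h0 : x ≠ 0 := by rintro rfl; simp at hx
  refine ⟨mem_ball_zero_iff.2 ?_, ?_⟩
  · rw [norm_inv, one_div]
    exact inv_strictAnti₀ two_pos h2
  · show (x⁻¹).im < 0
    rw [Complex.inv_im]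
    exact div_neg_of_neg_of_pos (by linarith) (Complex.normSq_pos.2 h0)

/-- The connection formula between `x` and `1 / x` in the upper half-plane. -/
theorem lam_eq_lam_inv (A B : ℂ) {x : ℂ} (hx : 0 < x.im) (h2 : 2 < ‖x‖) :
    lam A B x = x ^ (-1 / 2 : ℂ) * lam A (B + Complex.I * A) x⁻¹ := by
  have h0 : x ≠ 0 := by rintro rfl; simp at hx
  have ht := inv_mem_lowerHalfDisc hx h2
  have hxs : x ∈ Complex.slitPlane := Or.inr hx.ne'
  obtain ⟨h1, h2, h3, h4, h5⟩ := lowerHalfDisc_mem ht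
  have h3' := Complex.slitPlane_ne_zero h3
  have i1 : (1 - x).im < 0 := by simpa using hx
  have h1x : 1 - x ∈ Complex.slitPlane := Or.inr i1.ne
  have h1x0 := Complex.slitPlane_ne_zero h1x
  have hg := legK_ne_zero_of_norm_lt (mem_ball_zero_iff.1 h1.1)
  have hw := legK_ne_zero_of_norm_lt (mem_ball_zero_iff.1 h2.1)
  -- Pfaff's transformation at x handles K(1 - x). At 1 - x it leads to the argument t/(t - 1) with
  -- t = 1/x, which `legH_div_sub_one` brings back to t. The branch relation (-x)^(-1/2) = i
  -- x^(-1/2) in the upper half-plane supplies the remaining factor.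
  have k1 := legK_one_sub hxs
  have k2 := legK_one_sub h1x
  have e1 : (1 - x)⁻¹ = x⁻¹ / (x⁻¹ - 1) := by
    rw [show x⁻¹ - 1 = (1 - x) / x by field_simp]
    field_simp
  have k3 : legK (1 - x⁻¹ / (x⁻¹ - 1)) = legH (x⁻¹ / (x⁻¹ - 1)) * legK (x⁻¹ / (x⁻¹ - 1)) := by
    rw [legH, div_mul_cancel₀ _ hw]
  rw [sub_sub_cancel, e1, k3, legH_div_sub_one ht, legK_div_sub_one ht] at k2
  have nim : (-x).im ≤ 0 := by simpa using hx.le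
  have k4 : (1 - x) ^ (-1 / 2 : ℂ) = (-x) ^ (-1 / 2 : ℂ) * (1 - x⁻¹) ^ (-1 / 2 : ℂ) := by
    have hn : -x ∈ Complex.slitPlane := Or.inr (by simpa using hx.ne')
    rw [← mul_cpow_of_im hn h3 (Or.inr ⟨nim, h4.le⟩)]
    congr 1
    field_simp
    ring
  have k5 : ((1 - x⁻¹)⁻¹) ^ (-1 / 2 : ℂ) * (1 - x⁻¹) ^ (-1 / 2 : ℂ) = 1 := by
    rw [Complex.inv_cpow _ _ (Complex.slitPlane_arg_ne_pi h3), inv_mul_cancel₀]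
    simp [Complex.cpow_eq_zero_iff, h3']
  have k6 : (-x) ^ (-1 / 2 : ℂ) = Complex.I * x ^ (-1 / 2 : ℂ) := by
    rw [Complex.cpow_def_of_ne_zero (neg_ne_zero.2 h0), Complex.cpow_def_of_ne_zero h0]
    have : Complex.log (-x) = Complex.log x - Real.pi * Complex.I := by
      simp only [Complex.log, norm_neg, Complex.arg_neg_eq_arg_sub_pi_of_im_pos hx]
      push_cast
      ring
    rw [this, show (Complex.log x - Real.pi * Complex.I) * (-1 / 2) =
      Real.pi / 2 * Complex.I + Complex.log x * (-1 / 2) by ring, Complex.exp_add,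
      Complex.exp_pi_div_two_mul_I]
  have k7 : legK x = x ^ (-1 / 2 : ℂ) * (legK x⁻¹ + Complex.I * legK (1 - x⁻¹)) := by
    have h8 : legK (1 - x⁻¹) = legH x⁻¹ * legK x⁻¹ := by
      rw [legH, div_mul_cancel₀ _ hg]
    rw [k2, h8, k4, k6]
    linear_combination (Complex.I * x ^ (-1 / 2 : ℂ) * (legH x⁻¹ - Complex.I) * legK x⁻¹) * k5 -
      x ^ (-1 / 2 : ℂ) * legK x⁻¹ * Complex.I_sq
  simp only [lam]
  rw [k1, k7]
  ring

/-- Logarithmic differentiation of `lam_eq_lam_inv`; the contribution of the factor x^(-1/2) is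
absorbed by the summand 1/2 of `ric`. The form matches the action p ↦ x p of `symInf`. -/
theorem ric_eq_ric_inv (A B : ℂ) {x : ℂ} (hx : 0 < x.im) (h2 : 2 < ‖x‖)
    (hl : lam A (B + Complex.I * A) x⁻¹ ≠ 0) :
    x * ric A B x = ric A (B + Complex.I * A) x⁻¹ := by
  have h0 : x ≠ 0 := by rintro rfl; simp at hx
  have hxs : x ∈ Complex.slitPlane := Or.inr hx.ne'
  have hxD : x ∈ slitDomain := ⟨hxs, Or.inr (by simpa using hx.ne')⟩
  obtain ⟨h1, -⟩ := lowerHalfDisc_mem (inv_mem_lowerHalfDisc hx h2)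
  have htD := mem_slitDomain_of_norm_lt h1.2 (mem_ball_zero_iff.1 h1.1)
  have e : lam A B =ᶠ[𝓝 x] fun x => x ^ (-1 / 2 : ℂ) * lam A (B + Complex.I * A) x⁻¹ := by
    filter_upwards [(isOpen_lt continuous_const Complex.continuous_im).mem_nhds hx,
      (isOpen_lt continuous_const continuous_norm).mem_nhds h2] with y h1 h2
    exact lam_eq_lam_inv A B h1 h2
  have d1 := hasDerivAt_lam A B hxD
  have d2 := ((hasDerivAt_id x).cpow_const (c := (-1 / 2 : ℂ)) hxs).mul
    ((hasDerivAt_lam A (B + Complex.I * A) htD).comp x (hasDerivAt_inv h0))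
  have d3 := d1.unique (d2.congr_of_eventuallyEq e)
  have hc : x ^ (-1 / 2 : ℂ) ≠ 0 := by simp [Complex.cpow_eq_zero_iff, h0]
  have hc2 : x ^ (-1 / 2 - 1 : ℂ) = x ^ (-1 / 2 : ℂ) / x := by
    rw [Complex.cpow_sub _ _ h0, Complex.cpow_one]
  simp only [ric]
  rw [lam_eq_lam_inv A B hx h2, d3]
  simp only [id, Function.comp, hc2]
  generalize x ^ (-1 / 2 : ℂ) = c at hc ⊢
  generalize lam A (B + Complex.I * A) x⁻¹ = L at hl ⊢
  generalize lamDeriv A (B + Complex.I * A) x⁻¹ = D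
  field_simp
  ring

theorem behaviorAtInfinity_chain {p : ℤ} (hp : p ≠ 0) (A B : ℂ) (hB : B + Complex.I * A ≠ 0) :
    BehaviorAtInfinity p (-(Real.pi * A / (B + Complex.I * A)) - shift p) {x : ℂ | 0 < x.im}
      fun x => (chain x (0, ric A B x) p.natAbs).1 := by
  have hn : p.natAbs ≠ 0 := Int.natAbs_ne_zero.2 hp
  set l : Filter ℂ := Bornology.cobounded ℂ ⊓ 𝓟 {x : ℂ | 0 < x.im} with hl
  have him : ∀ᶠ x in l, 0 < x.im := mem_inf_of_right (mem_principal_self _)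
  have hx : Tendsto (fun x : ℂ => x⁻¹) l (𝓝[≠] 0) := by
    refine tendsto_nhdsWithin_iff.2 ⟨tendsto_inv₀_cobounded.mono_left inf_le_left, ?_⟩
    filter_upwards [him] with x hx
    refine inv_ne_zero ?_
    rintro rfl
    simp at hx
  have hbig : ∀ᶠ x in l, 2 < ‖x‖ :=
    (tendsto_norm_cobounded_atTop.mono_left inf_le_left).eventually_gt_atTop 2
  have hxs : ∀ᶠ x in l, x⁻¹ ∈ Complex.slitPlane := by
    filter_upwards [him] with x hx
    exact inv_mem_slitPlane (Or.inr hx.ne')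
  have hlam := (ric_asymptotics hx hxs A hB).2
  refine (chain_ric_asymptotics hx hxs A hB hn).1.congr' ?_
  filter_upwards [him, hbig, hlam] with x h1 h2 h3
  have h0 : x ≠ 0 := by rintro rfl; simp at h1
  have k1 := symInf_chain h0 (0, ric A B x) p.natAbs
  have k2 : symInf x (0, ric A B x) = (0, ric A (B + Complex.I * A) x⁻¹) := by
    simp only [symInf, zero_div, ric_eq_ric_inv A B h1 h2 h3]
  rw [k2, one_div] at k1
  rw [← k1]
  simp only [symInf]
  rw [natAbs_sq_cast, shift_eq, one_div]
  field_simp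
  ring

end PainleveSix

end

noncomputable section

namespace PainleveSix

open Filter Topology Set

/-! ### Uniqueness for the Riccati equation -/

/-- The asymptotics of the solutions of the hypergeometric equation at `x = 0`. -/
theorem tendsto_lam {ι : Type*} {l : Filter ι} {x : ι → ℂ} (hx : Tendsto x l (𝓝[≠] 0))
    (hxs : ∀ᶠ i in l, x i ∈ Complex.slitPlane) (A : ℂ) {B : ℂ} (hB : B ≠ 0) :
    Tendsto (fun i => lam A B (x i) *
      (Complex.log (x i) - 4 * Real.log 2 - Real.pi * A / B)⁻¹) l (𝓝 (-(B / 2))) := by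
  obtain ⟨E, hE, hE0, -, hh⟩ := exists_legH_eq
  have hπ : (Real.pi : ℂ) ≠ 0 := by exact_mod_cast Real.pi_ne_zero
  set s : ι → ℂ := fun i => Complex.log (x i) - 4 * Real.log 2 - Real.pi * A / B with hs
  have hS : Scale l x s := scale_log_sub hx _ _
  have hx0 := (tendsto_nhdsWithin_iff.1 hx).1
  have h0 : (0 : ℂ) ∈ cutPlane := mem_cutPlane_of_norm_lt (by simp)
  have tK : Tendsto (fun i => legK (x i)) l (𝓝 (Real.pi / 2)) := by
    have := (differentiableAt_legK h0).continuousAt.tendsto.comp hx0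
    rwa [legK_zero] at this
  have tE : Tendsto (fun i => E (x i)) l (𝓝 0) := by
    have := (hE.differentiableAt (Metric.ball_mem_nhds 0 one_pos)).continuousAt.tendsto.comp hx0
    rwa [hE0] at this
  have h := (tK.const_mul (-(B / Real.pi))).mul
    (((tE.const_mul (Real.pi : ℂ)).mul hS.inv).const_sub 1)
  rw [mul_zero, sub_zero, mul_one,
    show -(B / Real.pi) * (Real.pi / 2) = -(B / 2) by field_simp] at h
  refine h.congr' ?_
  filter_upwards [hx0.eventually (Metric.ball_mem_nhds 0 one_pos), hxs, hS.sne] with i h1 h2 h3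
  have hn := mem_ball_zero_iff.1 h1
  have hg := legK_ne_zero_of_norm_lt hn
  have hf : legK (1 - x i) = legH (x i) * legK (x i) := by
    rw [legH, div_mul_cancel₀ _ hg]
  rw [lam, hf, hh _ ⟨h1, h2⟩]
  change _ = _ * (s i)⁻¹
  rw [show Complex.log (x i) = s i + 4 * Real.log 2 + Real.pi * A / B by simp only [hs]; ring]
  field_simp
  ring

theorem wronskian_legK {x : ℂ} (hx : x ∈ Metric.ball (0 : ℂ) 1 ∩ Complex.slitPlane) :
    deriv legK x * legK (1 - x) + legK x * deriv legK (1 - x) =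
      Real.pi / 4 / (x * (1 - x)) := by
  obtain ⟨E, -, -, hh, -⟩ := exists_legH_eq
  have hn := mem_ball_zero_iff.1 hx.1
  have hg := legK_ne_zero_of_norm_lt hn
  have hxD := mem_slitDomain_of_norm_lt hx.2 hn
  have h0 := ne_zero_of_mem_slitDomain hxD
  have h1 := one_sub_ne_zero_of_mem_slitDomain hxD
  have h2 := (hasDerivAt_legK_one_sub hx.2).div (hasDerivAt_legK hxD.2) hg
  have h3 := h2.unique (hh x hx)
  field_simp at h3 ⊢
  linear_combination -h3

/-- The quotient of two solutions of the hypergeometric equation. -/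
theorem hasDerivAt_legK_div_lam (A B : ℂ) {x : ℂ}
    (hx : x ∈ Metric.ball (0 : ℂ) 1 ∩ Complex.slitPlane) (h : lam A B x ≠ 0) :
    HasDerivAt (fun t => legK t / lam A B t)
      (B * (Real.pi / 4) / (x * (1 - x) * lam A B x ^ 2)) x := by
  have hxD := mem_slitDomain_of_norm_lt hx.2 (mem_ball_zero_iff.1 hx.1)
  have h0 := ne_zero_of_mem_slitDomain hxD
  have h1 := one_sub_ne_zero_of_mem_slitDomain hxD
  refine ((hasDerivAt_legK hxD.2).div (hasDerivAt_lam A B hxD) h).congr_deriv ?_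
  have hw := wronskian_legK hx
  have : deriv legK x * lam A B x - legK x * lamDeriv A B x =
      B * (Real.pi / 4 / (x * (1 - x))) := by
    rw [← hw]
    simp only [lam, lamDeriv]
    ring
  rw [this]
  field_simp

/-- The difference of two solutions of the Riccati equation. -/
theorem hasDerivAt_inv_sub_ric {A B : ℂ} {f : ℂ → ℂ} {x : ℂ} (hx : x ∈ slitDomain)
    (hl : lam A B x ≠ 0) (hf : HasDerivAt f (hamP 0 (1 / 2) x 0 (f x)) x)
    (hd : f x - ric A B x ≠ 0) :
    HasDerivAt (fun t => (t * lam A B t ^ 2 * (f t - ric A B t))⁻¹)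
      (-1 / (x * (1 - x) * lam A B x ^ 2)) x := by
  have h0 := ne_zero_of_mem_slitDomain hx
  have h1 := one_sub_ne_zero_of_mem_slitDomain hx
  have hne : x * lam A B x ^ 2 * (f x - ric A B x) ≠ 0 :=
    mul_ne_zero (mul_ne_zero h0 (pow_ne_zero 2 hl)) hd
  refine ((((hasDerivAt_id x).mul ((hasDerivAt_lam A B hx).pow 2)).mul
    (hf.sub (hasDerivAt_ric A B hx hl))).inv hne).congr_deriv ?_
  simp only [hamP, Pi.mul_apply, Pi.sub_apply, Pi.pow_apply, id]
  -- The difference d of two Riccati solutions satisfies a Bernoulli equation, so 1/d satisfies a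
  -- linear one; the factor x λ² is the integrating factor that removes its homogeneous term.
  obtain ⟨d, hd'⟩ : ∃ d, d = f x - ric A B x := ⟨_, rfl⟩
  rw [← hd'] at hd ⊢
  rw [show f x = d + ric A B x by rw [hd']; ring]
  simp only [ric]
  generalize lam A B x = L at *
  generalize lamDeriv A B x = D at *
  have h2 : x - 1 = -(1 - x) := by ring
  rw [h2]
  field_simp
  ring

/-- A meromorphic solution of the Riccati equation is determined by its asymptotics at `0`. -/
theorem eq_ric_of_asymptotics {U : Set ℂ} (hU : IsOpen U) (hc : IsPreconnected U)
    (hray : ∀ᶠ x in ray, x ∈ U) (hUs : U ⊆ Metric.ball 0 1 ∩ Complex.slitPlane) {f : ℂ → ℂ}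
    (hf : MeromorphicOn f U)
    (hR : ∀ᶠ x in codiscreteWithin U, HasDerivAt f (hamP 0 (1 / 2) x 0 (f x)) x)
    (A : ℂ) {B : ℂ} (hB : B ≠ 0)
    (ha : Tendsto (fun x => (x * f x)⁻¹ +
      (Complex.log x - 4 * Real.log 2 - Real.pi * A / B)) ray (𝓝 0)) :
    ∀ᶠ x in codiscreteWithin U, f x = ric A B x := by
  have hUD : U ⊆ slitDomain := fun x hx =>
    mem_slitDomain_of_norm_lt (hUs hx).2 (mem_ball_zero_iff.1 (hUs hx).1)
  have hπ : (Real.pi : ℂ) ≠ 0 := by exact_mod_cast Real.pi_ne_zero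
  have hml := (meromorphicOn_lam A B).mono_set hUD
  have hmr := (meromorphicOn_ric A B).mono_set hUD
  have hmK : MeromorphicOn legK U :=
    meromorphicOn_of_hasDerivAt hU fun x hx => hasDerivAt_legK (hUD hx).2
  have hlam : ∀ᶠ x in codiscreteWithin U, lam A B x ≠ 0 :=
    MeromorphicOn.ne_zero_of_ray hU hc hray hml (ric_asymptotics tendsto_ray ray_slitPlane A hB).2
  rcases MeromorphicOn.eq_zero_or_ne_zero hU hc (hf.sub hmr) with h | h
  · exact h.mono fun x hx => sub_eq_zero.1 hx
  exfalso
  -- By the two preceding derivative formulas N is a first integral: the multiple of K/λ cancels the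
  -- derivative of the first term, 1/D with D = x λ² (f - ric).
  set N : ℂ → ℂ := fun x => (x * lam A B x ^ 2 * (f x - ric A B x))⁻¹ +
    4 / (Real.pi * B) * (legK x / lam A B x) with hN
  have hNm : MeromorphicOn N U :=
    (((MeromorphicOn.id.mul (hml.pow 2)).mul (hf.sub hmr)).inv).add
      ((MeromorphicOn.const _).mul (hmK.div hml))
  have hNd : ∀ᶠ x in codiscreteWithin U, HasDerivAt N 0 x := by
    filter_upwards [h, hlam, hR, mem_of_eventually_codiscreteWithin] with x h1 h2 h3 h4
    have h0 := ne_zero_of_mem_slitDomain (hUD h4)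
    have h5 := one_sub_ne_zero_of_mem_slitDomain (hUD h4)
    refine ((hasDerivAt_inv_sub_ric (hUD h4) h2 h3 h1).add
      ((hasDerivAt_legK_div_lam A B (hUs h4) h2).const_mul _)).congr_deriv ?_
    field_simp
    ring
  obtain ⟨c, hcN⟩ := MeromorphicOn.eq_const_of_hasDerivAt_zero hU hc hray.exists hNm hNd
  set s : ℂ → ℂ := fun x => Complex.log x - 4 * Real.log 2 - Real.pi * A / B with hs
  have hS : Scale ray (fun x => x) s := scale_log_sub tendsto_ray _ _
  have tl := tendsto_lam tendsto_ray ray_slitPlane A hB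
  have tr : Tendsto (fun x => (x * ric A B x)⁻¹ + s x) ray (𝓝 0) := by
    have := ((ric_asymptotics tendsto_ray ray_slitPlane A hB).1.mul hS.inv).neg
    rw [zero_mul, neg_zero] at this
    refine this.congr' ?_
    filter_upwards [hS.sne] with x hx
    change -((-(x * ric A B x)⁻¹ - s x) * s x * (s x)⁻¹) = _
    field_simp
    ring
  have tq : ∀ g : ℂ → ℂ, Tendsto (fun x => (x * g x)⁻¹ + s x) ray (𝓝 0) →
      Tendsto (fun x => (x * g x)⁻¹ * (s x)⁻¹) ray (𝓝 (-1)) := by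
    intro g hg
    have := (hg.mul hS.inv).sub_const 1
    rw [zero_mul, zero_sub] at this
    refine this.congr' ?_
    filter_upwards [hS.sne] with x hx
    field_simp
    ring
  have tq1 := tq f ha
  have tq2 := tq _ tr
  -- Equal asymptotics make 1/(x ric) - 1/(x f) tend to 0, and λ² (x f)(x ric) stays bounded since λ
  -- grows like s while x f and x ric decay like 1/s.
  have tD : Tendsto (fun x => x * lam A B x ^ 2 * (f x - ric A B x)) ray (𝓝 0) := by
    have := ((tr.sub ha).mul (tl.pow 2)).div (tq1.mul tq2) (by norm_num)
    simp only [sub_zero, zero_mul, zero_div] at this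
    refine this.congr' ?_
    filter_upwards [hS.sne, hS.ne, tq1.eventually_ne (neg_ne_zero.2 one_ne_zero),
      tq2.eventually_ne (neg_ne_zero.2 one_ne_zero)] with x h1 h2 h3 h4
    have h5 : f x ≠ 0 := by rintro h; simp [h] at h3
    have h6 : ric A B x ≠ 0 := by rintro h; simp [h] at h4
    simp only [Pi.div_apply]
    change ((x * ric A B x)⁻¹ + s x - ((x * f x)⁻¹ + s x)) * (lam A B x * (s x)⁻¹) ^ 2 /
      ((x * f x)⁻¹ * (s x)⁻¹ * ((x * ric A B x)⁻¹ * (s x)⁻¹)) = _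
    field_simp
    ring
  have tK : Tendsto (fun x => legK x / lam A B x) ray (𝓝 0) := by
    have h0 : (0 : ℂ) ∈ cutPlane := mem_cutPlane_of_norm_lt (by simp)
    have := (((differentiableAt_legK h0).continuousAt.tendsto.comp
      (tendsto_nhdsWithin_iff.1 tendsto_ray).1).mul hS.inv).div tl
        (neg_ne_zero.2 (div_ne_zero hB two_ne_zero))
    rw [mul_zero, zero_div] at this
    refine this.congr' ?_
    filter_upwards [hS.sne] with x h1
    change legK x * (s x)⁻¹ / (lam A B x * (s x)⁻¹) = _
    field_simp
  -- Where N = c, this product is (1/D) D = 1, although it tends to 0.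
  have tfin := ((tK.const_mul (4 / (Real.pi * B))).const_sub c).mul tD
  simp only [mul_zero] at tfin
  obtain ⟨x, ⟨h1, h2, h3, h4⟩, hx⟩ := ((frequently_ray hU hray
    (hcN.and (h.and (hlam.and mem_of_eventually_codiscreteWithin)))).and_eventually
      (tfin.eventually_ne (show (0 : ℂ) ≠ 1 by norm_num))).exists
  apply hx
  have h0 := ne_zero_of_mem_slitDomain (hUD h4)
  have h5 : x * lam A B x ^ 2 * (f x - ric A B x) ≠ 0 :=
    mul_ne_zero (mul_ne_zero h0 (pow_ne_zero 2 h3)) h2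
  rw [← h1]
  simp only [hN]
  generalize x * lam A B x ^ 2 * (f x - ric A B x) = D at *
  field_simp
  ring

end PainleveSix

end

noncomputable section

namespace PainleveSix

open Filter Topology Set

/-! ### Reduction of a solution to the Riccati equation -/

/-- Both components of the curve `z` are analytic at `x`. -/
def AnaAt (z : ℂ → ℂ × ℂ) (x : ℂ) : Prop :=
  AnalyticAt ℂ (fun t => (z t).1) x ∧ AnalyticAt ℂ (fun t => (z t).2) x

theorem AnaAt.mapA {z : ℂ → ℂ × ℂ} {x : ℂ} (h : AnaAt z x) (b : ℂ) (hz : (z x).2 ≠ 0) :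
    AnaAt (fun t => mapA b (z t)) x :=
  ⟨h.1.add (analyticAt_const.div h.2 hz), h.2⟩

theorem AnaAt.mapB {z : ℂ → ℂ × ℂ} {x : ℂ} (h : AnaAt z x) (a : ℂ) (hx : (z x).1 ≠ x)
    (h1 : (z x).1 ≠ 1) : AnaAt (fun t => mapB a t (z t)) x :=
  ⟨h.1, (h.2.sub (analyticAt_const.div (h.1.sub analyticAt_id) (sub_ne_zero.2 hx))).sub
    (analyticAt_const.div (h.1.sub analyticAt_const) (sub_ne_zero.2 h1))⟩

theorem AnaAt.mapC {z : ℂ → ℂ × ℂ} {x : ℂ} (h : AnaAt z x) (c : ℂ) (hz : (z x).1 ≠ 0) :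
    AnaAt (fun t => mapC c (z t)) x :=
  ⟨h.1, h.2.sub (analyticAt_const.div h.1 hz)⟩

theorem AnaAt.mapT {z : ℂ → ℂ × ℂ} {x a : ℂ} (h : AnaAt z x) (hr : regT a x (z x) ≠ 0) :
    AnaAt (fun t => mapT a t (z t)) x := by
  simp only [regT, mul_ne_zero_iff, sub_ne_zero] at hr
  obtain ⟨⟨⟨r1, r2, r3⟩, r4, r5, r6⟩, r7⟩ := hr
  exact ((((h.mapA a r1).mapB a r2 r3).mapA (2 * a) r4).mapB a r5 r6).mapA a r7

/-- The Hamiltonian system holds at the points where the curve is analytic. -/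
theorem IsHam.hamAt {a b : ℂ} {U : Set ℂ} (hU : IsOpen U) (hUs : U ⊆ slitDomain) {z : ℂ → ℂ × ℂ}
    (h : IsHam a b U z) {x : ℂ} (hx : x ∈ U) (hz : AnaAt z x) : HamAt a b z x := by
  have h0 := ne_zero_of_mem_slitDomain (hUs hx)
  have h1 : x - 1 ≠ 0 := by
    rw [← neg_sub]
    exact neg_ne_zero.2 (one_sub_ne_zero_of_mem_slitDomain (hUs hx))
  have hev := (eventually_codiscreteWithin_iff hU).1 h.ham x hx
  have c1 := hz.1.continuousAt
  have c2 := hz.2.continuousAt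
  have k1 : ∀ f g : ℂ → ℂ, ContinuousAt f x → ContinuousAt g x → (∀ᶠ t in 𝓝[≠] x, f t = g t) →
      f x = g x := fun f g hf hg hfg =>
    tendsto_nhds_unique (hf.tendsto.mono_left nhdsWithin_le_nhds)
      ((hg.tendsto.mono_left nhdsWithin_le_nhds).congr' (hfg.mono fun t ht => ht.symm))
  have hden : x * (x - 1) ≠ 0 := mul_ne_zero h0 h1
  refine ⟨?_, ?_⟩
  · refine hz.1.differentiableAt.hasDerivAt.congr_deriv
      (k1 _ (fun t => hamQ a b t (z t).1 (z t).2) hz.1.deriv.continuousAt ?_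
        (hev.mono fun t ht => ht.1.deriv))
    exact ContinuousAt.div (by fun_prop) (by fun_prop) hden
  · refine hz.2.differentiableAt.hasDerivAt.congr_deriv
      (k1 _ (fun t => hamP a b t (z t).1 (z t).2) hz.2.deriv.continuousAt ?_
        (hev.mono fun t ht => ht.2.deriv))
    exact ContinuousAt.div (by fun_prop) (by fun_prop) hden

/-- A differentiable function on a right neighbourhood of `0` that tends to `0` at `0` and has
nonincreasing absolute value vanishes near `0`. -/
theorem eventually_eq_zero_of_deriv {v g : ℝ → ℂ} (hv : Tendsto v (𝓝[>] 0) (𝓝 0))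
    (hd : ∀ᶠ t in 𝓝[>] 0, HasDerivAt v (v t * g t) t) (hg : ∀ᶠ t in 𝓝[>] 0, (g t).re ≤ 0) :
    ∀ᶠ t in 𝓝[>] 0, v t = 0 := by
  obtain ⟨ε, hε, hε'⟩ := mem_nhdsGT_iff_exists_Ioo_subset.1 (hd.and hg)
  have hε : 0 < ε := hε
  -- The squared modulus has derivative 2 |v|² Re g ≤ 0; a nonincreasing nonnegative function with
  -- limit 0 at the left endpoint is zero.
  have hN : ∀ t ∈ Ioo 0 ε, HasDerivAt (fun t => Complex.normSq (v t))
      (2 * (Complex.normSq (v t) * (g t).re)) t := by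
    intro t ht
    have h1 := (hε' ht).1
    have h2 := Complex.reCLM.hasFDerivAt.comp_hasDerivAt t h1
    have h3 := Complex.imCLM.hasFDerivAt.comp_hasDerivAt t h1
    refine ((h2.mul h2).add (h3.mul h3)).congr_deriv ?_
    simp [Complex.normSq_apply]
    ring
  have hanti : AntitoneOn (fun t => Complex.normSq (v t)) (Ioo 0 ε) := by
    refine antitoneOn_of_deriv_nonpos (convex_Ioo 0 ε)
      (fun t ht => (hN t ht).continuousAt.continuousWithinAt) ?_ ?_
    · rw [interior_Ioo]
      exact fun t ht => (hN t ht).differentiableAt.differentiableWithinAt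
    · rw [interior_Ioo]
      intro t ht
      rw [(hN t ht).deriv]
      nlinarith [mul_nonneg (Complex.normSq_nonneg (v t)) (neg_nonneg.2 (hε' ht).2)]
  have hlim : Tendsto (fun t => Complex.normSq (v t)) (𝓝[>] 0) (𝓝 0) := by
    have := (Complex.continuous_normSq.tendsto 0).comp hv
    rwa [map_zero] at this
  filter_upwards [Ioo_mem_nhdsGT hε] with t ht
  refine Complex.normSq_eq_zero.1 (le_antisymm (ge_of_tendsto hlim ?_) (Complex.normSq_nonneg _))
  filter_upwards [Ioo_mem_nhdsGT ht.1] with s hs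
  exact hanti ⟨hs.1, hs.2.trans ht.2⟩ ht hs.2.le

/-- A solution of the Hamiltonian system with `α₄ = 0` and the given asymptotics has `q = 0`. -/
theorem fst_eq_zero_of_asymptotics {U : Set ℂ} (hU : IsOpen U) (hUs : U ⊆ slitDomain)
    (hc : IsPreconnected U) (hray : ∀ᶠ x in ray, x ∈ U) {z : ℂ → ℂ × ℂ} (h : IsHam 0 (1 / 2) U z)
    (hz : ∀ᶠ x in ray, AnaAt z x) {c : ℂ}
    (ha : Asy ray (fun x => x) (fun x => Complex.log x + c) z (fun _ => 0) (fun t => 1 - t)) :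
    ∀ᶠ x in codiscreteWithin U, (z x).1 = 0 := by
  set L : ℂ → ℂ := fun x => Complex.log x
  have hL : Scale ray (fun x => x) L := scale_log tendsto_ray
  set v : ℂ → ℂ := fun x => (z x).1 / x with hv
  set w : ℂ → ℂ := fun x => (x * (z x).2)⁻¹ with hw
  -- For α₄ = 0 the equation for q has the factor q, so v = q/x satisfies v' = v g. As v → 0 and w ~
  -- -log x, one finds x g log x → 2, and since log x < 0 on the ray, Re g < 0 there near 0.
  set g : ℂ → ℂ := fun x =>
    ((x * v x - 1) / (x - 1) * (2 * (v x - 1) / w x + 1) - 1) / x with hg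
  have tx : Tendsto (fun x : ℂ => x) ray (𝓝 0) := hL.tendsto_zero
  have tv : Tendsto v ray (𝓝 0) := ha.fst.congr fun x => sub_zero _
  have tw : Tendsto (fun x => w x * (L x)⁻¹) ray (𝓝 (-1)) := by
    have := (ha.snd.mul hL.inv).add (tendsto_linear hL (1 - c) (-1))
    rw [zero_mul, zero_add] at this
    exact this.congr fun x => by simp only [hw, L]; ring
  have tw' : Tendsto (fun x => (w x)⁻¹) ray (𝓝 0) := by
    have := hL.inv.div tw (by norm_num)
    rw [zero_div] at this
    refine this.congr' ?_
    filter_upwards [hL.sne] with x hx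
    simp only [Pi.div_apply]
    field_simp
  have txL : Tendsto (fun x => x * L x) ray (𝓝 0) := by
    have := hL.small_two.mul hL.inv
    rw [zero_mul] at this
    refine this.congr' ?_
    filter_upwards [hL.sne] with x hx
    field_simp
  have t1 : Tendsto (fun x => x - 1) ray (𝓝 (-1)) := by simpa using tx.sub_const 1
  have tgL : Tendsto (fun x => x * g x * L x) ray (𝓝 2) := by
    have h1 := ((tv.sub_const 1).const_mul 2).div tw (by norm_num)
    have h2 := ((tv.sub_const 1).div t1 (by norm_num)).mul
      (txL.mul (((tv.sub_const 1).const_mul 2).mul tw' |>.add_const 1))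
    have := h1.add h2
    norm_num at this
    refine this.congr' ?_
    filter_upwards [hL.ne, hL.sne, t1.eventually_ne (show (-1 : ℂ) ≠ 0 by norm_num),
      tw.eventually_ne (show (-1 : ℂ) ≠ 0 by norm_num)] with x h1 h2 h3 h4
    have h5 : w x ≠ 0 := left_ne_zero_of_mul h4
    simp only [hg]
    field_simp
    ring
  have hd : ∀ᶠ x in ray, HasDerivAt v (v x * g x) x := by
    filter_upwards [hz, hray, hL.ne, tw.eventually_ne (show (-1 : ℂ) ≠ 0 by norm_num)]
      with x h1 h2 h3 h4
    have h5 : w x ≠ 0 := left_ne_zero_of_mul h4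
    have h6 : (z x).2 ≠ 0 := by
      intro h6
      simp [hw, h6] at h5
    have h7 : x - 1 ≠ 0 := by
      rw [← neg_sub]
      exact neg_ne_zero.2 (one_sub_ne_zero_of_mem_slitDomain (hUs h2))
    refine ((h.hamAt hU hUs h2 h1).1.div (hasDerivAt_id x) h3).congr_deriv ?_
    simp only [hamQ, hv, hg, hw, id]
    field_simp
    ring
  have hev : ∀ᶠ x in ray, v x = 0 := by
    refine eventually_eq_zero_of_deriv (v := fun t : ℝ => v t) (g := fun t : ℝ => g t)
      (tv.comp tendsto_map) ?_ ?_
    · have : ∀ᶠ t : ℝ in 𝓝[>] 0, HasDerivAt v (v t * g t) (t : ℂ) := hd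
      exact this.mono fun t ht => ht.comp_ofReal
    · have h1 : ∀ᶠ x in ray, 0 < (x * g x * L x).re :=
        ((Complex.continuous_re.tendsto 2).comp tgL).eventually_const_lt (by simp)
      have h1 : ∀ᶠ t : ℝ in 𝓝[>] 0, 0 < ((t : ℂ) * g t * L t).re := h1
      filter_upwards [h1, Ioo_mem_nhdsGT one_pos] with t h2 ht
      simp only [L] at h2
      rw [← Complex.ofReal_log ht.1.le, Complex.re_mul_ofReal, Complex.re_ofReal_mul] at h2
      have h3 := Real.log_neg ht.1 ht.2
      by_contra! h4
      nlinarith [mul_pos ht.1 h4]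
  refine (MeromorphicOn.eq_zero_or_ne_zero hU hc h.mero_fst).resolve_right fun hne => ?_
  obtain ⟨x, h1, h2, h3⟩ := ((frequently_ray hU hray hne).and_eventually (hev.and hL.ne)).exists
  exact div_ne_zero h1 h3 h2

/-- The solution of the Hamiltonian system with `α₄ = 0` and the given asymptotics. -/
theorem eq_ric_of_asy {U : Set ℂ} (hU : IsOpen U) (hc : IsPreconnected U)
    (hray : ∀ᶠ x in ray, x ∈ U) (hUs : U ⊆ Metric.ball 0 1 ∩ Complex.slitPlane) {z : ℂ → ℂ × ℂ}
    (h : IsHam 0 (1 / 2) U z) (hz : ∀ᶠ x in ray, AnaAt z x) {c A B : ℂ} (hB : B ≠ 0)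
    (hcAB : c = 1 - 4 * Real.log 2 - Real.pi * A / B)
    (ha : Asy ray (fun x => x) (fun x => Complex.log x + c) z (fun _ => 0) (fun t => 1 - t)) :
    ∀ᶠ x in codiscreteWithin U, z x = (0, ric A B x) := by
  have hUD : U ⊆ slitDomain := fun x hx =>
    mem_slitDomain_of_norm_lt (hUs hx).2 (mem_ball_zero_iff.1 (hUs hx).1)
  have h0 := fst_eq_zero_of_asymptotics hU hUD hc hray h hz ha
  have h1 := eq_ric_of_asymptotics hU hc hray hUs h.mero_snd (by
    filter_upwards [h0, h.ham] with x h1 h2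
    have := h2.2
    rwa [h1] at this) A hB (ha.snd.congr fun x => by rw [hcAB]; ring)
  filter_upwards [h0, h1] with x h2 h3
  exact Prod.ext h2 h3

/-- The solution of the Hamiltonian system with `α₄ = 2 m` and the given asymptotics. -/
theorem eq_chain_of_asy {U : Set ℂ} (hU : IsOpen U) (hc : IsPreconnected U)
    (hray : ∀ᶠ x in ray, x ∈ U) (hUs : U ⊆ Metric.ball 0 1 ∩ Complex.slitPlane) {A B : ℂ}
    (hB : B ≠ 0) (m : ℕ) {z : ℂ → ℂ × ℂ} (h : IsHam 0 (1 / 2 - ((m : ℂ) + 1)) U z)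
    (hz : ∀ᶠ x in ray, AnaAt z x) {c : ℂ}
    (hcAB : c = logShift (m + 1) - 4 * Real.log 2 - Real.pi * A / B)
    (ha : Asy ray (fun x => x) (fun x => Complex.log x + c) z
      (fun t => 1 - ((m : ℂ) + 1) ^ 2 * t ^ 2) (fun t => t * (1 - ((m : ℂ) + 1) * t))) :
    ∀ᶠ x in codiscreteWithin U, z x = chain x (0, ric A B x) (m + 1) := by
  have hUD : U ⊆ slitDomain := fun x hx =>
    mem_slitDomain_of_norm_lt (hUs hx).2 (mem_ball_zero_iff.1 (hUs hx).1)
  have hS : ∀ c, Scale ray (fun x => x) fun x => Complex.log x + c := fun c =>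
    (scale_log tendsto_ray).of_tendsto_sub (c := c) (tendsto_const_nhds.congr fun i => by ring)
  have hm1 : (m : ℂ) + 1 ≠ 0 := by exact_mod_cast Nat.succ_ne_zero m
  have hreg := (ha.mapT_aux hm1 (hS c)).1
  have hT := h.mapT hUD (MeromorphicOn.ne_zero_of_ray hU hc hray
    (meromorphicOn_regT _ h.mero_fst h.mero_snd) (hreg.mono fun x hx => hx.2))
  have hzT : ∀ᶠ x in ray, AnaAt (fun x => mapT (1 / 2 - ((m : ℂ) + 1)) x (z x)) x := by
    filter_upwards [hz, hreg] with x h1 h2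
    exact h1.mapT h2.2
  -- The descent retraces the chain: `mapT` takes n = m + 1 to -m and `mapC` takes -m to m, while
  -- the asymptotics follow along. At n = 1 the Riccati case is reached.
  induction m generalizing z c with
  | zero =>
    have h1 := (Asy.mapT_one (ha.congr (V' := fun t => 1 - 1 ^ 2 * t ^ 2)
      (W' := fun t => t * (1 - 1 * t)) (fun i => by simp) (fun i => by simp)) (hS c)).2
    simp only [Nat.cast_zero, zero_add] at hT hzT
    rw [show -(1 / 2 - 1 : ℂ) = 1 / 2 by norm_num] at hT
    have h2 := eq_ric_of_asy hU hc hray hUs hT hzT hB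
      (by rw [hcAB, logShift_one]) h1
    filter_upwards [h2] with x hx
    simp only [chain]
    rw [← hx, show mapC (2 * (0 : ℕ)) (mapT (1 / 2 - 1) x (z x)) = mapT (1 / 2 - 1) x (z x) by
      simp [mapC], show (1 / 2 + (0 : ℕ) : ℂ) = -(1 / 2 - 1) by norm_num, mapT_neg]
  | succ m ih =>
    obtain ⟨M, hM⟩ : ∃ M : ℂ, M = (m : ℂ) + 1 := ⟨_, rfl⟩
    have hM0 : M ≠ 0 := by rw [hM]; exact_mod_cast Nat.succ_ne_zero m
    have hcast : ((m + 1 : ℕ) : ℂ) = M := by rw [hM]; push_cast; rfl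
    simp only [hcast] at h ha hm1 hreg hT hzT
    have h1 := (ha.mapT hm1 (fun h => hM0 (by linear_combination h)) (hS c)).2
    have hs : ∀ x : ℂ, Complex.log x + c - 1 / (M + 1) - 1 / (M + 1 - 1) =
        Complex.log x + (logShift (m + 1) - 4 * Real.log 2 - Real.pi * A / B) := by
      intro x
      rw [hcAB, logShift_succ (m + 1), hcast, add_sub_cancel_right]
      ring
    simp only [hs] at h1
    have h2 := (h1.congr (V' := fun t => 1 - (-M) ^ 2 * t ^ 2) (W' := fun t => t * (1 - -M * t))
      (s' := fun x => Complex.log x + (logShift (m + 1) - 4 * Real.log 2 - Real.pi * A / B))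
      (fun i => by ring) (fun i => by ring)).mapC (neg_ne_zero.2 hM0) (hS _)
    have hC := hT.mapC hUD (c := 2 * -M) (by ring) (Or.inr
      (MeromorphicOn.ne_zero_of_ray hU hc hray hT.mero_fst h2.1))
    rw [show -(1 / 2 - (M + 1)) + 2 * -M = 1 / 2 - ((m : ℂ) + 1) by rw [← hM]; ring] at hC
    have hzC : ∀ᶠ x in ray, AnaAt (fun x => mapC (2 * -M) (mapT (1 / 2 - (M + 1)) x (z x))) x := by
      filter_upwards [hzT, h2.1] with x k1 k2
      exact k1.mapC _ k2
    have h3 := h2.2.congr (V' := fun t => 1 - ((m : ℂ) + 1) ^ 2 * t ^ 2)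
      (W' := fun t => t * (1 - ((m : ℂ) + 1) * t)) (s' := fun x => Complex.log x +
        (logShift (m + 1) - 4 * Real.log 2 - Real.pi * A / B))
      (fun i => by rw [← hM]; ring) (fun i => by rw [← hM]; ring)
    have hm1' : (m : ℂ) + 1 ≠ 0 := hM ▸ hM0
    have hreg' := (h3.mapT_aux hm1' (hS _)).1
    have h4 := ih hC hzC rfl h3 hm1' hreg' (hC.mapT hUD (MeromorphicOn.ne_zero_of_ray hU hc hray
      (meromorphicOn_regT _ hC.mero_fst hC.mero_snd) (hreg'.mono fun x hx => hx.2))) (by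
        filter_upwards [hzC, hreg'] with x k1 k2
        exact k1.mapT k2.2)
    -- The identification is carried back up by the exact inverses of `mapC` and `mapT`.
    filter_upwards [h4] with x hx
    rw [chain, ← hx, hcast, show 2 * M = -(2 * -M) by ring, mapC_neg,
      show 1 / 2 + M = -(1 / 2 - (M + 1)) by ring, mapT_neg]

end PainleveSix

end

noncomputable section

namespace PainleveSix

open Filter Topology Set

/-! ### Sectors -/

theorem sector_subset {r φ : ℝ} (hr1 : r ≤ 1) (hφπ : φ ≤ Real.pi) :
    sector r φ ⊆ Metric.ball 0 1 ∩ Complex.slitPlane := by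
  rintro x ⟨h1, h2, h3⟩
  refine ⟨mem_ball_zero_iff.2 (h2.trans_le hr1), Complex.mem_slitPlane_iff_arg.2
    ⟨fun h => ?_, norm_pos_iff.1 h1⟩⟩
  rw [h, abs_of_pos Real.pi_pos] at h3
  linarith

theorem isOpen_sector {r φ : ℝ} (hφπ : φ ≤ Real.pi) : IsOpen (sector r φ) := by
  have e : sector r φ = {x : ℂ | ‖x‖ < r} ∩ (Complex.slitPlane ∩ Complex.arg ⁻¹' Ioo (-φ) φ) := by
    ext x
    simp only [sector, mem_ofPred_eq, mem_inter_iff, mem_preimage, mem_Ioo, abs_lt,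
      Complex.mem_slitPlane_iff_arg, norm_pos_iff]
    constructor
    · rintro ⟨h1, h2, h3⟩
      exact ⟨h2, ⟨by linarith, h1⟩, h3⟩
    · rintro ⟨h2, ⟨-, h1⟩, h3⟩
      exact ⟨h1, h2, h3⟩
  rw [e]
  refine (isOpen_lt continuous_norm continuous_const).inter
    (ContinuousOn.isOpen_inter_preimage ?_ Complex.isOpen_slitPlane isOpen_Ioo)
  exact fun x hx => (Complex.continuousAt_arg hx).continuousWithinAt

theorem isPreconnected_sector {r φ : ℝ} (hr : 0 < r) (hφπ : φ ≤ Real.pi) :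
    IsPreconnected (sector r φ) := by
  have e : sector r φ = Complex.exp ''
      ({z | z.re < Real.log r} ∩ ({z | -φ < z.im} ∩ {z | z.im < φ})) := by
    ext x
    simp only [sector, mem_ofPred_eq, mem_image, mem_inter_iff, abs_lt]
    constructor
    · rintro ⟨h1, h2, h3⟩
      exact ⟨Complex.log x, ⟨by rw [Complex.log_re]; exact Real.log_lt_log h1 h2,
        by rwa [Complex.log_im]⟩, Complex.exp_log (norm_pos_iff.1 h1)⟩
    · rintro ⟨z, ⟨h1, h2, h3⟩, rfl⟩
      rw [← Complex.log_im, Complex.log_exp (by linarith) (by linarith), Complex.norm_exp]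
      exact ⟨Real.exp_pos _, (Real.lt_log_iff_exp_lt hr).1 h1, h2, h3⟩
  rw [e]
  exact ((convex_halfSpace_re_lt _).inter ((convex_halfSpace_im_gt _).inter
    (convex_halfSpace_im_lt _))).isPreconnected.image _ Complex.continuous_exp.continuousOn

/-- A neighbourhood of `0` in a sector contains discs around the points of the ray whose radii are
proportional to the distance from `0`. -/
theorem eventually_ray_closedBall {r φ : ℝ} (hr : 0 < r) (hφ : 0 < φ) : ∃ c > 0,
    ∀ P : ℂ → Prop, (∀ᶠ z in 𝓝[sector r φ] 0, P z) →
      ∀ᶠ x in ray, ∀ u ∈ Metric.closedBall (1 : ℂ) c, P (x * u) := by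
  -- Multiplication by a positive real number preserves arguments, so one disc around 1, scaled by
  -- the points of the ray, works for all of them.
  have h1 : ContinuousAt Complex.arg 1 := Complex.continuousAt_arg (by simp)
  have h2 : ∀ᶠ u in 𝓝 (1 : ℂ), |Complex.arg u| < φ ∧ 0 < ‖u‖ :=
    (h1.abs.eventually_lt_const (by simpa using hφ)).and
      (continuousAt_id.norm.eventually_const_lt (by simp))
  obtain ⟨c, hc, hc'⟩ := Metric.nhds_basis_closedBall.eventually_iff.1 h2
  refine ⟨c, hc, fun P hP => ?_⟩
  rw [eventually_nhdsWithin_iff] at hP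
  obtain ⟨ε, hε, hε'⟩ := Metric.eventually_nhds_iff_ball.1 hP
  have h3 : ∀ᶠ t : ℝ in 𝓝[>] 0, ∀ u ∈ Metric.closedBall (1 : ℂ) c, P (t * u) := by
    have hpos : 0 < min ε r / (1 + c) := div_pos (lt_min hε hr) (by linarith)
    filter_upwards [Ioo_mem_nhdsGT hpos] with t ht u hu
    have ht1 : t * (1 + c) < min ε r := (lt_div_iff₀ (by linarith)).1 ht.2
    obtain ⟨k1, k2⟩ := hc' hu
    have k3 : ‖u‖ ≤ 1 + c := by
      rw [mem_closedBall_iff_norm] at hu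
      have := norm_le_norm_add_norm_sub' u 1
      rw [norm_one] at this
      linarith
    have k4 : ‖(t : ℂ) * u‖ = t * ‖u‖ := by
      rw [norm_mul, Complex.norm_real, Real.norm_of_nonneg ht.1.le]
    have k5 : ‖(t : ℂ) * u‖ < min ε r := by
      rw [k4]
      exact (mul_le_mul_of_nonneg_left k3 ht.1.le).trans_lt ht1
    refine hε' _ (mem_ball_zero_iff.2 (k5.trans_le (min_le_left _ _))) ⟨?_,
      k5.trans_le (min_le_right _ _), ?_⟩
    · rw [k4]
      exact mul_pos ht.1 k2
    · rwa [Complex.arg_real_mul _ ht.1]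
  exact h3

theorem ray_le_nhdsWithin_sector {r φ : ℝ} (hr : 0 < r) (hφ : 0 < φ) :
    ray ≤ 𝓝[sector r φ] 0 := by
  intro S hS
  obtain ⟨c, hc, h⟩ := eventually_ray_closedBall hr hφ
  filter_upwards [h (fun x => x ∈ S) hS] with x hx
  simpa using hx 1 (Metric.mem_closedBall_self hc.le)

/-- Cauchy's estimate for functions on a sector. -/
theorem tendsto_mul_deriv_ray {r φ : ℝ} (hr : 0 < r) (hφ : 0 < φ) {e : ℂ → ℂ}
    (hd : ∀ᶠ x in 𝓝[sector r φ] 0, DifferentiableAt ℂ e x)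
    (he : Tendsto e (𝓝[sector r φ] 0) (𝓝 0)) :
    Tendsto (fun x => x * deriv e x) ray (𝓝 0) := by
  obtain ⟨c, hc, h⟩ := eventually_ray_closedBall hr hφ
  refine Metric.tendsto_nhds.2 fun ε hε => ?_
  have h1 := h _ ((Metric.tendsto_nhds.1 he (ε / 2 * c) (by positivity)).and hd)
  filter_upwards [h1] with x hx
  have hx1 : DifferentiableAt ℂ e x := by
    simpa using (hx 1 (Metric.mem_closedBall_self hc.le)).2
  -- Rescaling by x puts Cauchy's estimate on a disc of fixed radius c around 1, where u ↦ e(x u)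
  -- has derivative x e'(x).
  have hD : ∀ u ∈ Metric.closedBall (1 : ℂ) c, DifferentiableAt ℂ (fun u => e (x * u)) u :=
    fun u hu => DifferentiableAt.fun_comp' u (hx u hu).2 (by fun_prop)
  have h2 : deriv (fun u => e (x * u)) 1 = x * deriv e x := by
    rw [deriv_comp_mul_left, mul_one, smul_eq_mul]
  have h3 := Complex.norm_deriv_le_of_forall_mem_sphere_norm_le (f := fun u => e (x * u)) (c := 1)
    (C := ε / 2 * c) hc ?_ ?_
  · rw [h2, mul_div_cancel_right₀ _ hc.ne'] at h3
    rw [dist_zero_right]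
    linarith
  · exact DifferentiableOn.diffContOnCl_ball (U := Metric.closedBall 1 c)
      (fun u hu => (hD u hu).differentiableWithinAt) subset_rfl
  · intro u hu
    have := (hx u (Metric.sphere_subset_closedBall hu)).1
    rw [dist_zero_right] at this
    exact this.le

end PainleveSix

end

noncomputable section

namespace PainleveSix

open Filter Topology Set

/-! ### Uniqueness of the solution with given behavior at `0` -/

/-- The normal form of a meromorphic function with given asymptotics is analytic near `0` and has
the same asymptotics. -/
theorem analyticAt_toMeromorphicNFOn {U : Set ℂ} (hU : IsOpen U) (h0 : (0 : ℂ) ∉ U) {y m : ℂ → ℂ}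
    (hy : MeromorphicOn y U) (hm : ContinuousOn m U)
    (h : Tendsto (fun x => y x / x - m x) (𝓝[U] 0) (𝓝 0)) :
    (∀ᶠ x in 𝓝[U] 0, AnalyticAt ℂ (toMeromorphicNFOn y U) x) ∧
    Tendsto (fun x => toMeromorphicNFOn y U x / x - m x) (𝓝[U] 0) (𝓝 0) := by
  set Y := toMeromorphicNFOn y U with hY
  -- The normal form agrees with y only off a discrete set, so the estimate is transferred to
  -- punctured neighbourhoods. A pole would contradict the resulting local bound, and continuity
  -- recovers the estimate at the centre.
  have key : ∀ ε > 0, ∀ᶠ x in 𝓝[U] 0, ∀ᶠ t in 𝓝[≠] x, ‖Y t / t - m t‖ < ε := by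
    intro ε hε
    have h1 := eventually_eventually_nhdsWithin.2 (Metric.tendsto_nhds.1 h ε hε)
    filter_upwards [h1, eventually_mem_nhdsWithin] with x h2 hx
    rw [hU.nhdsWithin_eq hx] at h2
    filter_upwards [h2.filter_mono nhdsWithin_le_nhds,
      hy.toMeromorphicNFOn_eq_self_on_nhdsNE hx] with t h3 h4
    rw [dist_zero_right] at h3
    rwa [hY, h4]
  have hA : ∀ᶠ x in 𝓝[U] 0, AnalyticAt ℂ Y x := by
    filter_upwards [key 1 one_pos, eventually_mem_nhdsWithin] with x h1 hx
    refine (meromorphicNFOn_toMeromorphicNFOn y U hx).meromorphicOrderAt_nonneg_iff_analyticAt.1 ?_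
    by_contra! ho
    have h2 := tendsto_norm_cobounded_atTop.comp (tendsto_cobounded_of_meromorphicOrderAt_neg ho)
    have h3 : ContinuousAt (fun t => ‖t‖ * (1 + ‖m t‖)) x :=
      continuousAt_id.norm.mul (continuousAt_const.add (hm.continuousAt (hU.mem_nhds hx)).norm)
    have h4 := (h3.tendsto.mono_left (nhdsWithin_le_nhds (s := {x}ᶜ))).eventually_lt_const
      (lt_add_one _)
    have h5 : ∀ᶠ t in 𝓝[≠] x, t ≠ 0 :=
      (continuousAt_id.eventually_ne (y := (0 : ℂ)) fun h => h0 (by rwa [← h])).filter_mono nhdsWithin_le_nhds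
    obtain ⟨t, k1, k2, k3, k4⟩ := (h1.and (h4.and (h5.and
      (h2.eventually_gt_atTop (‖x‖ * (1 + ‖m x‖) + 1))))).exists
    simp only [Function.comp] at k4
    have k5 : Y t = t * (Y t / t - m t + m t) := by field_simp; ring
    have k6 : ‖Y t‖ ≤ ‖t‖ * (1 + ‖m t‖) := by
      rw [k5, norm_mul]
      refine mul_le_mul_of_nonneg_left ((norm_add_le _ _).trans ?_) (norm_nonneg t)
      linarith
    linarith
  refine ⟨hA, Metric.tendsto_nhds.2 fun ε hε => ?_⟩
  filter_upwards [key (ε / 2) (half_pos hε), hA, eventually_mem_nhdsWithin] with x h1 h2 hx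
  have hx0 : x ≠ 0 := fun h => h0 (h ▸ hx)
  have h3 : ContinuousAt (fun x => ‖Y x / x - m x‖) x :=
    ((h2.continuousAt.div continuousAt_id hx0).sub (hm.continuousAt (hU.mem_nhds hx))).norm
  have h4 := le_of_tendsto (h3.tendsto.mono_left (nhdsWithin_le_nhds (s := {x}ᶜ)))
    (h1.mono fun t ht => ht.le)
  rw [dist_zero_right]
  linarith

theorem IsSolutionOn.congr {θ₀ θₓ θ₁ θinf : ℂ} {U : Set ℂ} (hU : IsOpen U) {y Y : ℂ → ℂ}
    (h : IsSolutionOn θ₀ θₓ θ₁ θinf U y) (hY : MeromorphicOn Y U)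
    (he : ∀ᶠ x in codiscreteWithin U, Y x = y x) : IsSolutionOn θ₀ θₓ θ₁ θinf U Y := by
  refine ⟨hY, ?_⟩
  filter_upwards [h.2, eventually_codiscreteWithin_nhds hU he] with x h1 h2
  have h2 : Y =ᶠ[𝓝 x] y := h2
  rw [h2.eq_of_nhds, h2.deriv.eq_of_nhds, h2.deriv.deriv.eq_of_nhds]
  exact h1

/-- Asymptotics of the derivative of a function with logarithmic behavior at `0`. -/
theorem tendsto_deriv_of_quad {r φ : ℝ} (hr : 0 < r) (hr1 : r ≤ 1) (hφ : 0 < φ)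
    (hφπ : φ ≤ Real.pi) {y : ℂ → ℂ} {n ρ : ℂ}
    (hA : ∀ᶠ x in 𝓝[sector r φ] 0, AnalyticAt ℂ y x)
    (h : Tendsto (fun x => y x / x - (1 - n ^ 2 * (Complex.log x + ρ) ^ 2))
      (𝓝[sector r φ] 0) (𝓝 0)) :
    Tendsto (fun x => deriv y x - (1 - n ^ 2 * (Complex.log x + ρ) ^ 2 -
      2 * n ^ 2 * (Complex.log x + ρ))) ray (𝓝 0) := by
  set e : ℂ → ℂ := fun x => y x / x - (1 - n ^ 2 * (Complex.log x + ρ) ^ 2) with he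
  have hd : ∀ᶠ x in 𝓝[sector r φ] 0, x ≠ 0 ∧ HasDerivAt e ((deriv y x * x - y x) / x ^ 2 +
      n ^ 2 * (2 * (Complex.log x + ρ) * x⁻¹)) x := by
    filter_upwards [hA, eventually_mem_nhdsWithin] with x h1 h2
    have h3 := (sector_subset hr1 hφπ h2).2
    have h4 := Complex.slitPlane_ne_zero h3
    refine ⟨h4, ?_⟩
    refine ((h1.differentiableAt.hasDerivAt.div (hasDerivAt_id x) h4).sub
      (((((Complex.hasDerivAt_log h3).add_const ρ).pow 2).const_mul (n ^ 2)).const_sub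
        1)).congr_deriv ?_
    simp only [id]
    norm_num
  have h1 := (tendsto_mul_deriv_ray hr hφ (hd.mono fun x hx => hx.2.differentiableAt) h).add
    (h.mono_left (ray_le_nhdsWithin_sector hr hφ))
  rw [add_zero] at h1
  refine h1.congr' ?_
  filter_upwards [hd.filter_mono (ray_le_nhdsWithin_sector hr hφ)] with x hx
  have hx0 := hx.1
  rw [hx.2.deriv]
  simp only [he]
  field_simp
  ring

/-- The asymptotics of a solution and of its derivative in Hamiltonian form. -/
theorem asy_conj {ι : Type*} {l : Filter ι} {x s q q' : ι → ℂ} (hx : Scale l x s) {n : ℂ}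
    (hn : n ≠ 0) (hq : Tendsto (fun i => q i / x i - (1 - n ^ 2 * s i ^ 2)) l (𝓝 0))
    (hq' : Tendsto (fun i => q' i - (1 - n ^ 2 * s i ^ 2 - 2 * n ^ 2 * s i)) l (𝓝 0)) :
    Asy l x s (fun i => (q i, conj (2 * n) (x i) (q i) (q' i))) (fun t => 1 - n ^ 2 * t ^ 2)
      (fun t => t * (1 - n * t)) := by
  refine ⟨hq, ?_⟩
  set e : ι → ℂ := fun i => q i / x i - (1 - n ^ 2 * s i ^ 2) with he
  set e' : ι → ℂ := fun i => q' i - (1 - n ^ 2 * s i ^ 2 - 2 * n ^ 2 * s i) with he'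
  -- With v = q/x one has 1/(x p) = 2 v (v - 1)/N, where N = q' + d + (2n - 1)v - 2n. Here d → 0,
  -- and the leading part of N is -2n² s (1 + n s).
  set d : ι → ℂ := fun i => (x i - q i) / (q i - 1) * q' i with hd
  have tq0 := tendsto_zero_of_quad hx hq
  have tq1 : Tendsto (fun i => q i - 1) l (𝓝 (-1)) := by simpa using tq0.sub_const 1
  have ts : Tendsto (fun i => (1 - n ^ 2 * s i ^ 2) * (s i)⁻¹ ^ 2) l (𝓝 (-n ^ 2)) :=
    (tendsto_quad hx 1 0 (-n ^ 2)).congr fun i => by ring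
  have td : Tendsto d l (𝓝 0) := by
    have h1 : Tendsto (fun i => (1 - q i / x i) * (s i)⁻¹ ^ 2) l (𝓝 (n ^ 2)) := by
      have := ((hx.inv.pow 2).sub (hq.mul (hx.inv.pow 2))).sub ts
      norm_num at this
      exact this.congr fun i => by ring
    have h2 : Tendsto (fun i => q' i * (s i)⁻¹ ^ 2) l (𝓝 (-n ^ 2)) := by
      have := (hq'.mul (hx.inv.pow 2)).add (tendsto_quad hx 1 (-2 * n ^ 2) (-n ^ 2))
      rw [zero_mul, zero_add] at this
      exact this.congr fun i => by ring
    have := ((h1.mul h2).mul hx.small).div tq1 (by norm_num)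
    rw [mul_zero, zero_div] at this
    refine this.congr' ?_
    filter_upwards [hx.ne, hx.sne, tq1.eventually_ne (show (-1 : ℂ) ≠ 0 by norm_num)]
      with i h1 h2 h3
    simp only [hd, Pi.div_apply]
    field_simp
  have tN : Tendsto (fun i => (-2 * n ^ 2 * s i * (1 + n * s i) + (e' i + d i +
      (2 * n - 1) * e i)) * (s i)⁻¹ ^ 2) l (𝓝 (-2 * n ^ 3)) := by
    have := ((hq'.add (td.add (hq.const_mul (2 * n - 1)))).mul (hx.inv.pow 2)).add
      (tendsto_quad hx 0 (-2 * n ^ 2) (-2 * n ^ 3))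
    simp only [mul_zero, add_zero, zero_mul, zero_add] at this
    exact this.congr fun i => by simp only [he, he']; ring
  -- This is 2 v (v - 1) - s(1 - n s) N. Its terms free of e, e', d cancel because 2(1 -
  -- n²s²)(-n²s²) = s(1 - n s) · (-2n² s(1 + n s)); what remains is o(s²), while N has order s².
  have tM : Tendsto (fun i => (2 * e i * (1 - 2 * n ^ 2 * s i ^ 2) + 2 * e i ^ 2 -
      s i * (1 - n * s i) * (e' i + d i + (2 * n - 1) * e i)) * (s i)⁻¹ ^ 2) l (𝓝 0) := by
    have h1 := (hq.const_mul 2).mul (tendsto_quad hx 1 0 (-2 * n ^ 2))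
    have h2 := ((hq.pow 2).const_mul 2).mul (hx.inv.pow 2)
    have h3 := (tendsto_quad hx 0 1 (-n)).mul (hq'.add (td.add (hq.const_mul (2 * n - 1))))
    have := (h1.add h2).sub h3
    norm_num at this
    exact this.congr fun i => by simp only [he, he']; ring
  have tfin := tM.div tN (mul_ne_zero (by norm_num) (pow_ne_zero 3 hn))
  rw [zero_div] at tfin
  have hv0 := eventually_ne_zero_of_quad hx (f := fun i => q i / x i) (c₀ := 1) (c₁ := 0)
    (c₂ := -n ^ 2) (hq.congr fun i => by simp only [he]; ring)
    (Or.inl (neg_ne_zero.2 (pow_ne_zero 2 hn)))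
  have hv1 := eventually_ne_zero_of_quad hx (f := fun i => q i / x i - 1) (c₀ := 0) (c₁ := 0)
    (c₂ := -n ^ 2) (hq.congr fun i => by simp only [he]; ring)
    (Or.inl (neg_ne_zero.2 (pow_ne_zero 2 hn)))
  refine tfin.congr' ?_
  filter_upwards [hx.ne, hx.sne, hv0, hv1, tq1.eventually_ne (show (-1 : ℂ) ≠ 0 by norm_num),
    tN.eventually_ne (mul_ne_zero (by norm_num) (pow_ne_zero 3 hn))] with i h1 h2 h3 h4 h5 h6
  have h7 := left_ne_zero_of_mul h6
  have h8 : q i ≠ 0 := fun h => h3 (by simp [h])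
  have h9 : q i - x i ≠ 0 := fun h => h4 (by rw [sub_eq_zero.1 h, div_self h1, sub_self])
  simp only [Pi.div_apply]
  rw [mul_div_mul_right _ _ (pow_ne_zero 2 (inv_ne_zero h2))]
  have hN : -2 * n ^ 2 * s i * (1 + n * s i) + (e' i + d i + (2 * n - 1) * e i) =
      (x i * (x i - 1) * q' i + 2 * n * ((q i - 1) * (q i - x i)) - q i * (q i - 1)) /
        (x i * (q i - 1)) := by
    simp only [he, he', hd]
    field_simp
    ring
  have hM : 2 * e i * (1 - 2 * n ^ 2 * s i ^ 2) + 2 * e i ^ 2 -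
      s i * (1 - n * s i) * (e' i + d i + (2 * n - 1) * e i) =
      2 * (q i / x i) * (q i / x i - 1) - s i * (1 - n * s i) *
        (-2 * n ^ 2 * s i * (1 + n * s i) + (e' i + d i + (2 * n - 1) * e i)) := by
    simp only [he]
    ring
  rw [hM]
  rw [hN] at h7 ⊢
  simp only [conj]
  generalize x i * (x i - 1) * q' i + 2 * n * ((q i - 1) * (q i - x i)) - q i * (q i - 1) = P at *
  have h10 : P ≠ 0 := fun h => h7 (by rw [h, zero_div])
  field_simp

/-- A solution with logarithmic behavior at `0` comes from a solution of the Riccati equation. -/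
theorem eq_chain_of_behaviorAtZero {p : ℤ} (hp : p ≠ 0) {ρ : ℂ} {r φ : ℝ} (hr : 0 < r)
    (hr1 : r ≤ 1) (hφ : 0 < φ) (hφπ : φ ≤ Real.pi) {y : ℂ → ℂ}
    (hy : IsSolutionOn (2 * (p : ℂ)) 0 0 1 (sector r φ) y)
    (hy0 : BehaviorAtZero p ρ (sector r φ) y) {A B : ℂ} (hB : B ≠ 0)
    (hρ : ρ = -(Real.pi * A / B) - shift p) :
    ∀ᶠ x in codiscreteWithin (sector r φ), (chain x (0, ric A B x) p.natAbs).1 = y x := by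
  obtain ⟨m, hm⟩ := Nat.exists_eq_succ_of_ne_zero (Int.natAbs_ne_zero.2 hp)
  obtain ⟨n, hn⟩ : ∃ n : ℂ, n = (m : ℂ) + 1 := ⟨_, rfl⟩
  have hn0 : n ≠ 0 := by rw [hn]; exact_mod_cast Nat.succ_ne_zero m
  have hnp : n ^ 2 = (p : ℂ) ^ 2 := by
    rw [← natAbs_sq_cast, hm, hn]
    push_cast
    rfl
  have hU := isOpen_sector (r := r) hφπ
  have hc := isPreconnected_sector hr hφπ
  have hUs := sector_subset hr1 hφπ
  have hUD : sector r φ ⊆ slitDomain := fun x hx =>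
    mem_slitDomain_of_norm_lt (hUs hx).2 (mem_ball_zero_iff.1 (hUs hx).1)
  have hle := ray_le_nhdsWithin_sector hr hφ
  have hray : ∀ᶠ x in ray, x ∈ sector r φ := hle eventually_mem_nhdsWithin
  have hmodel : ContinuousOn (fun x => 1 - n ^ 2 * (Complex.log x + ρ) ^ 2) (sector r φ) :=
    fun x hx => (continuousAt_const.sub (continuousAt_const.mul
      (((continuousAt_clog (hUs hx).2).add continuousAt_const).pow 2))).continuousWithinAt
  -- The values of y on a discrete set are unconstrained by the equation; in normal form the
  -- function is analytic near 0, so it can be differentiated along the entire germ of the ray.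
  set Y := toMeromorphicNFOn y (sector r φ) with hY
  obtain ⟨hYa, hYt⟩ := analyticAt_toMeromorphicNFOn hU (fun h => (norm_pos_iff.1 h.1) rfl) hy.1
    hmodel (hy0.congr fun x => by rw [hnp])
  have hYy : ∀ᶠ x in codiscreteWithin (sector r φ), Y x = y x :=
    (toMeromorphicNFOn_eqOn_codiscrete hy.1).mono fun x hx => hx.symm
  have hYm : MeromorphicOn Y (sector r φ) := (meromorphicNFOn_toMeromorphicNFOn _ _).meromorphicOn
  have hYs := hy.congr hU hYm hYy
  have hS : Scale ray (fun x => x) fun x => Complex.log x + ρ :=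
    (scale_log tendsto_ray).of_tendsto_sub (c := ρ) (tendsto_const_nhds.congr fun i => by ring)
  have hYr := hYa.filter_mono hle
  have hYtr := hYt.mono_left hle
  have hAsy := asy_conj hS hn0 hYtr (tendsto_deriv_of_quad hr hr1 hφ hφπ hYa hYt)
  set z : ℂ → ℂ × ℂ := fun x => (Y x, conj (2 * n) x (Y x) (deriv Y x)) with hz
  have hH : IsHam 0 (1 / 2 - n) (sector r φ) z := by
    refine ⟨hYm, ?_, ?_⟩
    · have hd : MeromorphicOn (deriv Y) (sector r φ) := hYm.deriv
      exact (((MeromorphicOn.id.mul (MeromorphicOn.id.sub (MeromorphicOn.const 1))).mul hd).add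
        ((MeromorphicOn.const (2 * n)).mul ((hYm.sub (MeromorphicOn.const 1)).mul
          (hYm.sub MeromorphicOn.id))) |>.sub (hYm.mul (hYm.sub (MeromorphicOn.const 1)))).div
        ((((MeromorphicOn.const 2).mul hYm).mul (hYm.sub (MeromorphicOn.const 1))).mul
          (hYm.sub MeromorphicOn.id))
    · filter_upwards [hYs.2, hYm.analyticAt_mem_codiscreteWithin,
        mem_of_eventually_codiscreteWithin] with x h1 h2 h3
      have h4 := hUD h3
      have := hamAt_of_deriv_deriv (b := 1 / 2 - n) h2 (ne_zero_of_mem_slitDomain h4)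
        (sub_ne_zero.1 (one_sub_ne_zero_of_mem_slitDomain h4)).symm h1.1 h1.2.1 h1.2.2.1
        (p := p) (by linear_combination 4 * hnp) h1.2.2.2
      rwa [show 1 - 2 * (1 / 2 - n) = 2 * n by ring] at this
  have hq := tendsto_zero_of_quad hS hYtr
  have hv0 := eventually_ne_zero_of_quad hS (f := fun x => Y x / x) (c₀ := 1) (c₁ := 0)
    (c₂ := -n ^ 2) (hYtr.congr fun i => by ring) (Or.inl (neg_ne_zero.2 (pow_ne_zero 2 hn0)))
  have hv1 := eventually_ne_zero_of_quad hS (f := fun x => Y x / x - 1) (c₀ := 0) (c₁ := 0)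
    (c₂ := -n ^ 2) (hYtr.congr fun i => by ring) (Or.inl (neg_ne_zero.2 (pow_ne_zero 2 hn0)))
  have hzA : ∀ᶠ x in ray, AnaAt z x := by
    filter_upwards [hYr, hv0, hv1, hq.eventually_ne zero_ne_one, hS.ne] with x h1 h2 h3 h4 h5
    have h6 : Y x ≠ 0 := fun h => h2 (by simp [h])
    have h7 : Y x - x ≠ 0 := fun h => h3 (by rw [sub_eq_zero.1 h, div_self h5, sub_self])
    refine ⟨h1, AnalyticAt.div ?_ ?_ (mul_ne_zero (mul_ne_zero (mul_ne_zero two_ne_zero h6)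
      (sub_ne_zero.2 h4)) h7)⟩
    · have := h1.deriv
      fun_prop
    · fun_prop
  rw [hn] at hH
  have hfin := eq_chain_of_asy hU hc hray hUs (A := A) hB m hH hzA (c := ρ)
    (by rw [hρ, shift_eq, hm]; ring)
    (hAsy.congr (fun i => by rw [← hn]) (fun i => by rw [← hn]))
  filter_upwards [hfin, hYy] with x h1 h2
  rw [hm, Nat.succ_eq_add_one, ← h1]
  exact h2

end PainleveSix

end

/-- Every solution, near `0`, of the sixth Painlevé equation with
`θ₀ = 2p`, `θₓ = θ₁ = 0`, `θ∞ = 1` and with logarithmic behavior of parameter `ρ₀` at `0`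
continues meromorphically to the doubly slit plane, with the corresponding logarithmic
behaviors at `0`, `∞` (in the upper half-plane) and `1`. -/
theorem mainTheorem7 (p : ℤ) (hp : p ≠ 0) (ρ₀ : ℂ)
    (r φ : ℝ) (hr : 0 < r) (hr1 : r ≤ 1) (hφ : 0 < φ) (hφπ : φ ≤ Real.pi)
    (y : ℂ → ℂ)
    (hy : PainleveSix.IsSolutionOn (2 * (p : ℂ)) 0 0 1 (PainleveSix.sector r φ) y)
    (hy0 : PainleveSix.BehaviorAtZero p ρ₀ (PainleveSix.sector r φ) y) :
    ∃ Y : ℂ → ℂ,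
      PainleveSix.IsSolutionOn (2 * (p : ℂ)) 0 0 1 PainleveSix.slitDomain Y ∧
      (∀ᶠ x in Filter.codiscreteWithin (PainleveSix.sector r φ), Y x = y x) ∧
      PainleveSix.BehaviorAtZero p ρ₀ PainleveSix.slitDomain Y ∧
      ((Real.pi : ℂ) - Complex.I * (PainleveSix.shift p + ρ₀) ≠ 0 →
        PainleveSix.BehaviorAtInfinity p (PainleveSix.rhoInfinity p ρ₀)
          {x : ℂ | 0 < x.im} Y) ∧
      ((PainleveSix.shift p : ℂ) + ρ₀ ≠ 0 →
        PainleveSix.BehaviorAtOne p (PainleveSix.rhoOne p ρ₀) PainleveSix.slitDomain Y) := by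
  have hπ : (Real.pi : ℂ) ≠ 0 := by exact_mod_cast Real.pi_ne_zero
  -- Only the ratio A/B matters. With B = -π, A becomes `shift p + ρ₀`, and the conditions B + iA ≠
  -- 0 and A ≠ 0 for the behaviors at ∞ and 1 are exactly the two nondegeneracy hypotheses.
  have hB := neg_ne_zero.2 hπ
  obtain ⟨A, hA⟩ : ∃ A : ℂ, A = PainleveSix.shift p + ρ₀ := ⟨_, rfl⟩
  have hρ : ρ₀ = -(Real.pi * A / -Real.pi) - PainleveSix.shift p := by
    rw [hA]
    field_simp
    ring
  refine ⟨fun x => (PainleveSix.chain x (0, PainleveSix.ric A (-Real.pi) x) p.natAbs).1,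
    PainleveSix.isSolutionOn_chain A hB hp,
    PainleveSix.eq_chain_of_behaviorAtZero hp hr hr1 hφ hφπ hy hy0 hB hρ, ?_, ?_, ?_⟩
  · have := PainleveSix.behaviorAtZero_chain hp A hB
    rwa [← hρ] at this
  · intro h
    rw [← hA] at h
    have h1 : -(Real.pi : ℂ) + Complex.I * A ≠ 0 := fun h1 => h (by linear_combination -h1)
    have := PainleveSix.behaviorAtInfinity_chain hp A (-Real.pi) h1
    rwa [show -(Real.pi * A / (-(Real.pi : ℂ) + Complex.I * A)) - PainleveSix.shift p =
        PainleveSix.rhoInfinity p ρ₀ by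
      rw [PainleveSix.rhoInfinity, ← hA, ← div_neg]
      congr 2
      ring] at this
  · intro h
    rw [← hA] at h
    have := PainleveSix.behaviorAtOne_chain hp (-Real.pi) h
    rwa [show -(Real.pi * -(Real.pi : ℂ) / A) - PainleveSix.shift p =
        PainleveSix.rhoOne p ρ₀ by
      rw [PainleveSix.rhoOne, ← hA]
      ring] at this
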